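/- Let $n\ge 1$, $m\ge 2$, $k\ge 1$ be integers, let $1<q<p<\infty$ and $p_1,\dots,p_m\in(1,\infty)$ with $\frac1p=\sum_{i=1}^m\frac1{p_i}$, and put $\frac1r:=\frac1q-\frac1p$. All function spaces are over $\mathbb R^n$ with Lebesgue measure; functions are complex-valued unless said otherwise. **Non-degenerate operators.** Let $s_1,\dots,s_m\in(1,\infty]$ with $\frac1{s_0}:=\sum_i\frac1{s_i}\in(0,\infty)$, and let $T$ be an $m$-linear operator that is bounded from $L^{s_1}\times\cdots\times L^{s_m}$ to $L^{s_0}$. In a slot with $s_i=\infty$, $T$ is understood to be the extension of its values on $C_c^\infty$ by bounded a.e. convergence: if $g_N\in C_c^\infty$ are uniformly bounded and $g_N\to f_i$ a.e., then $T(f_1,\dots,g_N,\dots,f_m)\to T(f_1,\dots,f_i,\dots,f_m)$ in measure. Then $T$ is called a non-degenerate $m$-linear Calderón–Zygmund operator if there are a function $K(x,y_1,\dots,y_m)\in\mathbb C$, defined off the diagonal $x=y_1=\cdots=y_m$ of $(\mathbb R^n)^{m+1}$, constants $C,c_0>0$, and an increasing $\omega:[0,1)\to[0,\infty)$ with $\omega(t)\to0$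 as $t\to0^+$, such that: 1. $|K(x,y_1,\dots,y_m)|\le C\big(\sum_{i}|x-y_i|\big)^{-mn}$ off the diagonal; 2. off the diagonal, and for all $h\in\mathbb R^n$ with $|h|\le\frac12\max_i|x-y_i|$, $$|K(x+h,y_1,\dots,y_m)-K(x,y_1,\dots,y_m)|+\sum_{i=1}^m|K(x,y_1,\dots,y_i+h,\dots,y_m)-K(x,y_1,\dots,y_m)|\le\frac{C}{(\sum_i|x-y_i|)^{mn}}\,\omega\!\left(\frac{|h|}{\sum_i|x-y_i|}\right);$$ 3. for all $f_1,\dots,f_m\in C_c^\infty$ and a.e. $x\notin\bigcap_i\operatorname{supp}f_i$, $\;T(f_1,\dots,f_m)(x)=\int_{\mathbb R^{mn}}K(x,y_1,\dots,y_m)\prod_i f_i(y_i)\,dy_1\cdots dy_m$; 4. for every $y\in\mathbb R^n$ and $\rho>0$ there is $x\in\mathbb R^n\setminus B(y,\rho)$ with $|K(x,y,\dots,y)|\ge\frac1{c_0\rho^{mn}}$. **Iterated commutators.** For a real-valued function $b$ let $[b,S]_1(f_1,\dots,f_m):=b\,S(f_1,\dots,f_m)-S(bf_1,f_2,\dots,f_m)$,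 $T^{(0)}_{b,1}:=T$ and $T^{(k)}_{b,1}:=[b,T^{(k-1)}_{b,1}]_1$. We say that $T^{(k)}_{b,1}$ is bounded from $L^{p_1}\times\cdots\times L^{p_m}$ to $L^q$ if there is a constant $A<\infty$ with $\|T^{(k)}_{b,1}(f_1,\dots,f_m)\|_{L^q}\le A\prod_i\|f_i\|_{L^{p_i}}$ for all $f_i\in L^{p_i}$ at which the commutator is defined through $T$, i.e. $f_i\in L^{s_i}$ for all $i$ and $b^jf_1\in L^{s_1}$ for $0\le j\le k$. **Theorem.** Let $T$ be a non-degenerate $m$-linear Calderón–Zygmund operator and let $b\in L^k_{\mathrm{loc}}(\mathbb R^n)$ be real-valued. If $T^{(k)}_{b,1}$ is bounded from $L^{p_1}\times\cdots\times L^{p_m}$ to $L^q$, then $b\in\dot L^{kr}(\mathbb R^n)$, that is, $b\in L^{kr}_{\mathrm{loc}}(\mathbb R^n)$ and $\inf_{c\in\mathbb R}\|b-c\|_{L^{kr}}<\infty$. -/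

import Mathlib

open MeasureTheory Filter Topology
open scoped ENNReal NNReal

noncomputable section

/-- The Euclidean space `ℝⁿ` with its Euclidean norm and Lebesgue measure. -/
abbrev RSpace (n : ℕ) : Type := EuclideanSpace ℝ (Fin n)

/-- Operators acting on `m`-tuples of complex-valued functions on `ℝⁿ`. -/
abbrev TupleOp (n m : ℕ) : Type := (Fin m → RSpace n → ℂ) → RSpace n → ℂ

/-! ### Function spaces -/

/-- `b ∈ L^u_loc(ℝⁿ)`: `b` is in `L^u` of every ball. -/
def MemLpLoc {n : ℕ} (u : ℝ≥0∞) (b : RSpace n → ℝ) : Prop :=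
  ∀ (z : RSpace n) (R : ℝ), MemLp b u (volume.restrict (Metric.ball z R))

/-- The space of real `L^u` functions modulo constants: `b ∈ L^u_loc(ℝⁿ)` and
`inf_c ‖b - c‖_{L^u} < ∞`. -/
def MemLpModConst {n : ℕ} (u : ℝ≥0∞) (b : RSpace n → ℝ) : Prop :=
  MemLpLoc u b ∧ (⨅ c : ℝ, eLpNorm (fun x => b x - c) u volume) < ∞

/-- Test functions: `f ∈ C_c^∞(ℝⁿ)`, complex-valued. -/
def IsTestFunction {n : ℕ} (f : RSpace n → ℂ) : Prop :=
  ContDiff ℝ (⊤ : ℕ∞) f ∧ HasCompactSupport f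

open Classical in
/-- The class in `L^u` of a function `f`; it is only used for `f ∈ L^u`, where it is the usual
class (outside `L^u` it is `0`). -/
def lpClass {n : ℕ} (u : ℝ≥0∞) (f : RSpace n → ℂ) : Lp ℂ u (volume : Measure (RSpace n)) :=
  if h : MemLp f u volume then h.toLp f else 0

theorem lpClass_coe {n : ℕ} {u : ℝ≥0∞} {f : RSpace n → ℂ} (h : MemLp f u volume) :
    lpClass u f =ᵐ[volume] f := by
  rw [lpClass, dif_pos h]
  exact h.coeFn_toLp

/-! ### Multilinear Calderón–Zygmund operators -/

/-- The type of `m`-linear maps from `L^{s₁} × ⋯ × L^{s_m}` to `L^{s₀}`. -/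
abbrev LpMultilinear (n m : ℕ) (s : Fin m → ℝ≥0∞) (s₀ : ℝ≥0∞) : Type :=
  MultilinearMap ℂ (fun i => Lp ℂ (s i) (volume : Measure (RSpace n)))
    (Lp ℂ s₀ (volume : Measure (RSpace n)))

/-- An `m`-linear map between Lebesgue spaces, read as an operator on tuples of functions
`f_i ∈ L^{s_i}`. -/
def LpMultilinear.onFunctions {n m : ℕ} {s : Fin m → ℝ≥0∞} {s₀ : ℝ≥0∞}
    (T : LpMultilinear n m s s₀) : TupleOp n m :=
  fun f => ⇑(T fun i => lpClass (s i) (f i))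

/-- `K`, a function off the diagonal `x = y₁ = ⋯ = y_m`, satisfies the size condition and the
regularity condition with modulus of continuity `ω`, where `ω : [0,1) → [0,∞)` is increasing
and `ω(t) → 0` as `t → 0⁺`. The condition `∃ i, ‖h‖ ≤ ‖x - y i‖ / 2` says that
`‖h‖ ≤ (1/2) max_i ‖x - y i‖`. -/
structure IsMultilinearCZKernel {n m : ℕ} (K : RSpace n → (Fin m → RSpace n) → ℂ)
    (C : ℝ) (ω : ℝ → ℝ) : Prop where
  modulus_nonneg : ∀ t ∈ Set.Ico (0 : ℝ) 1, 0 ≤ ω t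
  modulus_mono : MonotoneOn ω (Set.Ico (0 : ℝ) 1)
  modulus_tendsto : Tendsto ω (𝓝[>] 0) (𝓝 0)
  size : ∀ (x : RSpace n) (y : Fin m → RSpace n), (¬ ∀ i, y i = x) →
    ‖K x y‖ ≤ C / (∑ i, ‖x - y i‖) ^ (m * n)
  regularity : ∀ (x : RSpace n) (y : Fin m → RSpace n) (h : RSpace n), (¬ ∀ i, y i = x) →
    (∃ i, ‖h‖ ≤ 1 / 2 * ‖x - y i‖) →
    ‖K (x + h) y - K x y‖ + ∑ i, ‖K x (Function.update y i (y i + h)) - K x y‖ ≤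
      C / (∑ i, ‖x - y i‖) ^ (m * n) * ω (‖h‖ / ∑ i, ‖x - y i‖)

/-- `K` is non-degenerate: for all `y` and all `ρ > 0` there is `x ∉ B(y, ρ)` such that
`|K(x, y, …, y)| ≥ 1 / (c₀ ρ^{mn})`. -/
def IsNondegenerateKernel {n m : ℕ} (K : RSpace n → (Fin m → RSpace n) → ℂ) : Prop :=
  ∃ c₀ : ℝ, 0 < c₀ ∧ ∀ (y : RSpace n) (ρ : ℝ), 0 < ρ →
    ∃ x : RSpace n, x ∉ Metric.ball y ρ ∧ 1 / (c₀ * ρ ^ (m * n)) ≤ ‖K x fun _ => y‖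

/-- `S` is represented by the kernel `K` off the intersection of the supports of test
functions. -/
def IsRepresentedBy {n m : ℕ} (S : TupleOp n m)
    (K : RSpace n → (Fin m → RSpace n) → ℂ) : Prop :=
  ∀ f : Fin m → RSpace n → ℂ, (∀ i, IsTestFunction (f i)) →
    ∀ᵐ x ∂(volume : Measure (RSpace n)), x ∉ ⋂ i, tsupport (f i) →
      S f x = ∫ y : Fin m → RSpace n, K x y * ∏ i, f i (y i)

/-- `T` is bounded from `L^{s₁} × ⋯ × L^{s_m}` to `L^{s₀}`, where `s_i ∈ (1, ∞]` and
`1/s₀ = ∑ 1/s_i ∈ (0, ∞)`. In a slot with `s_i = ∞`, where test functions are not dense in norm,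
`T` is the extension of its values on test functions by bounded a.e. convergence. -/
structure IsInitiallyBounded {n m : ℕ} {s : Fin m → ℝ≥0∞} {s₀ : ℝ≥0∞}
    (T : LpMultilinear n m s s₀) : Prop where
  one_lt : ∀ i, 1 < s i
  scaling : s₀⁻¹ = ∑ i, (s i)⁻¹
  ne_top : s₀ ≠ ∞
  bound : ∃ C : ℝ≥0, ∀ f : (i : Fin m) → Lp ℂ (s i) (volume : Measure (RSpace n)),
    eLpNorm (T f) s₀ volume ≤ C * ∏ i, eLpNorm (f i) (s i) volume
  extension_top : ∀ i, s i = ∞ → ∀ f : Fin m → RSpace n → ℂ,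
    (∀ l, MemLp (f l) (s l) volume) → ∀ g : ℕ → RSpace n → ℂ, (∀ N, IsTestFunction (g N)) →
    (∃ M : ℝ, ∀ N x, ‖g N x‖ ≤ M) →
    (∀ᵐ x ∂(volume : Measure (RSpace n)), Tendsto (fun N => g N x) atTop (𝓝 (f i x))) →
    TendstoInMeasure volume (fun N => T.onFunctions (Function.update f i (g N))) atTop
      (T.onFunctions f)

/-- `T` is a non-degenerate `m`-linear Calderón–Zygmund operator. -/
structure IsNondegenerateCZO {n m : ℕ} {s : Fin m → ℝ≥0∞} {s₀ : ℝ≥0∞}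
    (T : LpMultilinear n m s s₀) : Prop where
  initiallyBounded : IsInitiallyBounded T
  kernel : ∃ (K : RSpace n → (Fin m → RSpace n) → ℂ) (C : ℝ) (ω : ℝ → ℝ),
    IsMultilinearCZKernel K C ω ∧ IsRepresentedBy T.onFunctions K ∧ IsNondegenerateKernel K

/-! ### Iterated commutators -/

/-- The commutator in slot `i`:
`[b, S]_i (f₁, …, f_m) = b S(f₁, …, f_m) - S(f₁, …, b f_i, …, f_m)`. -/
def slotCommutator {n m : ℕ} (b : RSpace n → ℝ) (i : Fin m) (S : TupleOp n m) : TupleOp n m :=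
  fun f x => (b x : ℂ) * S f x - S (Function.update f i fun z => (b z : ℂ) * f i z) x

/-- The iterated commutator: `S^{(0)} = S` and `S^{(k+1)} = [b, S^{(k)}]_i`. -/
def iteratedCommutator {n m : ℕ} (b : RSpace n → ℝ) (i : Fin m) : ℕ → TupleOp n m → TupleOp n m
  | 0, S => S
  | k + 1, S => slotCommutator b i (iteratedCommutator b i k S)

/-- The functions `(f₁, …, f_m)` in `L^{p₁} × ⋯ × L^{p_m}` at which the `k`-th iterated
commutator in slot `i` of an operator on `L^{s₁} × ⋯ × L^{s_m}` is defined: `f_l ∈ L^{s_l}` for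
all `l`, and `b^j f_i ∈ L^{s_i}` for `0 ≤ j ≤ k`. -/
def commutatorDomain {n m : ℕ} (s p : Fin m → ℝ≥0∞) (b : RSpace n → ℝ) (i : Fin m) (k : ℕ) :
    Set (Fin m → RSpace n → ℂ) :=
  {f | (∀ l, MemLp (f l) (p l) volume) ∧ (∀ l, MemLp (f l) (s l) volume) ∧
    ∀ j ≤ k, MemLp (fun x => (b x : ℂ) ^ j * f i x) (s i) volume}

/-- `S`, defined on `D`, is bounded from `L^{p₁} × ⋯ × L^{p_m}` to `L^q`. -/
def IsBoundedOnDomain {n m : ℕ} (D : Set (Fin m → RSpace n → ℂ)) (S : TupleOp n m)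
    (p : Fin m → ℝ≥0∞) (q : ℝ≥0∞) : Prop :=
  ∃ C : ℝ≥0, ∀ f ∈ D, eLpNorm (S f) q volume ≤ C * ∏ i, eLpNorm (f i) (p i) volume

end

/-!
The oscillation of `b` on a ball `B(y, l)` is tested by the commutator itself: nondegeneracy gives a
ball `B(x₀, l)` at distance comparable to `l`, a *reflection*, such that `K` is almost constant, of
size `l ^ (-mn)`, when its first variable is in one of the two balls and the others are in the
other. Let `c` be a median of `b` on `B(x₀, l)`. Either on `{b ≥ c}` or on `{b ≤ c}`, and against
indicators of the corresponding half of `B(x₀, l)`, the kernel `(b x - b y) ^ k * K` of the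
commutator has constant phase, and it dominates `|b x - c| ^ k`. The set where `b` is huge is cut
off, because the kernel representation is available only for bounded functions.

To sum these lower bounds over a sparse family of balls, multilinear functions are inserted with
random signs, which isolates the diagonal terms, and the `L^{p_j} → L^q` bound is combined with the
`L^u` bound for sparse sums. By duality, the oscillations `⨍ |b - c| ^ k` are bounded in `ℓ^r`, with
the major subsets as weights. A stopping-time argument on the dyadic subcubes of a large cube
bounds `b` minus a constant, at almost every point, by a sparse sum of the `L^k` oscillations, and
the bound for sparse sums, now in `L^{kr}`, gives `‖b - t‖_{L^{kr}} ≤ V` on the cube with `V`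
independent of the cube. The constants `t` converge along a subsequence as the cubes exhaust `ℝⁿ`.
-/

noncomputable section

section MeasureSpace

variable {α : Type*} [MeasurableSpace α] {μ ν : Measure α}

theorem lintegral_rpow_le_of_mul_meas_lt_le {f : α → ℝ≥0∞} (hf : Measurable f)
    (hf_top : ∀ x, f x ≠ ∞) {C : ℝ≥0∞} {v : ℝ} (hv : 1 < v)
    (h : ∀ t : ℝ≥0∞, t * μ {x | t < f x} ≤ C * ν {x | t < f x}) :
    ∫⁻ x, f x ^ v ∂μ ≤ ENNReal.ofReal (v / (v - 1)) * C * ∫⁻ x, f x ^ (v - 1) ∂ν := by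
  have hv₁ : 0 < v - 1 := sub_pos.2 hv
  have layer_cake (κ : Measure α) {w : ℝ} (hw : 0 < w) : ∫⁻ x, f x ^ w ∂κ = ENNReal.ofReal w *
      ∫⁻ t in Set.Ioi (0 : ℝ), κ {x | ENNReal.ofReal t < f x} * ENNReal.ofReal (t ^ (w - 1)) := by
    calc ∫⁻ x, f x ^ w ∂κ = ∫⁻ x, ENNReal.ofReal ((f x).toReal ^ w) ∂κ :=
          lintegral_congr fun x ↦ by
            rw [← ENNReal.ofReal_rpow_of_nonneg ENNReal.toReal_nonneg hw.le,
              ENNReal.ofReal_toReal (hf_top x)]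
      _ = _ := by
          rw [lintegral_rpow_eq_lintegral_meas_lt_mul κ (.of_forall fun _ ↦ ENNReal.toReal_nonneg)
            hf.ennreal_toReal.aemeasurable hw]
          congr 1
          refine setLIntegral_congr_fun measurableSet_Ioi fun t ht ↦ ?_
          simp only [← ENNReal.ofReal_lt_iff_lt_toReal (le_of_lt ht) (hf_top _)]
  rw [layer_cake μ (hv₁.trans (sub_one_lt v)), layer_cake ν hv₁]
  have h_meas : Measurable fun t : ℝ ↦
      ν {x | ENNReal.ofReal t < f x} * ENNReal.ofReal (t ^ (v - 1 - 1)) :=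
    Measurable.mul (Antitone.measurable fun t t' htt' ↦ measure_mono fun x hx ↦
      (ENNReal.ofReal_le_ofReal htt').trans_lt hx) (by fun_prop)
  have h_ofReal : ENNReal.ofReal v = ENNReal.ofReal (v / (v - 1)) * ENNReal.ofReal (v - 1) := by
    rw [← ENNReal.ofReal_mul (by positivity), div_mul_cancel₀ _ hv₁.ne']
  rw [h_ofReal, mul_assoc, mul_assoc, mul_left_comm C, ← lintegral_const_mul _ h_meas]
  gcongr _ * (_ * ?_)
  refine setLIntegral_mono (h_meas.const_mul C) fun t (ht : 0 < t) ↦ ?_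
  calc μ {x | ENNReal.ofReal t < f x} * ENNReal.ofReal (t ^ (v - 1))
      = ENNReal.ofReal t * μ {x | ENNReal.ofReal t < f x} * ENNReal.ofReal (t ^ (v - 1 - 1)) := by
        rw [mul_right_comm, ← ENNReal.ofReal_mul ht.le, Real.rpow_sub_one ht.ne' (v - 1),
          mul_div_cancel₀ _ ht.ne', mul_comm]
    _ ≤ C * ν {x | ENNReal.ofReal t < f x} * ENNReal.ofReal (t ^ (v - 1 - 1)) :=
        mul_le_mul_left (h _) _
    _ = _ := mul_assoc ..

theorem lintegral_rpow_ne_top_of_le_indicator_const {f : α → ℝ≥0∞} {B : Set α} {c : ℝ≥0∞}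
    (hf : ∀ x, f x ≤ B.indicator (fun _ ↦ c) x) {v : ℝ} (hv : 0 < v) (hc : c ≠ ∞) (hB : μ B ≠ ∞) :
    ∫⁻ x, f x ^ v ∂μ ≠ ∞ := by
  have h_le (x : α) : f x ^ v ≤ B.indicator (fun _ ↦ c ^ v) x := by
    refine (ENNReal.rpow_le_rpow (hf x) hv.le).trans_eq ?_
    by_cases hx : x ∈ B <;> simp [hx, hv]
  exact ne_top_of_le_ne_top (ENNReal.mul_ne_top (ENNReal.rpow_ne_top_of_nonneg hv.le hc) hB) <|
    (lintegral_mono h_le).trans (lintegral_indicator_const_le B _)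

theorem ennreal_rpow_le_of_le_mul_rpow {x D : ℝ≥0∞} {a c : ℝ} (ha : 0 < a) (hc : 0 < c)
    (hac : a + c = 1) (hx : x ≠ ∞) (h : x ≤ D * x ^ c) : x ^ a ≤ D := by
  rcases eq_or_ne x 0 with rfl | hx₀
  · simp [ENNReal.zero_rpow_of_pos ha]
  · refine (ENNReal.mul_le_mul_iff_left (c := x ^ c) (by simp [hx₀, hx])
      (ENNReal.rpow_ne_top_of_nonneg hc.le hx)).1 ?_
    rwa [← ENNReal.rpow_add _ _ hx₀ hx, hac, ENNReal.rpow_one]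

theorem setLIntegral_ne_top_of_lintegral_rpow_ne_top {f : α → ℝ≥0∞} {B : Set α} {v : ℝ}
    (hv : 1 ≤ v) (hf : ∫⁻ x, f x ^ v ∂μ ≠ ∞) (hB : μ B ≠ ∞) : ∫⁻ x in B, f x ∂μ ≠ ∞ := by
  have h_le (x : α) : f x ≤ 1 + f x ^ v := by
    rcases le_total (f x) 1 with h | h
    · exact h.trans le_self_add
    · simpa using (ENNReal.rpow_le_rpow_of_exponent_le h hv).trans le_add_self
  refine ne_top_of_le_ne_top ?_ (lintegral_mono h_le)
  rw [lintegral_add_left measurable_const, setLIntegral_one]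
  exact ENNReal.add_ne_top.2 ⟨hB, ne_top_of_le_ne_top hf (setLIntegral_le_lintegral _ _)⟩

end MeasureSpace

/-! ### Sparse families of balls -/

section SparseFamilies

variable {E ι : Type*} [NormedAddCommGroup E] [MeasurableSpace E]

/-- The Hardy–Littlewood maximal function of `g` restricted to the averages over the balls
`B(y Q, l Q)`. -/
def ballMaximal (μ : Measure E) (y : ι → E) (l : ι → ℝ) (g : E → ℝ≥0∞) (x : E) : ℝ≥0∞ :=
  ⨆ Q, (Metric.closedBall (y Q) (l Q)).indicator
    (fun _ ↦ ⨍⁻ z in Metric.closedBall (y Q) (l Q), g z ∂μ) x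

/-- The balls `B(y Q, l Q)` form a sparse family with constant `C₀` and disjoint major
subsets `A Q`. -/
structure IsSparseFamily (μ : Measure E) (C₀ : ℝ≥0) (y : ι → E) (l : ι → ℝ)
    (A : ι → Set E) : Prop where
  radius_pos : ∀ Q, 0 < l Q
  measurableSet : ∀ Q, MeasurableSet (A Q)
  subset : ∀ Q, A Q ⊆ Metric.closedBall (y Q) (l Q)
  disjoint : Pairwise (Function.onFun Disjoint A)
  measure_le : ∀ Q, μ (Metric.closedBall (y Q) (l Q)) ≤ C₀ * μ (A Q)

variable {μ : Measure E} {y : ι → E} {l : ι → ℝ} {g : E → ℝ≥0∞}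

theorem lt_ballMaximal_iff {x : E} {t : ℝ≥0∞} :
    t < ballMaximal μ y l g x ↔ ∃ Q, x ∈ Metric.closedBall (y Q) (l Q) ∧
      t < ⨍⁻ z in Metric.closedBall (y Q) (l Q), g z ∂μ := by
  simp only [ballMaximal, lt_iSup_iff]
  refine exists_congr fun Q ↦ ?_
  by_cases hx : x ∈ Metric.closedBall (y Q) (l Q) <;> simp [hx]

theorem laverage_le_ballMaximal {x : E} {Q : ι} (hx : x ∈ Metric.closedBall (y Q) (l Q)) :
    ⨍⁻ z in Metric.closedBall (y Q) (l Q), g z ∂μ ≤ ballMaximal μ y l g x :=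
  le_iSup_of_le Q (by rw [Set.indicator_of_mem hx])

variable [Finite ι]

theorem measurable_ballMaximal [OpensMeasurableSpace E] : Measurable (ballMaximal μ y l g) :=
  .iSup fun _ ↦ measurable_const.indicator Metric.isClosed_closedBall.measurableSet

theorem measure_iUnion_closedBall_ne_top [ProperSpace E] [IsFiniteMeasureOnCompacts μ] :
    μ (⋃ Q, Metric.closedBall (y Q) (l Q)) ≠ ∞ := by
  have := Fintype.ofFinite ι
  exact ((measure_iUnion_fintype_le μ _).trans_lt
    (ENNReal.sum_lt_top.2 fun Q _ ↦ measure_closedBall_lt_top)).ne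

variable [NormedSpace ℝ E] [FiniteDimensional ℝ E] [μ.IsAddHaarMeasure]

theorem exists_ballMaximal_le_indicator (hl : ∀ Q, 0 < l Q) {v : ℝ} (hv : 1 ≤ v)
    (hg : ∫⁻ x, g x ^ v ∂μ ≠ ∞) : ∃ c ≠ ∞, ∀ x, ballMaximal μ y l g x ≤
      (⋃ Q, Metric.closedBall (y Q) (l Q)).indicator (fun _ ↦ c) x := by
  have := Fintype.ofFinite ι
  refine ⟨∑ Q, ⨍⁻ z in Metric.closedBall (y Q) (l Q), g z ∂μ,
    ENNReal.sum_ne_top.2 fun Q _ ↦ ?_, fun x ↦ iSup_le fun Q ↦ ?_⟩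
  · rw [setLAverage_eq]
    exact ENNReal.div_ne_top
      (setLIntegral_ne_top_of_lintegral_rpow_ne_top hv hg measure_closedBall_lt_top.ne)
      (Metric.measure_closedBall_pos μ _ (hl Q)).ne'
  · by_cases hx : x ∈ Metric.closedBall (y Q) (l Q)
    swap; · simp [hx]
    rw [Set.indicator_of_mem hx, Set.indicator_of_mem (Set.mem_iUnion_of_mem Q hx)]
    exact Finset.single_le_sum (f := fun Q ↦ ⨍⁻ z in Metric.closedBall (y Q) (l Q), g z ∂μ)
      (fun _ _ ↦ zero_le) (Finset.mem_univ Q)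

variable [BorelSpace E]

local notation "d" => Module.finrank ℝ E

theorem mul_meas_lt_ballMaximal_le (hl : ∀ Q, 0 ≤ l Q) (t : ℝ≥0∞) :
    t * μ {x | t < ballMaximal μ y l g x} ≤
      5 ^ d * ∫⁻ x in {x | t < ballMaximal μ y l g x}, g x ∂μ := by
  have := Fintype.ofFinite ι
  set W := {x | t < ballMaximal μ y l g x}
  let B (Q : ι) := Metric.closedBall (y Q) (l Q)
  obtain ⟨u, hu, h_disj, h_cov⟩ :=
    Vitali.exists_disjoint_subfamily_covering_enlargement_closedBall
      {Q | t < ⨍⁻ z in B Q, g z ∂μ} y l (∑ Q, l Q)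
      (fun Q _ ↦ Finset.single_le_sum (fun P _ ↦ hl P) (Finset.mem_univ Q)) 5 (by norm_num)
  have h_subset : W ⊆ ⋃ Q ∈ u, Metric.closedBall (y Q) (5 * l Q) := fun x hx ↦ by
    obtain ⟨Q, hxQ, hQ⟩ := lt_ballMaximal_iff.1 hx
    obtain ⟨P, hP, hQP⟩ := h_cov Q hQ
    exact Set.mem_biUnion hP (hQP hxQ)
  have h_superset : ⋃ Q ∈ u, B Q ⊆ W :=
    Set.iUnion₂_subset fun Q hQ x hx ↦ lt_ballMaximal_iff.2 ⟨Q, hx, hu hQ⟩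
  have h_enlarge (Q : ι) : μ (Metric.closedBall (y Q) (5 * l Q)) = 5 ^ d * μ (B Q) := by
    rw [Measure.addHaar_closedBall_mul _ _ (by norm_num) (hl Q),
      Measure.addHaar_closedBall_center _ (y Q), ENNReal.ofReal_pow (by norm_num),
      ENNReal.ofReal_ofNat]
  have hu_countable : u.Countable := u.to_countable
  calc t * μ W ≤ t * ∑' Q : u, μ (Metric.closedBall (y Q) (5 * l Q)) := by
        gcongr; exact (measure_mono h_subset).trans (measure_biUnion_le μ hu_countable _)
    _ = 5 ^ d * ∑' Q : u, t * μ (B Q) := by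
        simp only [h_enlarge, ENNReal.tsum_mul_left]; ring
    _ ≤ 5 ^ d * ∑' Q : u, ∫⁻ x in B Q, g x ∂μ := by
        gcongr with Q
        exact ENNReal.mul_le_of_le_div ((hu Q.2).le.trans_eq (setLAverage_eq ..))
    _ = 5 ^ d * ∫⁻ x in ⋃ Q ∈ u, B Q, g x ∂μ := by
        rw [lintegral_biUnion hu_countable
          (fun _ _ ↦ Metric.isClosed_closedBall.measurableSet) h_disj]
    _ ≤ 5 ^ d * ∫⁻ x in W, g x ∂μ := by
        gcongr

theorem lintegral_ballMaximal_rpow_le (hl : ∀ Q, 0 < l Q) (hg : Measurable g) {u v : ℝ}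
    (huv : u.HolderConjugate v) :
    (∫⁻ x, ballMaximal μ y l g x ^ v ∂μ) ^ (1 / v) ≤
      ENNReal.ofReal u * 5 ^ d * (∫⁻ x, g x ^ v ∂μ) ^ (1 / v) := by
  have hv := huv.symm.pos
  by_cases hg_top : ∫⁻ x, g x ^ v ∂μ = ∞
  · simp [hg_top, ENNReal.top_rpow_of_pos (inv_pos.2 hv), ENNReal.mul_top, huv.pos]
  obtain ⟨c, hc, h_le⟩ := exists_ballMaximal_le_indicator (y := y) hl huv.symm.lt.le hg_top
  have hM_top (x : E) : ballMaximal μ y l g x ≠ ∞ := ne_top_of_le_ne_top hc <|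
    (h_le x).trans (Set.indicator_le_self' (fun _ _ ↦ zero_le) x)
  have hJ : ∫⁻ x, ballMaximal μ y l g x ^ v ∂μ ≠ ∞ := lintegral_rpow_ne_top_of_le_indicator_const
    h_le hv hc measure_iUnion_closedBall_ne_top
  have hM := measurable_ballMaximal (μ := μ) (y := y) (l := l) (g := g)
  have h_weak (t : ℝ≥0∞) := mul_meas_lt_ballMaximal_le (μ := μ) (y := y) (g := g)
    (fun Q ↦ (hl Q).le) t
  have h_withDensity (t : ℝ≥0∞) := withDensity_apply (μ := μ) g
    (measurableSet_lt (measurable_const (a := t)) hM)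
  simp only [← h_withDensity] at h_weak
  refine ennreal_rpow_le_of_le_mul_rpow (c := 1 / u) (one_div_pos.2 hv) (one_div_pos.2 huv.pos)
    (by simpa using huv.symm.inv_add_inv_eq_one) hJ ?_
  calc ∫⁻ x, ballMaximal μ y l g x ^ v ∂μ
      ≤ ENNReal.ofReal u * 5 ^ d * ∫⁻ x, g x * ballMaximal μ y l g x ^ (v - 1) ∂μ := by
        have := lintegral_rpow_le_of_mul_meas_lt_le hM hM_top huv.symm.lt h_weak
        rwa [← huv.symm.conjugate_eq, lintegral_withDensity_eq_lintegral_mul _ hg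
          (by fun_prop)] at this
    _ ≤ ENNReal.ofReal u * 5 ^ d * ((∫⁻ x, g x ^ v ∂μ) ^ (1 / v) *
          (∫⁻ x, (ballMaximal μ y l g x ^ (v - 1)) ^ u ∂μ) ^ (1 / u)) := by
        gcongr
        exact ENNReal.lintegral_mul_le_Lp_mul_Lq μ huv.symm hg.aemeasurable (by fun_prop)
    _ = _ := by
        simp only [← ENNReal.rpow_mul, huv.symm.sub_one_mul_conj, mul_assoc]

namespace IsSparseFamily

omit [Finite ι]

variable [Fintype ι] {C₀ : ℝ≥0} {A : ι → Set E}

theorem lintegral_sum_indicator_mul_le (hA : IsSparseFamily μ C₀ y l A) (α : ι → ℝ≥0)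
    (hg : Measurable g) :
    ∫⁻ x, (∑ Q, (Metric.closedBall (y Q) (l Q)).indicator (fun _ ↦ (α Q : ℝ≥0∞)) x) * g x ∂μ ≤
      C₀ * ∫⁻ x, (∑ Q, (A Q).indicator (fun _ ↦ (α Q : ℝ≥0∞)) x) * ballMaximal μ y l g x ∂μ := by
  have lintegral_sum {B : ι → Set E} (hB : ∀ Q, MeasurableSet (B Q)) {f : E → ℝ≥0∞}
      (hf : Measurable f) : ∫⁻ x, (∑ Q, (B Q).indicator (fun _ ↦ (α Q : ℝ≥0∞)) x) * f x ∂μ =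
        ∑ Q, α Q * ∫⁻ x in B Q, f x ∂μ := by
    simp only [Finset.sum_mul, ← Set.indicator_mul_left]
    rw [lintegral_finsetSum _ fun Q _ ↦ (hf.const_mul _).indicator (hB Q)]
    exact Finset.sum_congr rfl fun Q _ ↦ by
      rw [lintegral_indicator (hB Q), lintegral_const_mul _ hf]
  rw [lintegral_sum (fun Q ↦ Metric.isClosed_closedBall.measurableSet) hg,
    lintegral_sum hA.measurableSet measurable_ballMaximal, Finset.mul_sum]
  refine Finset.sum_le_sum fun Q _ ↦ ?_
  calc (α Q : ℝ≥0∞) * ∫⁻ x in Metric.closedBall (y Q) (l Q), g x ∂μ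
      = α Q * (μ (Metric.closedBall (y Q) (l Q)) *
          ⨍⁻ x in Metric.closedBall (y Q) (l Q), g x ∂μ) := by
        rw [measure_mul_setLAverage _ measure_closedBall_lt_top.ne]
    _ ≤ α Q * (C₀ * μ (A Q) * ⨍⁻ x in Metric.closedBall (y Q) (l Q), g x ∂μ) := by
        gcongr; exact hA.measure_le Q
    _ = C₀ * (α Q * ∫⁻ _ in A Q, ⨍⁻ x in Metric.closedBall (y Q) (l Q), g x ∂μ ∂μ) := by
        rw [setLIntegral_const]; ring
    _ ≤ C₀ * (α Q * ∫⁻ x in A Q, ballMaximal μ y l g x ∂μ) := by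
        gcongr _ * (_ * ?_)
        exact setLIntegral_mono measurable_ballMaximal fun x hx ↦
          laverage_le_ballMaximal (hA.subset Q hx)

omit [NormedSpace ℝ E] [FiniteDimensional ℝ E] [μ.IsAddHaarMeasure] [BorelSpace E] in
theorem lintegral_sum_indicator_rpow (hA : IsSparseFamily μ C₀ y l A) (α : ι → ℝ≥0) {u : ℝ}
    (hu : 0 < u) : ∫⁻ x, (∑ Q, (A Q).indicator (fun _ ↦ (α Q : ℝ≥0∞)) x) ^ u ∂μ =
      ∑ Q, (α Q : ℝ≥0∞) ^ u * μ (A Q) := by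
  have h_pow (x : E) : (∑ Q, (A Q).indicator (fun _ ↦ (α Q : ℝ≥0∞)) x) ^ u =
      ∑ Q, (A Q).indicator (fun _ ↦ (α Q : ℝ≥0∞) ^ u) x := by
    by_cases hx : ∃ Q, x ∈ A Q
    · obtain ⟨Q, hQ⟩ := hx
      have h_notMem (P : ι) (hP : P ≠ Q) : x ∉ A P := (hA.disjoint hP).notMem_of_mem_right hQ
      rw [Fintype.sum_eq_single Q fun P hP ↦ Set.indicator_of_notMem (h_notMem P hP) _,
        Fintype.sum_eq_single Q fun P hP ↦ Set.indicator_of_notMem (h_notMem P hP) _,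
        Set.indicator_of_mem hQ, Set.indicator_of_mem hQ]
    · simp_all
  rw [lintegral_congr h_pow,
    lintegral_finsetSum _ fun Q _ ↦ measurable_const.indicator (hA.measurableSet Q)]
  exact Finset.sum_congr rfl fun Q _ ↦ lintegral_indicator_const (hA.measurableSet Q) _

theorem lintegral_sum_closedBall_rpow_le (hA : IsSparseFamily μ C₀ y l A) (α : ι → ℝ≥0) {u : ℝ}
    (hu : 1 < u) :
    (∫⁻ x, (∑ Q, (Metric.closedBall (y Q) (l Q)).indicator (fun _ ↦ (α Q : ℝ≥0∞)) x) ^ u ∂μ)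
      ^ (1 / u) ≤
      C₀ * (ENNReal.ofReal u * 5 ^ d) * (∑ Q, (α Q : ℝ≥0∞) ^ u * μ (A Q)) ^ (1 / u) := by
  let v := u.conjExponent
  have huv : u.HolderConjugate v := .conjExponent hu
  let B (Q : ι) := Metric.closedBall (y Q) (l Q)
  set φ : E → ℝ≥0∞ := fun x ↦ ∑ Q, (B Q).indicator (fun _ ↦ (α Q : ℝ≥0∞)) x
  have hφ : Measurable φ := Finset.measurable_fun_sum _ fun Q _ ↦
    measurable_const.indicator Metric.isClosed_closedBall.measurableSet
  have hφ_le (x : E) : φ x ≤ (⋃ Q, B Q).indicator (fun _ ↦ ∑ Q, (α Q : ℝ≥0∞)) x := by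
    by_cases hx : x ∈ ⋃ Q, B Q
    · rw [Set.indicator_of_mem hx]
      exact Finset.sum_le_sum fun Q _ ↦ Set.indicator_le_self' (fun _ _ ↦ zero_le) x
    · simp_all [φ]
  have h_sum_top : ∑ Q, (α Q : ℝ≥0∞) ≠ ∞ := by simp
  have hφ_top : ∫⁻ x, φ x ^ u ∂μ ≠ ∞ :=
    lintegral_rpow_ne_top_of_le_indicator_const hφ_le huv.pos h_sum_top
      measure_iUnion_closedBall_ne_top
  refine ennreal_rpow_le_of_le_mul_rpow (c := 1 / v) (one_div_pos.2 huv.pos)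
    (one_div_pos.2 huv.symm.pos) (by simpa using huv.inv_add_inv_eq_one) hφ_top ?_
  calc ∫⁻ x, φ x ^ u ∂μ = ∫⁻ x, φ x * φ x ^ (u - 1) ∂μ := by
        refine lintegral_congr fun x ↦ ?_
        have hx : φ x ≠ ∞ := ne_top_of_le_ne_top h_sum_top <|
          (hφ_le x).trans (Set.indicator_le_self' (fun _ _ ↦ zero_le) x)
        rcases eq_or_ne (φ x) 0 with h | h
        · simp [h, huv.pos]
        · rw [ENNReal.rpow_sub _ _ h hx, ENNReal.rpow_one, ENNReal.mul_div_cancel h hx]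
    _ ≤ C₀ * ∫⁻ x, (∑ Q, (A Q).indicator (fun _ ↦ (α Q : ℝ≥0∞)) x) *
          ballMaximal μ y l (fun x ↦ φ x ^ (u - 1)) x ∂μ :=
        hA.lintegral_sum_indicator_mul_le α (by fun_prop)
    _ ≤ C₀ * ((∑ Q, (α Q : ℝ≥0∞) ^ u * μ (A Q)) ^ (1 / u) *
          (∫⁻ x, ballMaximal μ y l (fun x ↦ φ x ^ (u - 1)) x ^ v ∂μ) ^ (1 / v)) := by
        gcongr
        rw [← hA.lintegral_sum_indicator_rpow α huv.pos]
        exact ENNReal.lintegral_mul_le_Lp_mul_Lq μ huv (Measurable.aemeasurable <|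
          Finset.measurable_fun_sum _ fun Q _ ↦ measurable_const.indicator (hA.measurableSet Q))
          measurable_ballMaximal.aemeasurable
    _ ≤ C₀ * ((∑ Q, (α Q : ℝ≥0∞) ^ u * μ (A Q)) ^ (1 / u) *
          (ENNReal.ofReal u * 5 ^ d * (∫⁻ x, φ x ^ u ∂μ) ^ (1 / v))) := by
        gcongr
        simpa only [← ENNReal.rpow_mul, huv.sub_one_mul_conj] using
          lintegral_ballMaximal_rpow_le (y := y) hA.radius_pos (hφ.pow_const (u - 1)) huv
    _ = _ := by ring

theorem eLpNorm_sum_le {F : Type*} [NormedAddCommGroup F] (hA : IsSparseFamily μ C₀ y l A)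
    (α : ι → ℝ≥0) {w : ι → E → F} (hw : ∀ Q x,
      ‖w Q x‖ₑ ≤ (Metric.closedBall (y Q) (l Q)).indicator (fun _ ↦ (α Q : ℝ≥0∞)) x)
    {u : ℝ} (hu : 1 < u) : eLpNorm (fun x ↦ ∑ Q, w Q x) (ENNReal.ofReal u) μ ≤
      C₀ * (ENNReal.ofReal u * 5 ^ d) * (∑ Q, (α Q : ℝ≥0∞) ^ u * μ (A Q)) ^ (1 / u) := by
  have hu₀ : 0 < u := zero_lt_one.trans hu
  rw [eLpNorm_eq_lintegral_rpow_enorm_toReal (by simpa) ENNReal.ofReal_ne_top,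
    ENNReal.toReal_ofReal hu₀.le]
  refine le_trans ?_ (hA.lintegral_sum_closedBall_rpow_le α hu)
  gcongr with x
  exact (enorm_sum_le _ _).trans (Finset.sum_le_sum fun Q _ ↦ hw Q x)

end IsSparseFamily

end SparseFamilies

/-! ### Dyadic cubes -/

section DyadicCubes

variable {n : ℕ} {L : ℝ} {i j : ℕ} {κ : Fin n → ℤ} {x y : RSpace n}

/-- The index of the dyadic cube of generation `j` that contains `x`, where the cube of
generation `0` and index `0` is `[-L/2, L/2)ⁿ`. -/
def gridMap (L : ℝ) (j : ℕ) (x : RSpace n) : Fin n → ℤ :=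
  fun i ↦ ⌊2 ^ j * (x i / L + 1 / 2)⌋

/-- The dyadic cube of generation `j` and index `κ`. -/
def gridCube (L : ℝ) (j : ℕ) (κ : Fin n → ℤ) : Set (RSpace n) :=
  gridMap L j ⁻¹' {κ}

/-- The lower corner of a dyadic cube; it serves as the centre of a ball containing the cube. -/
def gridCorner (L : ℝ) (j : ℕ) (κ : Fin n → ℤ) : RSpace n :=
  WithLp.toLp 2 fun i ↦ L * (κ i / 2 ^ j - 1 / 2)

/-- The diameter of the dyadic cubes of generation `j`. -/
def gridRadius (n : ℕ) (L : ℝ) (j : ℕ) : ℝ := L / 2 ^ j * √n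

/-- The ratio of the volume of a ball of radius `gridRadius n L j` to that of a dyadic cube of
generation `j`. -/
def gridRatio (n : ℕ) : ℝ≥0 := (volume (Metric.closedBall (0 : RSpace n) √n)).toNNReal

/-- The ball around a dyadic cube, with the corner of the cube as its centre. -/
def gridBall (L : ℝ) (j : ℕ) (κ : Fin n → ℤ) : Set (RSpace n) :=
  Metric.closedBall (gridCorner L j κ) (gridRadius n L j)

/-- `D` is a union of dyadic cubes of generation `j`. -/
def IsGridUnion (L : ℝ) (j : ℕ) (D : Set (RSpace n)) : Prop :=
  ∀ ⦃x y⦄, gridMap L j x = gridMap L j y → x ∈ D → y ∈ D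

theorem mem_gridCube_gridMap (L : ℝ) (j : ℕ) (x : RSpace n) : x ∈ gridCube L j (gridMap L j x) :=
  rfl

theorem measurable_gridMap (L : ℝ) (j : ℕ) : Measurable (gridMap (n := n) L j) :=
  measurable_pi_lambda _ fun _ ↦ Int.measurable_floor.comp (by fun_prop)

theorem measurableSet_gridCube : MeasurableSet (gridCube L j κ) :=
  measurable_gridMap L j (measurableSet_singleton κ)

theorem gridMap_eq_ediv_two (L : ℝ) (j : ℕ) (x : RSpace n) :
    gridMap L j x = fun i ↦ gridMap L (j + 1) x i / 2 := by
  funext i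
  have h := Int.floor_div_natCast (2 ^ (j + 1) * (x i / L + 1 / 2)) 2
  rw [pow_succ, mul_right_comm, Nat.cast_ofNat, mul_div_cancel_right₀ _ two_ne_zero] at h
  rw [gridMap, gridMap, h, pow_succ, mul_right_comm, Nat.cast_ofNat]

theorem gridMap_eq_of_le (hij : i ≤ j) (h : gridMap L j x = gridMap L j y) :
    gridMap L i x = gridMap L i y := by
  induction j, hij using Nat.le_induction with
  | base => exact h
  | succ j _ ih => exact ih (by rw [gridMap_eq_ediv_two, h, ← gridMap_eq_ediv_two])

theorem gridCube_subset_gridCube_of_le (hij : i ≤ j) (x : RSpace n) :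
    gridCube L j (gridMap L j x) ⊆ gridCube L i (gridMap L i x) :=
  fun _ hy ↦ gridMap_eq_of_le hij hy

theorem mem_gridCube_iff (hL : 0 < L) :
    x ∈ gridCube L j κ ↔
      ∀ i, gridCorner L j κ i ≤ x i ∧ x i < gridCorner L j κ i + L / 2 ^ j := by
  have h_pow : (0 : ℝ) < 2 ^ j := by positivity
  simp only [gridCube, Set.mem_preimage, Set.mem_singleton_iff, funext_iff, gridMap,
    Int.floor_eq_iff, gridCorner]
  refine forall_congr' fun i ↦ and_congr ?_ ?_
  · rw [← div_le_iff₀' h_pow, ← sub_le_iff_le_add, le_div_iff₀' hL]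
  · rw [← lt_div_iff₀' h_pow, ← lt_sub_iff_add_lt, div_lt_iff₀' hL]
    congr! 1
    ring

theorem volume_gridCube (hL : 0 < L) (j : ℕ) (κ : Fin n → ℤ) :
    volume (gridCube L j κ) = ENNReal.ofReal ((L / 2 ^ j) ^ n) := by
  have h_eq : gridCube L j κ = (WithLp.ofLp : RSpace n → Fin n → ℝ) ⁻¹' (Set.univ.pi fun i ↦
      Set.Ico (gridCorner L j κ i) (gridCorner L j κ i + L / 2 ^ j)) := by
    ext x
    simp [mem_gridCube_iff hL]
  rw [h_eq, (PiLp.volume_preserving_ofLp (Fin n)).measure_preimage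
    (MeasurableSet.univ_pi fun i ↦ measurableSet_Ico).nullMeasurableSet, Real.volume_pi_Ico]
  simp [ENNReal.ofReal_pow (by positivity : 0 ≤ L / 2 ^ j)]

theorem volume_gridCube_ne_zero (hL : 0 < L) : volume (gridCube L j κ) ≠ 0 := by
  rw [volume_gridCube hL, ENNReal.ofReal_ne_zero_iff]
  positivity

theorem volume_gridCube_ne_top (hL : 0 < L) : volume (gridCube L j κ) ≠ ∞ := by
  rw [volume_gridCube hL]
  exact ENNReal.ofReal_ne_top

theorem volume_real_gridCube (hL : 0 < L) (j : ℕ) (κ : Fin n → ℤ) :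
    volume.real (gridCube L j κ) = (L / 2 ^ j) ^ n := by
  rw [Measure.real, volume_gridCube hL, ENNReal.toReal_ofReal (by positivity)]

theorem volume_real_gridCube_pos (hL : 0 < L) : 0 < volume.real (gridCube L j κ) := by
  rw [volume_real_gridCube hL]
  positivity

theorem gridRadius_pos (hn : 0 < n) (hL : 0 < L) (j : ℕ) : 0 < gridRadius n L j := by
  unfold gridRadius
  positivity

theorem gridCube_subset_gridBall (hL : 0 < L) : gridCube L j κ ⊆ gridBall L j κ := by
  intro x hx
  rw [mem_gridCube_iff hL] at hx
  rw [gridBall, Metric.mem_closedBall, EuclideanSpace.dist_eq, gridRadius]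
  have hℓ : 0 ≤ L / 2 ^ j := by positivity
  calc √(∑ i, dist (x i) (gridCorner L j κ i) ^ 2) ≤ √(∑ _i : Fin n, (L / 2 ^ j) ^ 2) := by
        gcongr with i
        rw [Real.dist_eq, abs_of_nonneg (by linarith [hx i])]
        linarith [hx i]
    _ = L / 2 ^ j * √n := by
        rw [Finset.sum_const, Finset.card_univ, Fintype.card_fin, nsmul_eq_mul, mul_comm,
          Real.sqrt_mul (by positivity), Real.sqrt_sq hℓ]

theorem isBounded_gridCube (hL : 0 < L) : Bornology.IsBounded (gridCube L j κ) :=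
  Metric.isBounded_closedBall.subset (gridCube_subset_gridBall hL)

theorem gridRatio_pos (hn : 0 < n) : 0 < gridRatio n :=
  ENNReal.toNNReal_pos (Metric.measure_closedBall_pos _ _ (by positivity)).ne'
    measure_closedBall_lt_top.ne

theorem volume_gridBall (hL : 0 < L) (j : ℕ) (κ : Fin n → ℤ) :
    volume (gridBall L j κ) = gridRatio n * volume (gridCube L j κ) := by
  rw [gridBall, gridRadius, Measure.addHaar_closedBall_mul _ _ (by positivity) (by positivity),
    finrank_euclideanSpace_fin, volume_gridCube hL, gridRatio,
    ENNReal.coe_toNNReal measure_closedBall_lt_top.ne, mul_comm]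

theorem ball_subset_gridCube {R : ℝ} (hL : 0 < L) (hRL : 2 * R ≤ L) :
    Metric.ball (0 : RSpace n) R ⊆ gridCube L 0 0 := by
  intro x hx
  rw [mem_ball_zero_iff] at hx
  refine (mem_gridCube_iff hL).2 fun i ↦ ?_
  have hxi := abs_lt.1 ((PiLp.norm_apply_le x i).trans_lt hx)
  simp only [gridCorner, Pi.zero_apply, Int.cast_zero, pow_zero]
  constructor <;> linarith

theorem finite_gridMap_image_gridCube_zero (L : ℝ) (j : ℕ) :
    (gridMap (n := n) L j '' gridCube L 0 0).Finite := by
  refine (Set.finite_Icc (0 : Fin n → ℤ) fun _ ↦ 2 ^ j).subset ?_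
  rintro _ ⟨x, hx, rfl⟩
  have hx (i : Fin n) : 0 ≤ x i / L + 1 / 2 ∧ x i / L + 1 / 2 < 1 := by
    simpa [gridMap, Int.floor_eq_iff] using congrFun hx i
  refine ⟨fun i ↦ Int.floor_nonneg.2 (mul_nonneg (by positivity) (hx i).1), fun i ↦ ?_⟩
  refine Int.cast_le (R := ℝ).1 ((Int.floor_le _).trans ?_)
  push_cast
  exact mul_le_of_le_one_right (by positivity) (hx i).2.le

theorem IsGridUnion.preimage_image {D : Set (RSpace n)} (hD : IsGridUnion L j D) :
    gridMap L j ⁻¹' (gridMap L j '' D) = D :=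
  Set.Subset.antisymm (fun _ ⟨_, hx, h⟩ ↦ hD h hx) (Set.subset_preimage_image _ _)

theorem IsGridUnion.measurableSet {D : Set (RSpace n)} (hD : IsGridUnion L j D) :
    MeasurableSet D := by
  rw [← hD.preimage_image]
  exact measurable_gridMap L j (Set.to_countable _).measurableSet

theorem isGridUnion_gridCube (hij : i ≤ j) (κ : Fin n → ℤ) :
    IsGridUnion L j (gridCube L i κ) :=
  fun _ _ h hx ↦ (gridMap_eq_of_le hij h).symm.trans hx

theorem IsGridUnion.mul_volume_real_le {D : Set (RSpace n)} (hD : IsGridUnion L j D) (hL : 0 < L)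
    (hD_top : volume D ≠ ∞) {g : RSpace n → ℝ} (hg : IntegrableOn g D) {t : ℝ}
    (ht : ∀ x ∈ D, t ≤ ⨍ y in gridCube L j (gridMap L j x), g y) :
    t * volume.real D ≤ ∫ y in D, g y := by
  have h_iUnion : D = ⋃ κ : gridMap (n := n) L j '' D, gridCube L j κ.1 := by
    conv_lhs => rw [← hD.preimage_image, ← Set.biUnion_preimage_singleton, Set.biUnion_eq_iUnion]
    rfl
  have h_disj : Pairwise
      (Function.onFun Disjoint fun κ : gridMap (n := n) L j '' D ↦ gridCube (n := n) L j κ.1) :=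
    fun κ κ' h ↦ Disjoint.preimage _ (Set.disjoint_singleton.2 fun h' ↦ h (Subtype.ext h'))
  have h_sum {f : RSpace n → ℝ} (hf : IntegrableOn f D) :
      HasSum (fun κ : gridMap (n := n) L j '' D ↦ ∫ y in gridCube L j κ.1, f y)
        (∫ y in D, f y) := by
    rw [h_iUnion] at hf
    have := hasSum_integral_iUnion (fun _ ↦ measurableSet_gridCube) h_disj hf
    rwa [← h_iUnion] at this
  calc t * volume.real D = ∫ _ in D, t := by simp [mul_comm]
    _ ≤ ∫ y in D, g y := by
        refine hasSum_le ?_ (h_sum (integrableOn_const hD_top)) (h_sum hg)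
        rintro ⟨_, x, hx, rfl⟩
        have := ht x hx
        rw [setAverage_eq, smul_eq_mul, le_inv_mul_iff₀ (volume_real_gridCube_pos hL)] at this
        simpa using this

end DyadicCubes

section Averages

variable {n : ℕ} {L : ℝ} {j : ℕ}

theorem setAverage_nonneg {α : Type*} [MeasurableSpace α] {μ : Measure α} {f : α → ℝ}
    (hf : ∀ x, 0 ≤ f x) (A : Set α) : 0 ≤ ⨍ x in A, f x ∂μ := by
  rw [setAverage_eq]
  exact smul_nonneg (by positivity) (integral_nonneg hf)

theorem norm_setAverage_sub_le {α F : Type*} [MeasurableSpace α] [NormedAddCommGroup F]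
    [NormedSpace ℝ F] [CompleteSpace F] {μ : Measure α} {A : Set α} (hA₀ : μ A ≠ 0)
    (hA : μ A ≠ ∞) {f : α → F} (hf : IntegrableOn f A μ) (c : F) :
    ‖(⨍ x in A, f x ∂μ) - c‖ ≤ ⨍ x in A, ‖f x - c‖ ∂μ := by
  have h_eq : (⨍ x in A, f x ∂μ) - c = ⨍ x in A, (f x - c) ∂μ := by
    rw [setAverage_eq, setAverage_eq, integral_sub hf (integrableOn_const hA), smul_sub,
      ← setAverage_eq μ (fun _ ↦ c), setAverage_const hA₀ hA]
  rw [h_eq, setAverage_eq, setAverage_eq, norm_smul, Real.norm_of_nonneg (by positivity)]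
  exact mul_le_mul_of_nonneg_left (norm_integral_le_integral_norm _) (by positivity)

theorem setAverage_gridCube_le (hn : 0 < n) (hL : 0 < L) {κ : Fin n → ℤ} {g : RSpace n → ℝ}
    (hg₀ : ∀ x, 0 ≤ g x) (hg : IntegrableOn g (gridBall L j κ)) :
    ⨍ z in gridCube L j κ, g z ≤ gridRatio n * ⨍ z in gridBall L j κ, g z := by
  have h_volume : volume.real (gridBall L j κ) = gridRatio n * volume.real (gridCube L j κ) := by
    simp [Measure.real, volume_gridBall hL]
  have h_ratio : (gridRatio n : ℝ) ≠ 0 := by exact_mod_cast (gridRatio_pos hn).ne'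
  rw [setAverage_eq, setAverage_eq, h_volume, smul_eq_mul, smul_eq_mul, mul_inv, ← mul_assoc,
    mul_inv_cancel_left₀ h_ratio]
  exact mul_le_mul_of_nonneg_left (setIntegral_mono_set hg (.of_forall hg₀)
    (gridCube_subset_gridBall hL).eventuallyLE) (by positivity)

theorem tendsto_gridRadius (hn : 0 < n) (hL : 0 < L) :
    Tendsto (gridRadius n L) atTop (𝓝[>] 0) := by
  refine tendsto_nhdsWithin_iff.2 ⟨?_, .of_forall fun j ↦ gridRadius_pos hn hL j⟩
  have h := tendsto_const_nhds (x := L).div_atTop (tendsto_pow_atTop_atTop_of_one_lt one_lt_two)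
  change Tendsto (fun j ↦ L / 2 ^ j * √n) atTop (𝓝 0)
  simpa using h.mul_const √n

theorem ae_tendsto_setAverage_gridCube (hn : 0 < n) (hL : 0 < L) {F : Type*}
    [NormedAddCommGroup F] [NormedSpace ℝ F] [CompleteSpace F] {f : RSpace n → F}
    (hf : LocallyIntegrable f volume) :
    ∀ᵐ x, Tendsto (fun j ↦ ⨍ y in gridCube L j (gridMap L j x), f y) atTop (𝓝 (f x)) := by
  filter_upwards [IsUnifLocDoublingMeasure.ae_tendsto_average_norm_sub volume hf 1] with x hx
  have h_balls : Tendsto (fun j ↦ (gridRatio n : ℝ) *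
      ⨍ y in gridBall L j (gridMap L j x), ‖f y - f x‖) atTop (𝓝 0) := by
    simpa [gridBall] using (hx (fun j ↦ gridCorner L j (gridMap L j x)) (gridRadius n L)
      (tendsto_gridRadius hn hL) (.of_forall fun j ↦ by
        simpa [gridBall] using
          gridCube_subset_gridBall hL (mem_gridCube_gridMap L j x))).const_mul _
  have hf_ball (j : ℕ) : IntegrableOn f (gridBall L j (gridMap L j x)) :=
    hf.integrableOn_isCompact (isCompact_closedBall _ _)
  refine tendsto_iff_norm_sub_tendsto_zero.2 (squeeze_zero (fun _ ↦ norm_nonneg _)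
    (fun j ↦ (norm_setAverage_sub_le (volume_gridCube_ne_zero hL) (volume_gridCube_ne_top hL)
      ((hf_ball j).mono_set (gridCube_subset_gridBall hL)) _).trans ?_) h_balls)
  exact setAverage_gridCube_le hn hL (fun _ ↦ norm_nonneg _)
    ((hf_ball j).sub (integrableOn_const measure_closedBall_lt_top.ne)).norm

end Averages

section LocalSpaces

variable {n : ℕ} {b : RSpace n → ℝ} {A : Set (RSpace n)}

theorem MemLpLoc.memLp_restrict {u : ℝ≥0∞} (hb : MemLpLoc u b) (hA : Bornology.IsBounded A) :
    MemLp b u (volume.restrict A) := by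
  obtain ⟨R, hR⟩ := hA.subset_ball 0
  exact (hb 0 R).mono_measure (Measure.restrict_mono hR le_rfl)

theorem MemLpLoc.integrableOn_pow_abs_sub {k : ℕ} (hb : MemLpLoc (k : ℝ≥0∞) b)
    (hA : Bornology.IsBounded A) (t : ℝ) : IntegrableOn (fun x ↦ |b x - t| ^ k) A := by
  have : IsFiniteMeasure (volume.restrict A) :=
    ⟨by simpa using hA.measure_lt_top⟩
  exact ((hb.memLp_restrict hA).sub (memLp_const t)).integrable_norm_pow'

theorem abs_setAverage_sub_le_rpow {α : Type*} [MeasurableSpace α] {μ : Measure α} {A : Set α}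
    (hA₀ : μ A ≠ 0) (hA : μ A ≠ ∞) {k : ℕ} (hk : 1 ≤ k) {f : α → ℝ}
    (hf : MemLp f k (μ.restrict A)) (t : ℝ) :
    |(⨍ x in A, f x ∂μ) - t| ≤ (⨍ x in A, |f x - t| ^ k ∂μ) ^ (1 / k : ℝ) := by
  have : IsFiniteMeasure (μ.restrict A) := ⟨by simpa using hA.lt_top⟩
  have : NeZero (μ.restrict A) := ⟨by simpa using hA₀⟩
  have hft : MemLp (fun x ↦ f x - t) k (μ.restrict A) := hf.sub (memLp_const t)
  have h_one : (1 : ℝ≥0∞) ≤ k := by exact_mod_cast hk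
  have h_jensen : (⨍ x in A, |f x - t| ∂μ) ^ k ≤ ⨍ x in A, |f x - t| ^ k ∂μ :=
    (convexOn_pow k).map_average_le (s := Set.Ici (0 : ℝ)) (by fun_prop) isClosed_Ici
      (.of_forall fun x ↦ abs_nonneg (f x - t)) (hft.integrable h_one).abs hft.integrable_norm_pow'
  have h_nonneg : 0 ≤ ⨍ x in A, |f x - t| ∂μ := setAverage_nonneg (fun _ ↦ abs_nonneg _) A
  refine (norm_setAverage_sub_le hA₀ hA (hf.integrable h_one) t).trans ?_
  rw [one_div]
  refine (Real.le_rpow_inv_iff_of_pos h_nonneg ((pow_nonneg h_nonneg k).trans h_jensen)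
    (by positivity)).2 ?_
  simpa using h_jensen

end LocalSpaces

/-! ### Sparse domination by oscillations -/

section SparseDomination

variable {n : ℕ} {L : ℝ} {k : ℕ} {b : RSpace n → ℝ} {c : ℕ × (Fin n → ℤ) → ℝ} {i j N : ℕ}
  {κ : Fin n → ℤ} {x y : RSpace n}

/-- The average of `|b - c|^k` over the dyadic cube of generation `j` that contains `x`, where
`c` is the constant attached to the cube of generation `i` that contains `x`. -/
def gridOsc (L : ℝ) (k : ℕ) (b : RSpace n → ℝ) (c : ℕ × (Fin n → ℤ) → ℝ) (i j : ℕ)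
    (x : RSpace n) : ℝ :=
  ⨍ y in gridCube L j (gridMap L j x), |b y - c (i, gridMap L i x)| ^ k

open Classical in
/-- The generation of the smallest stopping cube, among those of generation at most `j`, that
contains `x`. A cube is a stopping cube when the average of `|b - c|^k` over it exceeds twice the
average over the preceding stopping cube, whose constant is `c`. -/
def stopLevel (L : ℝ) (k : ℕ) (b : RSpace n → ℝ) (c : ℕ × (Fin n → ℤ) → ℝ) :
    ℕ → RSpace n → ℕ
  | 0, _ => 0
  | j + 1, x =>
    if 2 * gridOsc L k b c (stopLevel L k b c j x) (stopLevel L k b c j x) x <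
      gridOsc L k b c (stopLevel L k b c j x) (j + 1) x then j + 1 else stopLevel L k b c j x

/-- The smallest stopping cube of generation at most `j` that contains `x`. -/
def stopIndex (L : ℝ) (k : ℕ) (b : RSpace n → ℝ) (c : ℕ × (Fin n → ℤ) → ℝ) (j : ℕ)
    (x : RSpace n) : ℕ × (Fin n → ℤ) :=
  (stopLevel L k b c j x, gridMap L (stopLevel L k b c j x) x)

/-- The union of the stopping cubes of generation `i + 1` whose preceding stopping cube is the
cube of generation `j` and index `κ`. -/
def stopChildren (L : ℝ) (k : ℕ) (b : RSpace n → ℝ) (c : ℕ × (Fin n → ℤ) → ℝ) (j : ℕ)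
    (κ : Fin n → ℤ) (i : ℕ) : Set (RSpace n) :=
  {x ∈ gridCube L j κ | stopLevel L k b c i x = j ∧ stopLevel L k b c (i + 1) x = i + 1}

/-- The indices of the stopping cubes of generation at most `N` that meet the cube of generation
`0` and index `0`. -/
def stopCubes (L : ℝ) (k : ℕ) (b : RSpace n → ℝ) (c : ℕ × (Fin n → ℤ) → ℝ) (N : ℕ) :
    Set (ℕ × (Fin n → ℤ)) :=
  {I | I.1 ≤ N ∧ ∃ x ∈ gridCube L 0 0, stopLevel L k b c I.1 x = I.1 ∧ gridMap L I.1 x = I.2}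

theorem gridOsc_congr (hij : i ≤ j) (h : gridMap L j x = gridMap L j y) :
    gridOsc L k b c i j x = gridOsc L k b c i j y := by
  rw [gridOsc, gridOsc, h, gridMap_eq_of_le hij h]

theorem gridOsc_nonneg (i j : ℕ) (x : RSpace n) : 0 ≤ gridOsc L k b c i j x :=
  setAverage_nonneg (fun _ ↦ by positivity) _

theorem gridOsc_succ_le (hL : 0 < L) (hb : MemLpLoc k b) (i j : ℕ) (x : RSpace n) :
    gridOsc L k b c i (j + 1) x ≤ 2 ^ n * gridOsc L k b c i j x := by
  have h_integral :
      ∫ y in gridCube L (j + 1) (gridMap L (j + 1) x), |b y - c (i, gridMap L i x)| ^ k ≤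
        ∫ y in gridCube L j (gridMap L j x), |b y - c (i, gridMap L i x)| ^ k :=
    setIntegral_mono_set (hb.integrableOn_pow_abs_sub (isBounded_gridCube hL) _)
      (.of_forall fun _ ↦ by positivity)
      (gridCube_subset_gridCube_of_le j.le_succ x).eventuallyLE
  have h_volume : ((L / 2 ^ (j + 1)) ^ n)⁻¹ = 2 ^ n * ((L / 2 ^ j) ^ n)⁻¹ := by
    rw [pow_succ, ← div_div, div_pow _ (2 : ℝ), inv_div, div_eq_mul_inv]
  rw [gridOsc, gridOsc, setAverage_eq, setAverage_eq, volume_real_gridCube hL,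
    volume_real_gridCube hL, smul_eq_mul, smul_eq_mul, h_volume, mul_assoc]
  gcongr

theorem gridOsc_eq_zero_of_le (hL : 0 < L) (hb : MemLpLoc k b) {j' : ℕ} (hj : j ≤ j')
    (h : gridOsc L k b c i j x = 0) : gridOsc L k b c i j' x = 0 := by
  induction j', hj using Nat.le_induction with
  | base => exact h
  | succ j' _ ih =>
    exact le_antisymm ((gridOsc_succ_le hL hb i j' x).trans (by simp [ih])) (gridOsc_nonneg _ _ _)

theorem stopLevel_le (j : ℕ) (x : RSpace n) : stopLevel L k b c j x ≤ j := by
  induction j with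
  | zero => simp [stopLevel]
  | succ j ih =>
    rw [stopLevel]
    split_ifs <;> omega

theorem stopLevel_congr (h : gridMap L j x = gridMap L j y) :
    stopLevel L k b c j x = stopLevel L k b c j y := by
  induction j with
  | zero => simp [stopLevel]
  | succ j ih =>
    have h_le := stopLevel_le (L := L) (k := k) (b := b) (c := c) j y
    rw [stopLevel, stopLevel, ih (gridMap_eq_of_le j.le_succ h), gridOsc_congr (by omega) h,
      gridOsc_congr le_rfl (gridMap_eq_of_le (by omega) h)]

theorem stopLevel_succ_eq (j : ℕ) (x : RSpace n) :
    stopLevel L k b c (j + 1) x = j + 1 ∨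
      stopLevel L k b c (j + 1) x = stopLevel L k b c j x := by
  rw [stopLevel]
  split_ifs <;> simp

theorem monotone_stopLevel (x : RSpace n) : Monotone fun j ↦ stopLevel L k b c j x := by
  refine monotone_nat_of_le_succ fun j ↦ ?_
  have h_le := stopLevel_le (L := L) (k := k) (b := b) (c := c) j x
  rcases stopLevel_succ_eq (L := L) (k := k) (b := b) (c := c) j x with h | h <;> omega

theorem gridOsc_stopLevel_le (j : ℕ) (x : RSpace n) :
    gridOsc L k b c (stopLevel L k b c j x) j x ≤
      2 * gridOsc L k b c (stopLevel L k b c j x) (stopLevel L k b c j x) x := by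
  have h_self (i : ℕ) : gridOsc L k b c i i x ≤ 2 * gridOsc L k b c i i x :=
    le_mul_of_one_le_left (gridOsc_nonneg _ _ _) one_le_two
  cases j with
  | zero => simpa [stopLevel] using h_self 0
  | succ j =>
    rw [stopLevel]
    split_ifs with h
    · exact h_self _
    · exact not_lt.1 h

theorem lt_gridOsc_of_mem_stopChildren (hx : x ∈ stopChildren L k b c j κ i) :
    2 * gridOsc L k b c j j x < gridOsc L k b c j (i + 1) x := by
  obtain ⟨-, h_level, h_succ⟩ := hx
  have h_le := stopLevel_le (L := L) (k := k) (b := b) (c := c) i x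
  by_contra h
  rw [stopLevel, h_level, if_neg h] at h_succ
  omega

theorem stopChildren_subset : stopChildren L k b c j κ i ⊆ gridCube L j κ :=
  fun _ hx ↦ hx.1

theorem isGridUnion_stopChildren (hij : j ≤ i) :
    IsGridUnion L (i + 1) (stopChildren L k b c j κ i) := by
  rintro x y h ⟨h_cube, h_level, h_succ⟩
  exact ⟨isGridUnion_gridCube (by omega) κ h h_cube,
    (stopLevel_congr (gridMap_eq_of_le i.le_succ h)).symm.trans h_level,
    (stopLevel_congr h).symm.trans h_succ⟩

theorem pairwise_disjoint_stopChildren :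
    Pairwise (Function.onFun Disjoint (stopChildren L k b c j κ)) := by
  refine (pairwise_disjoint_on _).2 fun i i' hii' ↦ Set.disjoint_left.2 ?_
  rintro x ⟨-, h_level, h_succ⟩ ⟨-, h_level', -⟩
  have h_mono : stopLevel L k b c (i + 1) x ≤ stopLevel L k b c i' x := monotone_stopLevel x hii'
  have h_le := stopLevel_le (L := L) (k := k) (b := b) (c := c) i x
  omega

theorem mul_volume_real_stopChildren_le (hL : 0 < L) (hb : MemLpLoc k b) (hij : j ≤ i) :
    2 * (⨍ y in gridCube L j κ, |b y - c (j, κ)| ^ k) *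
        volume.real (stopChildren L k b c j κ i) ≤
      ∫ y in stopChildren L k b c j κ i, |b y - c (j, κ)| ^ k := by
  refine (isGridUnion_stopChildren hij).mul_volume_real_le hL
    (measure_ne_top_of_subset stopChildren_subset (volume_gridCube_ne_top hL))
    (hb.integrableOn_pow_abs_sub ((isBounded_gridCube hL).subset stopChildren_subset) _)
    fun x hx ↦ ?_
  have hκ : gridMap L j x = κ := stopChildren_subset hx
  simpa only [gridOsc, hκ] using (lt_gridOsc_of_mem_stopChildren hx).le

theorem two_mul_volume_biUnion_stopChildren_le (hL : 0 < L) (hb : MemLpLoc k b) (j N : ℕ)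
    (κ : Fin n → ℤ) :
    2 * volume (⋃ i ∈ Finset.Ico j N, stopChildren L k b c j κ i) ≤ volume (gridCube L j κ) := by
  set U := ⋃ i ∈ Finset.Ico j N, stopChildren L k b c j κ i
  set g : RSpace n → ℝ := fun y ↦ |b y - c (j, κ)| ^ k
  set a := ⨍ y in gridCube L j κ, g y with ha_def
  have hUQ : U ⊆ gridCube L j κ := Set.iUnion₂_subset fun i _ ↦ stopChildren_subset
  have hU_top : volume U ≠ ∞ := measure_ne_top_of_subset hUQ (volume_gridCube_ne_top hL)
  have hg : IntegrableOn g (gridCube L j κ) :=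
    hb.integrableOn_pow_abs_sub (isBounded_gridCube hL) _
  rcases U.eq_empty_or_nonempty with hU | ⟨x, hx⟩
  · simp [hU]
  have ha : 0 < a := by
    obtain ⟨i, hi, hx⟩ := Set.mem_iUnion₂.1 hx
    have hκ : gridMap L j x = κ := stopChildren_subset hx
    refine (setAverage_nonneg (fun _ ↦ by positivity) _).lt_of_ne' fun ha₀ ↦ ?_
    have h_osc : gridOsc L k b c j j x = 0 := by rw [gridOsc, hκ]; exact ha₀
    have h_lt := lt_gridOsc_of_mem_stopChildren hx
    rw [gridOsc_eq_zero_of_le hL hb ((Finset.mem_Ico.1 hi).1.trans i.le_succ) h_osc, h_osc] at h_lt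
    simp at h_lt
  have h_meas : ∀ i ∈ Finset.Ico j N, MeasurableSet (stopChildren L k b c j κ i) :=
    fun i hi ↦ (isGridUnion_stopChildren (Finset.mem_Ico.1 hi).1).measurableSet
  have h_volume : 2 * a * volume.real U ≤ a * volume.real (gridCube L j κ) := by
    calc 2 * a * volume.real U
        = ∑ i ∈ Finset.Ico j N, 2 * a * volume.real (stopChildren L k b c j κ i) := by
          rw [measureReal_biUnion_finset (pairwise_disjoint_stopChildren.set_pairwise _) h_meas
            fun i _ ↦ measure_ne_top_of_subset stopChildren_subset (volume_gridCube_ne_top hL),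
            Finset.mul_sum]
      _ ≤ ∑ i ∈ Finset.Ico j N, ∫ y in stopChildren L k b c j κ i, g y :=
          Finset.sum_le_sum fun i hi ↦
            mul_volume_real_stopChildren_le hL hb (Finset.mem_Ico.1 hi).1
      _ = ∫ y in U, g y := (integral_biUnion_finset _ h_meas
          (pairwise_disjoint_stopChildren.set_pairwise _)
          fun i _ ↦ hg.mono_set stopChildren_subset).symm
      _ ≤ ∫ y in gridCube L j κ, g y :=
          setIntegral_mono_set hg (.of_forall fun _ ↦ by positivity) hUQ.eventuallyLE
      _ = a * volume.real (gridCube L j κ) := by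
          rw [ha_def, setAverage_eq, smul_eq_mul, mul_comm,
            mul_inv_cancel_left₀ (volume_real_gridCube_pos hL).ne']
  rw [← ENNReal.toReal_le_toReal (ENNReal.mul_ne_top (by simp) hU_top)
    (volume_gridCube_ne_top hL), ENNReal.toReal_mul]
  exact le_of_mul_le_mul_left (by simpa [Measure.real, mul_left_comm, mul_assoc] using h_volume) ha

theorem gridCube_subset_stopChildren_union (hj : j ≤ N)
    (hκ : ∀ x ∈ gridCube L j κ, stopLevel L k b c j x = j) :
    gridCube L j κ ⊆ (⋃ i ∈ Finset.Ico j N, stopChildren L k b c j κ i) ∪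
      {x | stopIndex L k b c N x = (j, κ)} := by
  intro x hx
  by_contra! h_not
  rw [Set.mem_union, not_or] at h_not
  obtain ⟨h_children, h_index⟩ := h_not
  have h_level (i : ℕ) (hi : j ≤ i) (hiN : i ≤ N) : stopLevel L k b c i x = j := by
    induction i, hi using Nat.le_induction with
    | base => exact hκ x hx
    | succ i hi ih =>
      rcases stopLevel_succ_eq (L := L) (k := k) (b := b) (c := c) i x with h | h
      · have h_mem : x ∈ stopChildren L k b c j κ i := ⟨hx, ih (by omega), h⟩
        exact absurd (Set.mem_iUnion₂.2 ⟨i, Finset.mem_Ico.2 ⟨hi, hiN⟩, h_mem⟩) h_children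
      · exact h.trans (ih (by omega))
  have hxκ : gridMap L j x = κ := hx
  exact h_index (by simp [stopIndex, h_level N hj le_rfl, hxκ])

theorem volume_gridCube_le_two_mul (hL : 0 < L) (hb : MemLpLoc k b) (hj : j ≤ N)
    (hx : stopLevel L k b c j x = j) :
    volume (gridCube L j (gridMap L j x)) ≤
      2 * volume {y | stopIndex L k b c N y = (j, gridMap L j x)} := by
  set Q := gridCube L j (gridMap L j x)
  set U := ⋃ i ∈ Finset.Ico j N, stopChildren L k b c j (gridMap L j x) i
  set E := {y | stopIndex L k b c N y = (j, gridMap L j x)}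
  have h_cover : volume Q ≤ volume U + volume E :=
    (measure_mono (gridCube_subset_stopChildren_union hj
      fun y hy ↦ (stopLevel_congr hy).trans hx)).trans (measure_union_le _ _)
  refine (ENNReal.add_le_add_iff_left (volume_gridCube_ne_top hL : volume Q ≠ ∞)).1 ?_
  calc volume Q + volume Q = 2 * volume Q := (two_mul _).symm
    _ ≤ 2 * volume U + 2 * volume E := (mul_le_mul_right h_cover 2).trans_eq (mul_add _ _ _)
    _ ≤ volume Q + 2 * volume E := by
        gcongr
        exact two_mul_volume_biUnion_stopChildren_le hL hb j N _

theorem abs_setAverage_gridCube_sub_le (hL : 0 < L) (hk : 1 ≤ k) (hb : MemLpLoc k b) (i j : ℕ)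
    (x : RSpace n) :
    |(⨍ y in gridCube L j (gridMap L j x), b y) - c (i, gridMap L i x)| ≤
      gridOsc L k b c i j x ^ (1 / k : ℝ) :=
  abs_setAverage_sub_le_rpow (volume_gridCube_ne_zero hL) (volume_gridCube_ne_top hL) hk
    (hb.memLp_restrict (isBounded_gridCube hL)) _

theorem abs_setAverage_sub_stopIndex_le (hL : 0 < L) (hk : 1 ≤ k) (hb : MemLpLoc k b)
    (hij : i ≤ j) (hji : j ≤ i + 1) (x : RSpace n) :
    |(⨍ y in gridCube L j (gridMap L j x), b y) - c (stopIndex L k b c i x)| ≤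
      (2 * 2 ^ n) ^ (1 / k : ℝ) *
        gridOsc L k b c (stopLevel L k b c i x) (stopLevel L k b c i x) x ^ (1 / k : ℝ) := by
  refine (abs_setAverage_gridCube_sub_le hL hk hb _ _ _).trans ?_
  rw [← Real.mul_rpow (by positivity) (gridOsc_nonneg _ _ _)]
  refine Real.rpow_le_rpow (gridOsc_nonneg _ _ _) ?_ (by positivity)
  have h_stop := gridOsc_stopLevel_le (L := L) (k := k) (b := b) (c := c) i x
  rw [mul_comm 2, mul_assoc]
  obtain rfl | rfl : j = i ∨ j = i + 1 := by omega
  · exact h_stop.trans (le_mul_of_one_le_left ((gridOsc_nonneg _ _ _).trans h_stop)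
      (one_le_pow₀ one_le_two))
  · exact (gridOsc_succ_le hL hb _ _ _).trans (by gcongr)

theorem abs_stopIndex_sub_le (hL : 0 < L) (hk : 1 ≤ k) (hb : MemLpLoc k b) (N : ℕ)
    (x : RSpace n) :
    |c (stopIndex L k b c N x) - c (0, gridMap L 0 x)| + (2 * 2 ^ n) ^ (1 / k : ℝ) *
        gridOsc L k b c (stopLevel L k b c N x) (stopLevel L k b c N x) x ^ (1 / k : ℝ) ≤
      (1 + (2 * 2 ^ n) ^ (1 / k : ℝ)) * ∑ j ∈ Finset.range (N + 1),
        if stopLevel L k b c j x = j then gridOsc L k b c j j x ^ (1 / k : ℝ) else 0 := by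
  have h_nonneg (j : ℕ) : 0 ≤ gridOsc L k b c j j x ^ (1 / k : ℝ) :=
    Real.rpow_nonneg (gridOsc_nonneg _ _ _) _
  induction N with
  | zero =>
    simp only [stopIndex, stopLevel, sub_self, abs_zero, zero_add, Finset.range_one,
      Finset.sum_singleton, if_true]
    linarith [h_nonneg 0]
  | succ N ih =>
    rw [Finset.sum_range_succ]
    rcases stopLevel_succ_eq (L := L) (k := k) (b := b) (c := c) N x with h | h
    · have h_index : stopIndex L k b c (N + 1) x = (N + 1, gridMap L (N + 1) x) := by
        rw [stopIndex, h]
      have h_new : |c (N + 1, gridMap L (N + 1) x) -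
            ⨍ y in gridCube L (N + 1) (gridMap L (N + 1) x), b y| ≤
          gridOsc L k b c (N + 1) (N + 1) x ^ (1 / k : ℝ) := by
        rw [abs_sub_comm]
        exact abs_setAverage_gridCube_sub_le hL hk hb _ _ _
      have h_old := abs_setAverage_sub_stopIndex_le (c := c) hL hk hb N.le_succ le_rfl x
      have h_triangle := (abs_sub_le (c (N + 1, gridMap L (N + 1) x))
        (⨍ y in gridCube L (N + 1) (gridMap L (N + 1) x), b y) (c (0, gridMap L 0 x))).trans
        (add_le_add_right (abs_sub_le _ (c (stopIndex L k b c N x)) _) _)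
      rw [if_pos h, mul_add, h_index, h]
      linarith
    · have h_index : stopIndex L k b c (N + 1) x = stopIndex L k b c N x := by
        rw [stopIndex, h, stopIndex]
      rw [h_index, h]
      refine ih.trans (mul_le_mul_of_nonneg_left (le_add_of_nonneg_right ?_) (by positivity))
      split_ifs
      exacts [h_nonneg _, le_rfl]

theorem finite_stopCubes (L : ℝ) (k : ℕ) (b : RSpace n → ℝ) (c : ℕ × (Fin n → ℤ) → ℝ) (N : ℕ) :
    (stopCubes L k b c N).Finite := by
  refine ((Set.finite_Iic N).biUnion fun j _ ↦
    (finite_gridMap_image_gridCube_zero L j).image (Prod.mk j)).subset ?_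
  rintro ⟨j, κ⟩ ⟨hj, x, hx, -, hκ⟩
  exact Set.mem_iUnion₂.2 ⟨j, hj, κ, ⟨x, hx, hκ⟩, rfl⟩

theorem sum_gridOsc_le_sum_stopCubes (N : ℕ) (hx : x ∈ gridCube L 0 0) :
    (∑ j ∈ Finset.range (N + 1),
        if stopLevel L k b c j x = j then gridOsc L k b c j j x ^ (1 / k : ℝ) else 0) ≤
      ∑ I ∈ (finite_stopCubes L k b c N).toFinset, (gridCube L I.1 I.2).indicator
        (fun _ ↦ (⨍ y in gridCube L I.1 I.2, |b y - c I| ^ k) ^ (1 / k : ℝ)) x := by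
  have h_inj : Set.InjOn (fun j ↦ (j, gridMap L j x))
      ((Finset.range (N + 1)).filter fun j ↦ stopLevel L k b c j x = j) :=
    fun _ _ _ _ h ↦ congrArg Prod.fst h
  rw [← Finset.sum_filter]
  calc _ = ∑ I ∈ ((Finset.range (N + 1)).filter fun j ↦ stopLevel L k b c j x = j).image
          (fun j ↦ (j, gridMap L j x)), (gridCube L I.1 I.2).indicator
          (fun _ ↦ (⨍ y in gridCube L I.1 I.2, |b y - c I| ^ k) ^ (1 / k : ℝ)) x := by
        rw [Finset.sum_image h_inj]
        refine Finset.sum_congr rfl fun j _ ↦ ?_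
        rw [Set.indicator_of_mem (mem_gridCube_gridMap L j x), gridOsc]
    _ ≤ _ := by
        refine Finset.sum_le_sum_of_subset_of_nonneg (fun I hI ↦ ?_) fun I _ _ ↦
          Set.indicator_nonneg (fun _ _ ↦ Real.rpow_nonneg
            (setAverage_nonneg (fun _ ↦ by positivity) _) _) _
        obtain ⟨j, hj, rfl⟩ := Finset.mem_image.1 hI
        obtain ⟨hjN, h_level⟩ := Finset.mem_filter.1 hj
        exact (Set.Finite.mem_toFinset _).2
          ⟨Nat.lt_succ_iff.1 (Finset.mem_range.1 hjN), x, hx, h_level, rfl⟩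

theorem exists_sparse_domination (hL : 0 < L) (hk : 1 ≤ k) (hb : MemLpLoc k b)
    (c : ℕ × (Fin n → ℤ) → ℝ) (N : ℕ) :
    ∃ (S : Finset (ℕ × (Fin n → ℤ))) (E : ℕ × (Fin n → ℤ) → Set (RSpace n)),
      (∀ I, MeasurableSet (E I)) ∧ (∀ I, E I ⊆ gridCube L I.1 I.2) ∧
      Pairwise (Function.onFun Disjoint E) ∧
      (∀ I ∈ S, volume (gridCube L I.1 I.2) ≤ 2 * volume (E I)) ∧
      ∀ x ∈ gridCube L 0 0, |(⨍ y in gridCube L N (gridMap L N x), b y) - c (0, 0)| ≤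
        (1 + (2 * 2 ^ n) ^ (1 / k : ℝ)) * ∑ I ∈ S, (gridCube L I.1 I.2).indicator
          (fun _ ↦ (⨍ y in gridCube L I.1 I.2, |b y - c I| ^ k) ^ (1 / k : ℝ)) x := by
  refine ⟨(finite_stopCubes L k b c N).toFinset, fun I ↦ {x | stopIndex L k b c N x = I},
    fun I ↦ ?_, ?_, fun I I' hII' ↦ ?_, ?_, fun x hx ↦ ?_⟩
  · refine IsGridUnion.measurableSet (L := L) (j := N) fun x y hxy hx ↦ ?_
    rw [Set.mem_ofPred_eq] at hx ⊢
    rw [stopIndex, ← stopLevel_congr hxy, ← gridMap_eq_of_le (stopLevel_le N x) hxy]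
    exact hx
  · rintro I x rfl
    exact mem_gridCube_gridMap L _ x
  · exact Set.disjoint_left.2 fun x hx hx' ↦ hII' (hx.symm.trans hx')
  · intro I hI
    obtain ⟨hI, x, -, hx, hκ⟩ := (Set.Finite.mem_toFinset _).1 hI
    simpa only [hκ] using volume_gridCube_le_two_mul hL hb hI hx
  · have h_last := abs_setAverage_sub_stopIndex_le (c := c) hL hk hb le_rfl N.le_succ x
    have h_chain := abs_stopIndex_sub_le (c := c) hL hk hb N x
    have hx₀ : gridMap L 0 x = 0 := hx
    rw [hx₀] at h_chain
    refine (abs_sub_le _ (c (stopIndex L k b c N x)) _).trans <|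
      (by linarith : _ ≤ _).trans (h_chain.trans (mul_le_mul_of_nonneg_left ?_ (by positivity)))
    exact sum_gridOsc_le_sum_stopCubes N hx

end SparseDomination

/-! ### Approximation by test functions -/

section BoundedFunctions

/-- `f` is a bounded measurable function that vanishes off the set `A`. -/
structure IsBddOn {n : ℕ} (A : Set (RSpace n)) (f : RSpace n → ℂ) : Prop where
  measurable : Measurable f
  exists_norm_le : ∃ M : ℝ, ∀ x, ‖f x‖ ≤ M
  eq_zero : ∀ x ∉ A, f x = 0

/-- The test functions `g N`, supported in `A`, converge to `f` boundedly and almost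
everywhere. -/
structure IsTestApproximation {n : ℕ} (A : Set (RSpace n)) (g : ℕ → RSpace n → ℂ)
    (f : RSpace n → ℂ) : Prop where
  isTestFunction : ∀ N, IsTestFunction (g N)
  tsupport_subset : ∀ N, tsupport (g N) ⊆ A
  exists_norm_le : ∃ M : ℝ, ∀ N x, ‖g N x‖ ≤ M
  ae_tendsto : ∀ᵐ x ∂(volume : Measure (RSpace n)), Tendsto (g · x) atTop (𝓝 (f x))

variable {n m : ℕ} {A A' : Set (RSpace n)} {f : RSpace n → ℂ}

theorem IsBddOn.mono (hf : IsBddOn A f) (h : A ⊆ A') : IsBddOn A' f :=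
  ⟨hf.measurable, hf.exists_norm_le, fun x hx ↦ hf.eq_zero x (mt (@h x) hx)⟩

theorem IsBddOn.norm_le_indicator (hf : IsBddOn A f) {M : ℝ} (hM : ∀ x, ‖f x‖ ≤ M)
    (x : RSpace n) : ‖f x‖ ≤ A.indicator (fun _ ↦ M) x := by
  by_cases hx : x ∈ A
  · simpa [hx] using hM x
  · simp [hx, hf.eq_zero x hx]

theorem IsBddOn.memLp (hf : IsBddOn A f) (hA : Bornology.IsBounded A) (u : ℝ≥0∞) :
    MemLp f u volume := by
  obtain ⟨M, hM⟩ := hf.exists_norm_le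
  obtain ⟨R, hR⟩ := hA.subset_closedBall 0
  exact (memLp_indicator_const u measurableSet_closedBall M
    (.inr measure_closedBall_lt_top.ne)).mono' hf.measurable.aestronglyMeasurable
    (.of_forall ((hf.mono hR).norm_le_indicator hM))

theorem IsBddOn.mul_left {a : RSpace n → ℂ} (hf : IsBddOn A f) (ha : Measurable a) {M : ℝ}
    (haM : ∀ x ∈ A, ‖a x‖ ≤ M) : IsBddOn A fun x ↦ a x * f x where
  measurable := ha.mul hf.measurable
  exists_norm_le := by
    obtain ⟨M', hM'⟩ := hf.exists_norm_le
    refine ⟨|M| * M', fun x ↦ ?_⟩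
    by_cases hx : x ∈ A
    · rw [norm_mul]
      exact mul_le_mul ((haM x hx).trans (le_abs_self M)) (hM' x) (norm_nonneg _) (abs_nonneg M)
    · rw [hf.eq_zero x hx, mul_zero, norm_zero]
      exact mul_nonneg (abs_nonneg M) ((norm_nonneg _).trans (hM' x))
  eq_zero x hx := by rw [hf.eq_zero x hx, mul_zero]

theorem IsBddOn.update {F : Fin m → RSpace n → ℂ} (hF : ∀ l, IsBddOn A (F l)) (i : Fin m)
    (hf : IsBddOn A f) (l : Fin m) : IsBddOn A (Function.update F i f l) :=
  Function.forall_update_iff F (fun _ ↦ IsBddOn A) |>.2 ⟨hf, fun l _ ↦ hF l⟩ l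

theorem IsTestFunction.isBddOn (hf : IsTestFunction f) (hA : tsupport f ⊆ A) : IsBddOn A f where
  measurable := hf.1.continuous.measurable
  exists_norm_le := hf.2.exists_bound_of_continuous hf.1.continuous
  eq_zero _ hx := image_eq_zero_of_notMem_tsupport (mt (@hA _) hx)

theorem IsTestApproximation.isBddOn {g : ℕ → RSpace n → ℂ} (hg : IsTestApproximation A g f)
    (N : ℕ) : IsBddOn A (g N) :=
  (hg.isTestFunction N).isBddOn (hg.tsupport_subset N)

/-- A bump function at scale `δ / (N + 1)`, used to mollify. -/
def mollifierBump (n : ℕ) {δ : ℝ} (hδ : 0 < δ) (N : ℕ) : ContDiffBump (0 : RSpace n) where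
  rIn := δ / (N + 1) / 2
  rOut := δ / (N + 1)
  rIn_pos := by positivity
  rIn_lt_rOut := half_lt_self (by positivity)

theorem mollifierBump_rOut_le {δ : ℝ} (hδ : 0 < δ) (N : ℕ) :
    (mollifierBump n hδ N).rOut ≤ δ :=
  div_le_self hδ.le (by simp)

theorem tendsto_mollifierBump_rOut {δ : ℝ} (hδ : 0 < δ) :
    Tendsto (fun N ↦ (mollifierBump n hδ N).rOut) atTop (𝓝 0) := by
  simpa [mollifierBump, div_eq_mul_inv] using
    (tendsto_one_div_add_atTop_nhds_zero_nat (𝕜 := ℝ)).const_mul δ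

theorem tsupport_convolution_subset_closedBall {φ : RSpace n → ℝ} {y : RSpace n} {δ ρ : ℝ}
    (hφ : Function.support φ ⊆ Metric.ball 0 δ)
    (hf : Function.support f ⊆ Metric.closedBall y ρ) :
    tsupport (convolution φ f (ContinuousLinearMap.lsmul ℝ ℝ) volume) ⊆
      Metric.closedBall y (ρ + δ) := by
  refine closure_minimal ((support_convolution_subset _).trans ?_) Metric.isClosed_closedBall
  rintro _ ⟨u, hu, v, hv, rfl⟩
  have huδ : ‖u‖ < δ := mem_ball_zero_iff.1 (hφ hu)
  have hvρ : ‖v - y‖ ≤ ρ := mem_closedBall_iff_norm.1 (hf hv)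
  rw [mem_closedBall_iff_norm, add_sub_assoc]
  linarith [norm_add_le u (v - y)]

theorem IsBddOn.exists_isTestApproximation {y : RSpace n} {ρ ρ' : ℝ} (hρ : ρ < ρ')
    (hf : IsBddOn (Metric.closedBall y ρ) f) :
    ∃ g, IsTestApproximation (Metric.closedBall y ρ') g f := by
  obtain ⟨M, hM⟩ := hf.exists_norm_le
  have hδ : 0 < ρ' - ρ := sub_pos.2 hρ
  let φ := mollifierBump n hδ
  let g := fun N ↦ convolution ((φ N).normed volume) f (ContinuousLinearMap.lsmul ℝ ℝ) volume
  have hf_loc : LocallyIntegrable f volume :=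
    (memLp_one_iff_integrable.1 (hf.memLp Metric.isBounded_closedBall 1)).locallyIntegrable
  have h_support (N : ℕ) : tsupport (g N) ⊆ Metric.closedBall y ρ' := by
    have hφ : Function.support ((φ N).normed volume) ⊆ Metric.ball 0 (ρ' - ρ) := by
      rw [(φ N).support_normed_eq]
      exact Metric.ball_subset_ball (mollifierBump_rOut_le hδ N)
    simpa using tsupport_convolution_subset_closedBall hφ
      fun x hx ↦ by_contra fun h ↦ hx (hf.eq_zero x h)
  refine ⟨g, fun N ↦ ⟨?_, ?_⟩, h_support, ⟨M, fun N x ↦ ?_⟩, ?_⟩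
  · exact (φ N).hasCompactSupport_normed.contDiff_convolution_left _ (φ N).contDiff_normed hf_loc
  · exact (isCompact_closedBall y ρ').of_isClosed_subset (isClosed_tsupport _) (h_support N)
  · have := dist_convolution_le (z₀ := (0 : ℂ)) (x₀ := x) (ε := M)
      ((norm_nonneg _).trans (hM 0)) (φ N).support_normed_eq.le (φ N).nonneg_normed
      ((φ N).integral_normed (μ := volume)) hf.measurable.aestronglyMeasurable
      fun z _ ↦ by simpa using hM z
    simpa using this
  · exact ContDiffBump.ae_convolution_tendsto_right_of_locallyIntegrable (K := 2)
      (tendsto_mollifierBump_rOut hδ)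
      (.of_forall fun N ↦ (mul_div_cancel₀ _ two_ne_zero).ge) hf_loc

theorem tendsto_eLpNorm_sub_of_dominated {α E : Type*} [MeasurableSpace α] {μ : Measure α}
    [NormedAddCommGroup E] {u : ℝ≥0∞} (hu₀ : u ≠ 0) (hu : u ≠ ∞) {F : ℕ → α → E} {f : α → E}
    {B : α → ℝ} (hF : ∀ N, AEStronglyMeasurable (F N) μ) (hB : MemLp B u μ)
    (h_bound : ∀ N, ∀ᵐ x ∂μ, ‖F N x‖ ≤ B x)
    (h_lim : ∀ᵐ x ∂μ, Tendsto (F · x) atTop (𝓝 (f x))) :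
    Tendsto (fun N ↦ eLpNorm (F N - f) u μ) atTop (𝓝 0) := by
  have hu_pos : 0 < u.toReal := ENNReal.toReal_pos hu₀ hu
  have hf : AEStronglyMeasurable f μ := aestronglyMeasurable_of_tendsto_ae _ hF h_lim
  have h_lintegral : Tendsto (fun N ↦ ∫⁻ x, ‖(F N - f) x‖ₑ ^ u.toReal ∂μ) atTop (𝓝 0) := by
    rw [← lintegral_zero (μ := μ)]
    refine tendsto_lintegral_of_dominated_convergence' (fun x ↦ ‖(B + B) x‖ₑ ^ u.toReal)
      (fun N ↦ ((hF N).sub hf).enorm.pow_const _) (fun N ↦ ?_)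
      (lintegral_rpow_enorm_lt_top_of_eLpNorm_lt_top hu₀ hu (hB.add hB).2).ne ?_
    · filter_upwards [ae_all_iff.2 h_bound, h_lim] with x hx hx_lim
      have hfx : ‖f x‖ ≤ B x := le_of_tendsto hx_lim.norm (.of_forall hx)
      gcongr
      exact enorm_le_iff_norm_le.2 ((norm_sub_le _ _).trans
        ((add_le_add (hx N) hfx).trans (le_abs_self _)))
    · filter_upwards [h_lim] with x hx
      have h_sub : Tendsto (fun N ↦ ‖(F N - f) x‖ₑ) atTop (𝓝 0) := by
        simpa using (hx.sub_const (f x)).enorm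
      simpa [hu_pos] using h_sub.ennrpow_const u.toReal
  have h_root := h_lintegral.ennrpow_const (1 / u.toReal)
  rw [ENNReal.zero_rpow_of_pos (by positivity)] at h_root
  exact h_root.congr fun N ↦ (eLpNorm_eq_lintegral_rpow_enorm_toReal hu₀ hu).symm

theorem IsTestApproximation.tendsto_eLpNorm_sub {g : ℕ → RSpace n → ℂ}
    (hg : IsTestApproximation A g f) (hA : Bornology.IsBounded A) {u : ℝ≥0∞} (hu₀ : u ≠ 0)
    (hu : u ≠ ∞) : Tendsto (fun N ↦ eLpNorm (g N - f) u volume) atTop (𝓝 0) := by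
  obtain ⟨M, hM⟩ := hg.exists_norm_le
  obtain ⟨R, hR⟩ := hA.subset_closedBall 0
  exact tendsto_eLpNorm_sub_of_dominated hu₀ hu
    (fun N ↦ (hg.isBddOn N).measurable.aestronglyMeasurable)
    (memLp_indicator_const u measurableSet_closedBall M (.inr measure_closedBall_lt_top.ne))
    (fun N ↦ .of_forall (((hg.isBddOn N).mono hR).norm_le_indicator (hM N))) hg.ae_tendsto

end BoundedFunctions

section SlotContinuity

variable {n m : ℕ} {s : Fin m → ℝ≥0∞} {s₀ : ℝ≥0∞} {T : LpMultilinear n m s s₀}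

theorem LpMultilinear.onFunctions_update (T : LpMultilinear n m s s₀) (f : Fin m → RSpace n → ℂ)
    (i : Fin m) (g : RSpace n → ℂ) :
    T.onFunctions (Function.update f i g) =
      T (Function.update (fun l ↦ lpClass (s l) (f l)) i (lpClass (s i) g)) :=
  congrArg (fun F ↦ (⇑(T F) : RSpace n → ℂ))
    (funext fun l ↦ Function.apply_update (fun l ↦ lpClass (s l)) f i g l)

theorem IsInitiallyBounded.exponent_ne_zero (hT : IsInitiallyBounded T) : s₀ ≠ 0 := by
  have h_sum : ∑ i, (s i)⁻¹ ≠ ∞ := ENNReal.sum_ne_top.2 fun i _ ↦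
    ENNReal.inv_ne_top.2 (zero_lt_one.trans (hT.one_lt i)).ne'
  rintro rfl
  exact h_sum (hT.scaling.symm.trans ENNReal.inv_zero)

theorem LpMultilinear.eLpNorm_onFunctions_update_sub_le {C : ℝ≥0}
    (hC : ∀ f : (l : Fin m) → Lp ℂ (s l) (volume : Measure (RSpace n)),
      eLpNorm (T f) s₀ volume ≤ C * ∏ l, eLpNorm (f l) (s l) volume)
    (f : Fin m → RSpace n → ℂ) (i : Fin m) {g h : RSpace n → ℂ} (hg : MemLp g (s i) volume)
    (hh : MemLp h (s i) volume) :
    eLpNorm (T.onFunctions (Function.update f i g) - T.onFunctions (Function.update f i h))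
        s₀ volume ≤
      (C * ∏ l ∈ Finset.univ \ {i}, eLpNorm (lpClass (s l) (f l)) (s l) volume) *
        eLpNorm (g - h) (s i) volume := by
  set F : (l : Fin m) → Lp ℂ (s l) (volume : Measure (RSpace n)) := fun l ↦ lpClass (s l) (f l)
  have h_slot : eLpNorm (⇑(lpClass (s i) g - lpClass (s i) h)) (s i) volume =
      eLpNorm (g - h) (s i) volume :=
    eLpNorm_congr_ae ((Lp.coeFn_sub _ _).trans ((lpClass_coe hg).sub (lpClass_coe hh)))
  rw [T.onFunctions_update, T.onFunctions_update, eLpNorm_congr_ae (Lp.coeFn_sub _ _).symm,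
    ← T.map_update_sub]
  refine (hC _).trans_eq ?_
  have h_others : ∏ l ∈ Finset.univ \ {i},
      eLpNorm (Function.update F i (lpClass (s i) g - lpClass (s i) h) l) (s l) volume =
      ∏ l ∈ Finset.univ \ {i}, eLpNorm (F l) (s l) volume :=
    Finset.prod_congr rfl fun l hl ↦ by rw [Function.update_of_ne (by simpa using hl)]
  rw [Finset.prod_eq_mul_prod_sdiff_singleton_of_mem (Finset.mem_univ i), h_others,
    Function.update_self, h_slot]
  ring

theorem IsInitiallyBounded.tendstoInMeasure_update (hT : IsInitiallyBounded T)
    {A : Set (RSpace n)} (hA : Bornology.IsBounded A) {f : Fin m → RSpace n → ℂ}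
    (hf : ∀ l, IsBddOn A (f l)) (i : Fin m) {g : ℕ → RSpace n → ℂ}
    (hg : IsTestApproximation A g (f i)) :
    TendstoInMeasure volume (fun N ↦ T.onFunctions (Function.update f i (g N))) atTop
      (T.onFunctions f) := by
  by_cases hs : s i = ∞
  · exact hT.extension_top i hs f (fun l ↦ (hf l).memLp hA _) g hg.isTestFunction
      hg.exists_norm_le hg.ae_tendsto
  obtain ⟨C, hC⟩ := hT.bound
  set D : ℝ≥0∞ := C * ∏ l ∈ Finset.univ \ {i}, eLpNorm (lpClass (s l) (f l)) (s l) volume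
  have hD : D ≠ ∞ := ENNReal.mul_ne_top ENNReal.coe_ne_top
    (ENNReal.prod_ne_top fun l _ ↦ Lp.eLpNorm_ne_top _)
  have h_bound (N : ℕ) :
      eLpNorm (T.onFunctions (Function.update f i (g N)) - T.onFunctions f) s₀ volume ≤
        D * eLpNorm (g N - f i) (s i) volume := by
    simpa only [Function.update_eq_self] using LpMultilinear.eLpNorm_onFunctions_update_sub_le hC
      f i ((hg.isBddOn N).memLp hA _) ((hf i).memLp hA _)
  have h_tendsto : Tendsto (fun N ↦ D * eLpNorm (g N - f i) (s i) volume) atTop (𝓝 0) := by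
    simpa using ENNReal.Tendsto.const_mul
      (hg.tendsto_eLpNorm_sub hA (zero_lt_one.trans (hT.one_lt i)).ne' hs) (.inr hD)
  exact tendstoInMeasure_of_tendsto_eLpNorm hT.exponent_ne_zero
    (fun _ ↦ Lp.aestronglyMeasurable _) (Lp.aestronglyMeasurable _)
    (tendsto_of_tendsto_of_tendsto_of_le_of_le tendsto_const_nhds h_tendsto (fun _ ↦ zero_le)
      h_bound)

end SlotContinuity

/-! ### Kernel estimates and the kernel representation -/

section KernelEstimates

variable {n m : ℕ} {K : RSpace n → (Fin m → RSpace n) → ℂ} {C : ℝ} {ω : ℝ → ℝ}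
  {x x' y₀ : RSpace n} {y y' : Fin m → RSpace n} {D τ ρ : ℝ}

theorem not_forall_eq_of_sum_norm_sub_pos (h : 0 < ∑ i, ‖x - y i‖) : ¬ ∀ i, y i = x :=
  fun hy ↦ by simp [hy] at h

namespace IsMultilinearCZKernel

theorem const_nonneg (hK : IsMultilinearCZKernel K C ω) (h : 0 < ∑ i, ‖x - y i‖) : 0 ≤ C := by
  have h_div := (norm_nonneg _).trans (hK.size x y (not_forall_eq_of_sum_norm_sub_pos h))
  by_contra! hC
  exact h_div.not_gt (div_neg_of_neg_of_pos hC (by positivity))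

theorem norm_le (hK : IsMultilinearCZKernel K C ω) (hD : 0 < D) (hDy : D ≤ ∑ i, ‖x - y i‖) :
    ‖K x y‖ ≤ C / D ^ (m * n) := by
  have hy := hD.trans_le hDy
  have hC := hK.const_nonneg hy
  exact (hK.size x y (not_forall_eq_of_sum_norm_sub_pos hy)).trans (by gcongr)

theorem regularity_le (hK : IsMultilinearCZKernel K C ω) {h : RSpace n} (hD : 0 < D)
    (hDy : D ≤ ∑ i, ‖x - y i‖) (hτ : τ * m ≤ 1 / 2) (hh : ‖h‖ ≤ τ * D) :
    ‖K (x + h) y - K x y‖ + ∑ i, ‖K x (Function.update y i (y i + h)) - K x y‖ ≤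
      C / D ^ (m * n) * ω τ := by
  set S := ∑ i, ‖x - y i‖ with hS_def
  have hS : 0 < S := hD.trans_le hDy
  have hC : 0 ≤ C := hK.const_nonneg hS
  have : NeZero m := ⟨by rintro rfl; simp [hS_def] at hS⟩
  have hm : (1 : ℝ) ≤ m := by exact_mod_cast NeZero.one_le
  have hτ₀ : 0 ≤ τ := nonneg_of_mul_nonneg_left ((norm_nonneg h).trans hh) hD
  have hτ₁ : τ ≤ 1 / 2 := (le_mul_of_one_le_right hτ₀ hm).trans hτ
  have hhS : ‖h‖ ≤ τ * S := hh.trans (by gcongr)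
  obtain ⟨i, -, hi⟩ : ∃ i ∈ Finset.univ, ‖h‖ ≤ 1 / 2 * ‖x - y i‖ := by
    refine Finset.exists_le_of_sum_le Finset.univ_nonempty ?_
    calc ∑ _i : Fin m, ‖h‖ = m * ‖h‖ := by simp
      _ ≤ m * (τ * S) := by gcongr
      _ = τ * m * S := by ring
      _ ≤ 1 / 2 * S := by gcongr
      _ = ∑ i, 1 / 2 * ‖x - y i‖ := Finset.mul_sum _ _ _
  have h_ratio : ‖h‖ / S ≤ τ := (div_le_iff₀ hS).2 hhS
  have h_mem : ‖h‖ / S ∈ Set.Ico (0 : ℝ) 1 := ⟨by positivity, by linarith⟩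
  refine (hK.regularity x y h (not_forall_eq_of_sum_norm_sub_pos hS) ⟨i, hi⟩).trans ?_
  exact mul_le_mul (by gcongr) (hK.modulus_mono h_mem ⟨hτ₀, by linarith⟩ h_ratio)
    (hK.modulus_nonneg _ h_mem) (by positivity)

theorem norm_sub_le_left (hK : IsMultilinearCZKernel K C ω) (hD : 0 < D)
    (hDy : D ≤ ∑ i, ‖x - y i‖) (hτ : τ * m ≤ 1 / 2) (hx : ‖x' - x‖ ≤ τ * D) :
    ‖K x' y - K x y‖ ≤ C / D ^ (m * n) * ω τ := by
  have h_reg := hK.regularity_le hD hDy hτ hx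
  rw [add_sub_cancel] at h_reg
  exact (le_add_of_nonneg_right (Finset.sum_nonneg fun _ _ ↦ norm_nonneg _)).trans h_reg

theorem norm_update_sub_le (hK : IsMultilinearCZKernel K C ω) (hD : 0 < D)
    (hDy : D ≤ ∑ i, ‖x - y i‖) (hτ : τ * m ≤ 1 / 2) (i : Fin m) {z : RSpace n}
    (hz : ‖z - y i‖ ≤ τ * D) :
    ‖K x (Function.update y i z) - K x y‖ ≤ C / D ^ (m * n) * ω τ := by
  have h_reg := hK.regularity_le hD hDy hτ hz
  have h_single := Finset.single_le_sum
    (f := fun l ↦ ‖K x (Function.update y l (y l + (z - y i))) - K x y‖)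
    (fun _ _ ↦ norm_nonneg _) (Finset.mem_univ i)
  simp only [add_sub_cancel] at h_single
  exact h_single.trans ((le_add_of_nonneg_left (norm_nonneg _)).trans h_reg)

theorem norm_sub_le_right (hK : IsMultilinearCZKernel K C ω) (hD : 0 < D)
    (hDy : 2 * D ≤ ∑ i, ‖x - y i‖) (hτ : τ * m ≤ 1 / 2) (hy : ∀ i, ‖y' i - y i‖ ≤ τ * D) :
    ‖K x y' - K x y‖ ≤ m * (C / D ^ (m * n) * ω τ) := by
  suffices key : ∀ J : Finset (Fin m),
      ‖K x (J.piecewise y' y) - K x y‖ ≤ J.card * (C / D ^ (m * n) * ω τ) by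
    simpa using key Finset.univ
  intro J
  induction J using Finset.induction_on with
  | empty => simp
  | insert j J hj ih =>
    set z := J.piecewise y' y
    have hzj : z j = y j := Finset.piecewise_eq_of_notMem _ _ _ hj
    have hDz : D ≤ ∑ i, ‖x - z i‖ := by
      have h_slot (i : Fin m) : ‖x - y i‖ ≤ ‖x - z i‖ + τ * D := by
        have hzy : ‖z i - y i‖ ≤ τ * D := by
          by_cases hi : i ∈ J
          · simpa [z, hi] using hy i
          · simpa [z, hi] using (norm_nonneg _).trans (hy i)
        linarith [norm_sub_le_norm_sub_add_norm_sub x (z i) (y i)]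
      have h_sum := Finset.sum_le_sum fun i (_ : i ∈ Finset.univ) ↦ h_slot i
      rw [Finset.sum_add_distrib, Finset.sum_const, Finset.card_univ, Fintype.card_fin,
        nsmul_eq_mul] at h_sum
      nlinarith
    rw [Finset.piecewise_insert, Finset.card_insert_of_notMem hj]
    push_cast
    linarith [hK.norm_update_sub_le hD hDz hτ j (hzj ▸ hy j),
      norm_sub_le_norm_sub_add_norm_sub (K x (Function.update z j (y' j))) (K x z) (K x y)]

theorem eventually_mul_modulus_lt (hK : IsMultilinearCZKernel K C ω) (a : ℝ) {ε : ℝ}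
    (hε : 0 < ε) : ∀ᶠ τ in 𝓝[>] 0, a * ω τ < ε ∧ τ * m ≤ 1 / 2 := by
  have h_modulus : Tendsto (fun t ↦ a * ω t) (𝓝[>] 0) (𝓝 0) := by
    simpa using hK.modulus_tendsto.const_mul a
  have h_mul : Tendsto (fun t : ℝ ↦ t * m) (𝓝[>] 0) (𝓝 0) := by
    simpa using ((continuous_mul_const (m : ℝ)).tendsto 0).mono_left nhdsWithin_le_nhds
  exact (h_modulus.eventually_lt_const hε).and (h_mul.eventually_le_const (by norm_num))

theorem continuousOn (hK : IsMultilinearCZKernel K C ω) (x : RSpace n) :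
    ContinuousOn (K x) {y | 0 < ∑ i, ‖x - y i‖} := by
  intro y (hy : 0 < ∑ i, ‖x - y i‖)
  refine ContinuousAt.continuousWithinAt (Metric.tendsto_nhds.2 fun ε hε ↦ ?_)
  set D := (∑ i, ‖x - y i‖) / 2 with hD_def
  have hD : 0 < D := by positivity
  obtain ⟨τ, ⟨hτε, hτ⟩, hτ₀ : 0 < τ⟩ :=
    ((hK.eventually_mul_modulus_lt (m * (C / D ^ (m * n))) hε).and self_mem_nhdsWithin).exists
  filter_upwards [Metric.ball_mem_nhds y (mul_pos hτ₀ hD)] with y' hy'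
  have h_slot (i : Fin m) : ‖y' i - y i‖ ≤ τ * D :=
    (norm_le_pi_norm (y' - y) i).trans (mem_ball_iff_norm.1 hy').le
  rw [dist_eq_norm]
  exact (hK.norm_sub_le_right hD (by rw [hD_def]; linarith) hτ h_slot).trans_lt
    (by rwa [← mul_assoc])

end IsMultilinearCZKernel

/-- The tuples of points of the ball `closedBall y₀ ρ`. -/
def ballTuples (m : ℕ) (y₀ : RSpace n) (ρ : ℝ) : Set (Fin m → RSpace n) :=
  Set.univ.pi fun _ ↦ Metric.closedBall y₀ ρ

theorem measurableSet_ballTuples : MeasurableSet (ballTuples m y₀ ρ) :=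
  .univ_pi fun _ ↦ measurableSet_closedBall

theorem integrable_indicator_ballTuples (c : ℝ) :
    Integrable ((ballTuples m y₀ ρ).indicator fun _ ↦ c) volume := by
  refine (integrable_indicator_iff measurableSet_ballTuples).2 (integrableOn_const ?_)
  rw [ballTuples, volume_pi_pi]
  exact ENNReal.prod_ne_top fun _ _ ↦ measure_closedBall_lt_top.ne

theorem mul_sub_le_sum_norm_sub (hy : y ∈ ballTuples m y₀ ρ) :
    m * (dist x y₀ - ρ) ≤ ∑ i, ‖x - y i‖ := by
  have h_slot (i : Fin m) : dist x y₀ - ρ ≤ ‖x - y i‖ := by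
    have hi : dist (y i) y₀ ≤ ρ := hy i trivial
    rw [← dist_eq_norm]
    linarith [dist_triangle x (y i) y₀]
  simpa only [Finset.card_univ, Fintype.card_fin, nsmul_eq_mul] using
    Finset.card_nsmul_le_sum Finset.univ _ _ fun i _ ↦ h_slot i

variable {f : Fin m → RSpace n → ℂ}

theorem indicator_mul_prod_eq (hf : ∀ i, IsBddOn (Metric.closedBall y₀ ρ) (f i))
    (F : (Fin m → RSpace n) → ℂ) (y : Fin m → RSpace n) :
    (ballTuples m y₀ ρ).indicator F y * ∏ i, f i (y i) = F y * ∏ i, f i (y i) := by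
  by_cases hy : y ∈ ballTuples m y₀ ρ
  · rw [Set.indicator_of_mem hy]
  · obtain ⟨i, hi⟩ : ∃ i, y i ∉ Metric.closedBall y₀ ρ := by simpa [ballTuples] using hy
    rw [Finset.prod_eq_zero (Finset.mem_univ i) ((hf i).eq_zero _ hi), mul_zero, mul_zero]

theorem aestronglyMeasurable_kernel_mul_prod (hK : IsMultilinearCZKernel K C ω) (hm : 0 < m)
    (hx : x ∉ Metric.closedBall y₀ ρ) (hf : ∀ i, IsBddOn (Metric.closedBall y₀ ρ) (f i)) :
    AEStronglyMeasurable (fun y ↦ K x y * ∏ i, f i (y i)) volume := by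
  have hρ : 0 < dist x y₀ - ρ := sub_pos.2 (not_le.1 hx)
  have h_cont : ContinuousOn (K x) (ballTuples m y₀ ρ) :=
    (hK.continuousOn x).mono fun y hy ↦
      lt_of_lt_of_le (by positivity) (mul_sub_le_sum_norm_sub hy)
  have h_kernel := (aestronglyMeasurable_indicator_iff measurableSet_ballTuples).2
    (h_cont.aestronglyMeasurable (μ := volume) measurableSet_ballTuples)
  have h_prod : Measurable fun y : Fin m → RSpace n ↦ ∏ i, f i (y i) :=
    Finset.measurable_fun_prod _ fun i _ ↦ (hf i).measurable.comp (measurable_pi_apply i)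
  exact (h_kernel.mul h_prod.aestronglyMeasurable).congr
    (.of_forall (indicator_mul_prod_eq hf (K x)))

theorem norm_kernel_mul_prod_le (hK : IsMultilinearCZKernel K C ω) (hm : 0 < m)
    (hx : x ∉ Metric.closedBall y₀ ρ) (hf : ∀ i, IsBddOn (Metric.closedBall y₀ ρ) (f i))
    {M : Fin m → ℝ} (hM : ∀ i z, ‖f i z‖ ≤ M i) (y : Fin m → RSpace n) :
    ‖K x y * ∏ i, f i (y i)‖ ≤ (ballTuples m y₀ ρ).indicator
      (fun _ ↦ C / (m * (dist x y₀ - ρ)) ^ (m * n) * ∏ i, M i) y := by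
  have hρ : 0 < dist x y₀ - ρ := sub_pos.2 (not_le.1 hx)
  rw [← indicator_mul_prod_eq hf]
  by_cases hy : y ∈ ballTuples m y₀ ρ
  · have h_kernel := hK.norm_le (by positivity) (mul_sub_le_sum_norm_sub (x := x) hy)
    rw [Set.indicator_of_mem hy, Set.indicator_of_mem hy, norm_mul, norm_prod]
    exact mul_le_mul h_kernel (Finset.prod_le_prod (fun _ _ ↦ norm_nonneg _) fun i _ ↦ hM i _)
      (Finset.prod_nonneg fun _ _ ↦ norm_nonneg _) ((norm_nonneg _).trans h_kernel)
  · rw [Set.indicator_of_notMem hy, Set.indicator_of_notMem hy, zero_mul, norm_zero]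

theorem integrable_kernel_mul_prod (hK : IsMultilinearCZKernel K C ω) (hm : 0 < m)
    (hx : x ∉ Metric.closedBall y₀ ρ) (hf : ∀ i, IsBddOn (Metric.closedBall y₀ ρ) (f i)) :
    Integrable (fun y ↦ K x y * ∏ i, f i (y i)) volume := by
  choose M hM using fun i ↦ (hf i).exists_norm_le
  exact (integrable_indicator_ballTuples _).mono'
    (aestronglyMeasurable_kernel_mul_prod hK hm hx hf)
    (.of_forall (norm_kernel_mul_prod_le hK hm hx hf hM))

theorem tendsto_integral_kernel_mul_prod_update (hK : IsMultilinearCZKernel K C ω)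
    (hx : x ∉ Metric.closedBall y₀ ρ) (hf : ∀ l, IsBddOn (Metric.closedBall y₀ ρ) (f l))
    (i : Fin m) {g : ℕ → RSpace n → ℂ}
    (hg : IsTestApproximation (Metric.closedBall y₀ ρ) g (f i)) :
    Tendsto (fun N ↦ ∫ y : Fin m → RSpace n, K x y * ∏ l, Function.update f i (g N) l (y l)) atTop
      (𝓝 (∫ y : Fin m → RSpace n, K x y * ∏ l, f l (y l))) := by
  obtain ⟨M, hM⟩ := hg.exists_norm_le
  choose M' hM' using fun l ↦ (hf l).exists_norm_le
  have h_bdd (N : ℕ) := IsBddOn.update hf i (hg.isBddOn N)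
  have h_bound (N : ℕ) (l : Fin m) (z : RSpace n) :
      ‖Function.update f i (g N) l z‖ ≤ Function.update M' i M l := by
    obtain rfl | hl := eq_or_ne l i
    · simpa using hM N z
    · simpa [hl] using hM' l z
  have h_eval : Measure.QuasiMeasurePreserving (Function.eval i)
      (volume : Measure (Fin m → RSpace n)) volume :=
    Measure.quasiMeasurePreserving_eval (fun _ ↦ volume) i
  refine tendsto_integral_of_dominated_convergence _
    (fun N ↦ aestronglyMeasurable_kernel_mul_prod hK i.pos hx (h_bdd N))
    (integrable_indicator_ballTuples _)
    (fun N ↦ .of_forall (norm_kernel_mul_prod_le hK i.pos hx (h_bdd N) (h_bound N))) ?_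
  filter_upwards [h_eval.ae hg.ae_tendsto] with y hy
  refine Tendsto.const_mul _ (tendsto_finsetProd _ fun l _ ↦ ?_)
  obtain rfl | hl := eq_or_ne l i
  · simpa using hy
  · simp [hl]

end KernelEstimates

section KernelRepresentation

variable {n m : ℕ} {K : RSpace n → (Fin m → RSpace n) → ℂ} {C : ℝ} {ω : ℝ → ℝ}
  {s : Fin m → ℝ≥0∞} {s₀ : ℝ≥0∞} {T : LpMultilinear n m s s₀} {y₀ : RSpace n} {ρ ρ' : ℝ}
  {f : Fin m → RSpace n → ℂ}

/-- Off the set `B`, the function `S f` is given by integration of `f` against the kernel `K`. -/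
def IsRepresentedOff (S : TupleOp n m) (K : RSpace n → (Fin m → RSpace n) → ℂ)
    (B : Set (RSpace n)) (f : Fin m → RSpace n → ℂ) : Prop :=
  ∀ᵐ x ∂(volume : Measure (RSpace n)), x ∉ B →
    S f x = ∫ y : Fin m → RSpace n, K x y * ∏ l, f l (y l)

theorem IsRepresentedBy.isRepresentedOff {S : TupleOp n m} (hS : IsRepresentedBy S K)
    (hm : 0 < m) {B : Set (RSpace n)} (hf : ∀ l, IsTestFunction (f l))
    (hB : ∀ l, tsupport (f l) ⊆ B) : IsRepresentedOff S K B f := by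
  filter_upwards [hS f hf] with x hx hxB
  exact hx fun h ↦ hxB (hB ⟨0, hm⟩ (Set.mem_iInter.1 h _))

theorem isRepresentedOff_of_approximation (hT : IsInitiallyBounded T)
    (hK : IsMultilinearCZKernel K C ω) (hf : ∀ l, IsBddOn (Metric.closedBall y₀ ρ) (f l))
    (i : Fin m) {g : ℕ → RSpace n → ℂ}
    (hg : IsTestApproximation (Metric.closedBall y₀ ρ) g (f i))
    (h_rep : ∀ N, IsRepresentedOff T.onFunctions K (Metric.closedBall y₀ ρ)
      (Function.update f i (g N))) :
    IsRepresentedOff T.onFunctions K (Metric.closedBall y₀ ρ) f := by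
  obtain ⟨φ, hφ, h_ae⟩ :=
    (hT.tendstoInMeasure_update Metric.isBounded_closedBall hf i hg).exists_seq_tendsto_ae
  filter_upwards [h_ae, ae_all_iff.2 h_rep] with x hx h_repx hxB
  refine tendsto_nhds_unique hx ?_
  simp only [fun N ↦ h_repx (φ N) hxB]
  exact (tendsto_integral_kernel_mul_prod_update hK hxB hf i hg).comp hφ.tendsto_atTop

theorem IsRepresentedBy.isRepresentedOff_of_isBddOn (hT : IsInitiallyBounded T)
    (hK : IsMultilinearCZKernel K C ω) (hTK : IsRepresentedBy T.onFunctions K) (hm : 0 < m)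
    (hρ : ρ < ρ') (hf : ∀ l, IsBddOn (Metric.closedBall y₀ ρ) (f l)) :
    IsRepresentedOff T.onFunctions K (Metric.closedBall y₀ ρ') f := by
  -- The slots are passed from test functions to bounded functions one at a time.
  suffices key : ∀ (J : Finset (Fin m)) (f : Fin m → RSpace n → ℂ),
      (∀ l ∈ J, IsBddOn (Metric.closedBall y₀ ρ) (f l)) →
      (∀ l ∉ J, IsTestFunction (f l) ∧ tsupport (f l) ⊆ Metric.closedBall y₀ ρ') →
      IsRepresentedOff T.onFunctions K (Metric.closedBall y₀ ρ') f from
    key Finset.univ f (fun l _ ↦ hf l) (by simp)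
  intro J
  induction J using Finset.induction_on with
  | empty =>
    intro f _ hf_test
    simp only [Finset.notMem_empty, not_false_eq_true, true_imp_iff] at hf_test
    exact hTK.isRepresentedOff hm (fun l ↦ (hf_test l).1) fun l ↦ (hf_test l).2
  | insert i J hi ih =>
    intro f hf_bdd hf_test
    obtain ⟨g, hg⟩ := (hf_bdd i (Finset.mem_insert_self i J)).exists_isTestApproximation hρ
    have hf (l : Fin m) : IsBddOn (Metric.closedBall y₀ ρ') (f l) := by
      by_cases hl : l ∈ insert i J
      · exact (hf_bdd l hl).mono (Metric.closedBall_subset_closedBall hρ.le)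
      · exact (hf_test l hl).1.isBddOn (hf_test l hl).2
    refine isRepresentedOff_of_approximation hT hK hf i hg fun N ↦
      ih _ (fun l hl ↦ ?_) fun l hl ↦ ?_
    · rw [Function.update_of_ne (ne_of_mem_of_not_mem hl hi)]
      exact hf_bdd l (Finset.mem_insert_of_mem hl)
    · obtain rfl | hli := eq_or_ne l i
      · simpa using ⟨hg.isTestFunction N, hg.tsupport_subset N⟩
      · rw [Function.update_of_ne hli]
        exact hf_test l (by simp [hli, hl])

/-- The kernel `(b(x) - b(y_i))^k K(x, y)` of the `k`-th iterated commutator in slot `i`. -/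
def commutatorKernel (b : RSpace n → ℝ) (i : Fin m) (k : ℕ)
    (K : RSpace n → (Fin m → RSpace n) → ℂ) (x : RSpace n) (y : Fin m → RSpace n) : ℂ :=
  ((b x : ℂ) - b (y i)) ^ k * K x y

theorem prod_update_mul_apply (f : Fin m → RSpace n → ℂ) (i : Fin m) (a : RSpace n → ℂ)
    (y : Fin m → RSpace n) :
    ∏ l, Function.update f i (fun z ↦ a z * f i z) l (y l) = a (y i) * ∏ l, f l (y l) := by
  rw [Fintype.prod_eq_mul_prod_compl i, Fintype.prod_eq_mul_prod_compl i (fun l ↦ f l (y l)),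
    Function.update_self, mul_assoc]
  congr 2
  exact Finset.prod_congr rfl fun l hl ↦ by rw [Function.update_of_ne (by simpa using hl)]

variable {b : RSpace n → ℝ} {M : ℝ} {i : Fin m}

theorem integrable_commutatorKernel_mul_prod (hK : IsMultilinearCZKernel K C ω)
    (hb : Measurable b) (k : ℕ)
    (hf : ∀ l, IsBddOn (Metric.closedBall y₀ ρ ∩ {z | |b z| ≤ M}) (f l)) {x : RSpace n}
    (hx : x ∉ Metric.closedBall y₀ ρ) :
    Integrable (fun y ↦ commutatorKernel b i k K x y * ∏ l, f l (y l)) volume := by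
  have hfi : IsBddOn (Metric.closedBall y₀ ρ ∩ {z | |b z| ≤ M})
      fun z ↦ ((b x : ℂ) - b z) ^ k * f i z := by
    refine (hf i).mul_left (by fun_prop) (M := (|b x| + M) ^ k) fun z hz ↦ ?_
    have hbz : |b z| ≤ M := hz.2
    rw [← Complex.ofReal_sub, norm_pow, Complex.norm_real]
    gcongr
    exact (norm_sub_le _ _).trans (by simpa using hbz)
  refine (integrable_kernel_mul_prod hK i.pos hx fun l ↦
    (IsBddOn.update hf i hfi l).mono Set.inter_subset_left).congr (.of_forall fun y ↦ ?_)
  simp only [prod_update_mul_apply f i fun z ↦ ((b x : ℂ) - b z) ^ k, commutatorKernel]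
  ring

theorem isRepresentedOff_iteratedCommutator (hT : IsInitiallyBounded T)
    (hK : IsMultilinearCZKernel K C ω) (hTK : IsRepresentedBy T.onFunctions K) (hρ : ρ < ρ')
    (hb : Measurable b) (k : ℕ)
    (hf : ∀ l, IsBddOn (Metric.closedBall y₀ ρ ∩ {z | |b z| ≤ M}) (f l)) :
    IsRepresentedOff (iteratedCommutator b i k T.onFunctions) (commutatorKernel b i k K)
      (Metric.closedBall y₀ ρ') f := by
  induction k generalizing f with
  | zero =>
    simpa [IsRepresentedOff, iteratedCommutator, commutatorKernel] using
      hTK.isRepresentedOff_of_isBddOn hT hK i.pos hρ fun l ↦ (hf l).mono Set.inter_subset_left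
  | succ k ih =>
    have h_bdd : ∀ l, IsBddOn (Metric.closedBall y₀ ρ ∩ {z | |b z| ≤ M})
        (Function.update f i (fun z ↦ (b z : ℂ) * f i z) l) :=
      IsBddOn.update hf i ((hf i).mul_left (by fun_prop) fun z hz ↦ by simpa using hz.2)
    filter_upwards [ih hf, ih h_bdd] with x hx hx_update hxB
    have hxρ : x ∉ Metric.closedBall y₀ ρ := mt (Metric.closedBall_subset_closedBall hρ.le ·) hxB
    rw [iteratedCommutator, slotCommutator, hx hxB, hx_update hxB, ← integral_const_mul,
      ← integral_sub ((integrable_commutatorKernel_mul_prod hK hb k hf hxρ).const_mul _)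
        (integrable_commutatorKernel_mul_prod hK hb k h_bdd hxρ)]
    congr with y
    rw [prod_update_mul_apply f i fun z ↦ (b z : ℂ), commutatorKernel, commutatorKernel]
    ring

end KernelRepresentation

/-! ### Medians -/

section Median

theorem isClosed_setOf_le_measure_Iic (ν : Measure ℝ) [IsFiniteMeasure ν] (a : ℝ≥0∞) :
    IsClosed {c | a ≤ ν (Set.Iic c)} := by
  rw [← isOpen_compl_iff, isOpen_iff_mem_nhds]
  intro c hc
  have h_lim : Tendsto (fun t ↦ ν (Set.Iic t)) (𝓝[>] c) (𝓝 (ν (Set.Iic c))) := by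
    rw [show Set.Iic c = ⋂ t > c, Set.Iic t by ext; simp [forall_gt_imp_ge_iff_le_of_dense]]
    exact tendsto_measure_biInter_gt (fun _ _ ↦ measurableSet_Iic.nullMeasurableSet)
      (fun _ _ _ h ↦ Set.Iic_subset_Iic.2 h) ⟨c + 1, by simp, measure_ne_top _ _⟩
  obtain ⟨t, ht, hct⟩ :=
    ((h_lim.eventually (gt_mem_nhds (not_le.1 hc))).and self_mem_nhdsWithin).exists
  filter_upwards [Iio_mem_nhds hct] with u hu
  exact not_le.2 ((measure_mono (Set.Iic_subset_Iic.2 (Set.mem_Iio.1 hu).le)).trans_lt ht)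

theorem exists_le_two_mul_measure_Iic (ν : Measure ℝ) [IsFiniteMeasure ν] :
    ∃ c, ν Set.univ ≤ 2 * ν (Set.Iic c) := by
  rcases eq_or_ne (ν Set.univ) 0 with h | h
  · exact ⟨0, h.trans_le zero_le⟩
  · have h_half := ENNReal.half_lt_self h (measure_ne_top ν _)
    obtain ⟨c, hc⟩ := ((tendsto_measure_Iic_atTop ν).eventually (lt_mem_nhds h_half)).exists
    exact ⟨c, ((ENNReal.div_lt_iff (by simp) (by simp)).1 hc).le.trans_eq (mul_comm _ _)⟩

theorem exists_median (ν : Measure ℝ) [IsFiniteMeasure ν] :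
    ∃ c, ν Set.univ ≤ 2 * ν (Set.Iic c) ∧ ν Set.univ ≤ 2 * ν (Set.Ici c) := by
  have h_Ici (c : ℝ) : ν.map Neg.neg (Set.Iic c) = ν (Set.Ici (-c)) := by
    rw [Measure.map_apply measurable_neg measurableSet_Iic, Set.neg_preimage, Set.neg_Iic]
  have h_univ : ν.map Neg.neg Set.univ = ν Set.univ := by
    rw [Measure.map_apply measurable_neg .univ, Set.preimage_univ]
  have h_closed (η : Measure ℝ) [IsFiniteMeasure η] :
      IsClosed {c | η Set.univ ≤ 2 * η (Set.Iic c)} := by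
    simpa only [ENNReal.div_le_iff_le_mul (.inl two_ne_zero) (.inl ENNReal.ofNat_ne_top),
      mul_comm (η (Set.Iic _))] using isClosed_setOf_le_measure_Iic η (η Set.univ / 2)
  have h_closed_Ici : IsClosed {c | ν Set.univ ≤ 2 * ν (Set.Ici c)} := by
    simpa only [Set.preimage_ofPred_eq, h_Ici, h_univ, neg_neg] using
      (h_closed (ν.map Neg.neg)).preimage continuous_neg
  obtain ⟨c₁, hc₁⟩ := exists_le_two_mul_measure_Iic ν
  obtain ⟨c₂, hc₂⟩ := exists_le_two_mul_measure_Iic (ν.map Neg.neg)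
  rw [h_Ici, h_univ] at hc₂
  have h_union : Set.univ ⊆
      {c | ν Set.univ ≤ 2 * ν (Set.Iic c)} ∪ {c | ν Set.univ ≤ 2 * ν (Set.Ici c)} := by
    by_contra! h
    obtain ⟨c, -, hc⟩ := Set.not_subset.1 h
    obtain ⟨h_Iic, h_Ici⟩ := not_or.1 hc
    refine (ENNReal.add_lt_add (not_le.1 h_Iic) (not_le.1 h_Ici)).not_ge ?_
    calc ν Set.univ + ν Set.univ = 2 * ν (Set.Iic c ∪ Set.Ici c) := by
          rw [Set.Iic_union_Ici, two_mul]
      _ ≤ 2 * (ν (Set.Iic c) + ν (Set.Ici c)) := by gcongr; exact measure_union_le _ _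
      _ = 2 * ν (Set.Iic c) + 2 * ν (Set.Ici c) := mul_add _ _ _
  obtain ⟨c, -, hc⟩ := isPreconnected_closed_iff.1 isPreconnected_univ _ _ (h_closed ν)
    h_closed_Ici h_union ⟨c₁, trivial, hc₁⟩ ⟨-c₂, trivial, hc₂⟩
  exact ⟨c, hc⟩

/-- `c` is a median of the function `b` on the set `A` of finite measure. -/
structure IsMedianOn {α : Type*} [MeasurableSpace α] (μ : Measure α) (b : α → ℝ) (A : Set α)
    (c : ℝ) : Prop where
  measure_le_two_mul_lower : μ A ≤ 2 * μ (A ∩ {x | b x ≤ c})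
  measure_le_two_mul_upper : μ A ≤ 2 * μ (A ∩ {x | c ≤ b x})

theorem exists_isMedianOn {α : Type*} [MeasurableSpace α] {μ : Measure α} {A : Set α}
    (hμA : μ A ≠ ∞) {b : α → ℝ} (hb : Measurable b) : ∃ c, IsMedianOn μ b A c := by
  have : Fact (μ A < ∞) := ⟨hμA.lt_top⟩
  obtain ⟨c, h_le, h_ge⟩ := exists_median ((μ.restrict A).map b)
  have h_map {J : Set ℝ} (hJ : MeasurableSet J) :
      (μ.restrict A).map b J = μ (A ∩ b ⁻¹' J) := by
    rw [Measure.map_apply hb hJ, Measure.restrict_apply (hb hJ), Set.inter_comm]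
  rw [h_map .univ, Set.preimage_univ, Set.inter_univ] at h_le h_ge
  rw [h_map measurableSet_Iic] at h_le
  rw [h_map measurableSet_Ici] at h_ge
  exact ⟨c, h_le, h_ge⟩

end Median

/-! ### Reflected balls -/

section Reflection

variable {n m : ℕ} {K : RSpace n → (Fin m → RSpace n) → ℂ} {C : ℝ} {ω : ℝ → ℝ}

/-- The ball of radius `l` about `x₀` is a reflection of the ball of radius `l` about `y₀`: the two
balls are far apart on the scale `l`, but by a factor at most `Λ`, and for `x` in the former and
`y₁, …, y_m` in the latter the kernel `K` is close to a number `K₀` which is large on the scale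
`l ^ (-m n)`. -/
structure IsReflection (K : RSpace n → (Fin m → RSpace n) → ℂ) (Λ c₁ : ℝ) (y₀ : RSpace n) (l : ℝ)
    (x₀ : RSpace n) (K₀ : ℂ) : Prop where
  le_dist : 4 * l ≤ dist x₀ y₀
  dist_le : dist x₀ y₀ ≤ Λ * l
  le_norm_mul : c₁ ≤ ‖K₀‖ * volume.real (Metric.closedBall y₀ l) ^ m
  norm_sub_le : ∀ x ∈ Metric.closedBall x₀ l, ∀ y ∈ ballTuples m y₀ l,
    ‖K x y - K₀‖ ≤ 1 / 2 * ‖K₀‖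

theorem IsNondegenerateKernel.dim_pos (hK : IsNondegenerateKernel K) : 0 < n := by
  obtain ⟨c₀, -, h⟩ := hK
  obtain ⟨x, hx, -⟩ := h 0 1 one_pos
  by_contra! hn
  obtain rfl : n = 0 := by omega
  exact hx (by simp [Subsingleton.elim x 0])

theorem IsMultilinearCZKernel.dist_le_of_le_norm (hK : IsMultilinearCZKernel K C ω) (hm : 0 < m)
    (hn : 0 < n) {c₀ ρ : ℝ} (hc₀ : 0 < c₀) (hρ : 0 < ρ) {x y₀ : RSpace n}
    (h : 1 / (c₀ * ρ ^ (m * n)) ≤ ‖K x fun _ ↦ y₀‖) : dist x y₀ ≤ max 1 (C * c₀) * ρ := by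
  set B := max 1 (C * c₀)
  have hB : 1 ≤ B := le_max_left _ _
  by_contra! h_far
  have hBρ : 0 < B * ρ := by positivity
  have h_sum : B * ρ < ∑ _i : Fin m, ‖x - y₀‖ := by
    have hm' : (1 : ℝ) ≤ m := by exact_mod_cast hm
    rw [Finset.sum_const, Finset.card_univ, Fintype.card_fin, nsmul_eq_mul, ← dist_eq_norm]
    exact h_far.trans_le (le_mul_of_one_le_left dist_nonneg hm')
  have h_size := h.trans (hK.size x _ (not_forall_eq_of_sum_norm_sub_pos (hBρ.trans h_sum)))
  have h_pow : (B * ρ) ^ (m * n) < (∑ _i : Fin m, ‖x - y₀‖) ^ (m * n) :=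
    pow_lt_pow_left₀ h_sum hBρ.le (by positivity)
  rw [div_le_div_iff₀ (by positivity) ((pow_pos hBρ _).trans h_pow), one_mul] at h_size
  refine (h_size.trans ?_).not_gt h_pow
  calc C * (c₀ * ρ ^ (m * n)) = C * c₀ * ρ ^ (m * n) := (mul_assoc _ _ _).symm
    _ ≤ B ^ (m * n) * ρ ^ (m * n) := by
        gcongr
        exact (le_max_right _ _).trans (le_self_pow₀ hB (by positivity))
    _ = (B * ρ) ^ (m * n) := (mul_pow _ _ _).symm

theorem IsMultilinearCZKernel.norm_sub_le_of_mem_closedBall (hK : IsMultilinearCZKernel K C ω)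
    (hm : 0 < m) {D τ : ℝ} (hD : 0 < D) (hτ : τ * m ≤ 1 / 2) {x₀ y₀ x : RSpace n}
    {y : Fin m → RSpace n} (h_far : 4 * D ≤ dist x₀ y₀) (hx : x ∈ Metric.closedBall x₀ (τ * D))
    (hy : y ∈ ballTuples m y₀ (τ * D)) :
    ‖K x y - K x₀ fun _ ↦ y₀‖ ≤ (m + 1) * (C / D ^ (m * n) * ω τ) := by
  have hm' : (1 : ℝ) ≤ m := by exact_mod_cast hm
  have h_sum (z : RSpace n) : ∑ _i : Fin m, ‖z - y₀‖ = m * dist z y₀ := by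
    simp [dist_eq_norm]
  have hx₀ : dist x x₀ ≤ τ * D := hx
  have hτD : τ * D ≤ D := by nlinarith [dist_nonneg.trans hx₀]
  have h_dist : 2 * D ≤ dist x y₀ := by
    linarith [dist_triangle x₀ x y₀, dist_comm x₀ x]
  have h_left : ‖K x (fun _ ↦ y₀) - K x₀ fun _ ↦ y₀‖ ≤ C / D ^ (m * n) * ω τ := by
    refine hK.norm_sub_le_left hD ?_ hτ (by rwa [← dist_eq_norm])
    rw [h_sum]
    exact (by linarith : D ≤ dist x₀ y₀).trans (le_mul_of_one_le_left dist_nonneg hm')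
  have h_right : ‖K x y - K x fun _ ↦ y₀‖ ≤ m * (C / D ^ (m * n) * ω τ) := by
    refine hK.norm_sub_le_right hD ?_ hτ fun i ↦ mem_closedBall_iff_norm.1 (hy i trivial)
    rw [h_sum]
    exact h_dist.trans (le_mul_of_one_le_left dist_nonneg hm')
  calc ‖K x y - K x₀ fun _ ↦ y₀‖
      ≤ ‖K x y - K x fun _ ↦ y₀‖ + ‖K x (fun _ ↦ y₀) - K x₀ fun _ ↦ y₀‖ :=
        norm_sub_le_norm_sub_add_norm_sub _ _ _
    _ ≤ (m + 1) * (C / D ^ (m * n) * ω τ) := by linarith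

theorem IsMultilinearCZKernel.exists_isReflection (hK : IsMultilinearCZKernel K C ω)
    (hKn : IsNondegenerateKernel K) (hm : 0 < m) :
    ∃ Λ c₁ : ℝ, 0 ≤ Λ ∧ 0 < c₁ ∧ ∀ (y₀ : RSpace n) (l : ℝ), 0 < l →
      ∃ (x₀ : RSpace n) (K₀ : ℂ), IsReflection K Λ c₁ y₀ l x₀ K₀ := by
  have hn := hKn.dim_pos
  obtain ⟨c₀, hc₀, h_nondeg⟩ := hKn
  obtain ⟨τ, ⟨hτω, hτm⟩, hτ : 0 < τ⟩ :=
    ((hK.eventually_mul_modulus_lt ((m + 1) * (C * 4 ^ (m * n)))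
      (show 0 < 1 / (2 * c₀) by positivity)).and self_mem_nhdsWithin).exists
  have hτ_le : τ ≤ 1 / 2 :=
    (le_mul_of_one_le_right hτ.le (by exact_mod_cast hm)).trans hτm
  set v₁ := volume.real (Metric.ball (0 : RSpace n) 1)
  have hv₁ : 0 < v₁ := ENNReal.toReal_pos (Metric.measure_ball_pos _ _ one_pos).ne'
    measure_ball_lt_top.ne
  refine ⟨max 1 (C * c₀) * (4 / τ), v₁ ^ m / (c₀ * (4 / τ) ^ (m * n)), by positivity,
    by positivity, fun y₀ l hl ↦ ?_⟩
  set ρ := 4 / τ * l with hρ_def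
  have hρ : 0 < ρ := by positivity
  have hτρ : τ * (ρ / 4) = l := by rw [hρ_def]; field_simp
  obtain ⟨x₀, hx₀, hK₀⟩ := h_nondeg y₀ ρ hρ
  have h_far : ρ ≤ dist x₀ y₀ := not_lt.1 hx₀
  refine ⟨x₀, K x₀ fun _ ↦ y₀, ⟨?_, ?_, ?_, fun x hx y hy ↦ ?_⟩⟩
  · nlinarith
  · rw [mul_assoc]
    exact hK.dist_le_of_le_norm hm hn hc₀ hρ hK₀
  · have h_vol : volume.real (Metric.closedBall y₀ l) = l ^ n * v₁ := by
      simpa only [finrank_euclideanSpace_fin] using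
        Measure.addHaar_real_closedBall volume y₀ hl.le
    calc v₁ ^ m / (c₀ * (4 / τ) ^ (m * n))
        = 1 / (c₀ * ρ ^ (m * n)) * volume.real (Metric.closedBall y₀ l) ^ m := by
          rw [h_vol, hρ_def, mul_pow, mul_pow, ← pow_mul, mul_comm n m]
          field_simp
      _ ≤ ‖K x₀ fun _ ↦ y₀‖ * volume.real (Metric.closedBall y₀ l) ^ m := by gcongr
  · rw [← hτρ] at hx hy
    calc ‖K x y - K x₀ fun _ ↦ y₀‖
        ≤ (m + 1) * (C / (ρ / 4) ^ (m * n) * ω τ) :=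
          hK.norm_sub_le_of_mem_closedBall hm (by positivity) hτm (by linarith) hx hy
      _ = (m + 1) * (C * 4 ^ (m * n)) * ω τ / ρ ^ (m * n) := by rw [div_pow]; field_simp
      _ ≤ 1 / (2 * c₀) / ρ ^ (m * n) := by gcongr
      _ = 1 / 2 * (1 / (c₀ * ρ ^ (m * n))) := by field_simp
      _ ≤ 1 / 2 * ‖K x₀ fun _ ↦ y₀‖ := by gcongr

end Reflection

/-! ### Testing the commutator from below -/

section LowerBound

theorem IsBddOn.indicator_const {n : ℕ} {A U : Set (RSpace n)} (hU : MeasurableSet U)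
    (h : U ⊆ A) (a : ℂ) : IsBddOn A (U.indicator fun _ ↦ a) where
  measurable := measurable_const.indicator hU
  exists_norm_le := ⟨‖a‖, fun _ ↦ norm_indicator_le_norm_self _ _⟩
  eq_zero _ hx := Set.indicator_of_notMem (fun hxU ↦ hx (h hxU)) _

/-- The unimodular factor which turns `(b x - b z) ^ k * K₀` into `‖K₀‖ * |b x - b z| ^ k` where
`σ = ±1` is the sign of `b z - b x`. -/
def testPhase (K₀ : ℂ) (σ : ℝ) (k : ℕ) : ℂ := starRingEnd ℂ K₀ / ‖K₀‖ * (-σ) ^ k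

theorem norm_testPhase_le {σ : ℝ} (hσ : |σ| = 1) (K₀ : ℂ) (k : ℕ) : ‖testPhase K₀ σ k‖ ≤ 1 := by
  simpa [testPhase, hσ] using div_self_le_one ‖K₀‖

theorem half_sq_le_re_conj_mul {w z : ℂ} (h : ‖w - z‖ ≤ 1 / 2 * ‖z‖) :
    1 / 2 * ‖z‖ ^ 2 ≤ (starRingEnd ℂ z * w).re := by
  have h_re : -(‖z‖ * ‖w - z‖) ≤ (starRingEnd ℂ z * (w - z)).re := by
    simpa only [norm_mul, Complex.norm_conj] using
      (abs_le.1 (Complex.abs_re_le_norm (starRingEnd ℂ z * (w - z)))).1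
  calc 1 / 2 * ‖z‖ ^ 2 ≤ ‖z‖ ^ 2 - ‖z‖ * ‖w - z‖ := by nlinarith [norm_nonneg z]
    _ ≤ ‖z‖ ^ 2 + (starRingEnd ℂ z * (w - z)).re := by linarith
    _ = (starRingEnd ℂ z * z + starRingEnd ℂ z * (w - z)).re := by
        rw [Complex.add_re, Complex.conj_mul', ← Complex.ofReal_pow, Complex.ofReal_re]
    _ = (starRingEnd ℂ z * w).re := by ring_nf

theorem half_mul_pow_le_re_testPhase_mul {w K₀ : ℂ} (h : ‖w - K₀‖ ≤ 1 / 2 * ‖K₀‖) {α β c σ : ℝ}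
    (hσ : |β - c| ≤ σ * (β - α)) (k : ℕ) :
    1 / 2 * ‖K₀‖ * |β - c| ^ k ≤ (testPhase K₀ σ k * (((α : ℂ) - β) ^ k * w)).re := by
  have h_eq : testPhase K₀ σ k * (((α : ℂ) - β) ^ k * w) =
      (((σ * (β - α)) ^ k / ‖K₀‖ : ℝ) : ℂ) * (starRingEnd ℂ K₀ * w) := by
    have h_pow : (-(σ : ℂ)) ^ k * ((α : ℂ) - β) ^ k = ((σ : ℂ) * (β - α)) ^ k := by
      rw [← mul_pow]; ring
    rw [testPhase]
    push_cast
    rw [← h_pow]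
    ring
  have hσ₀ : 0 ≤ σ * (β - α) := (abs_nonneg _).trans hσ
  calc 1 / 2 * ‖K₀‖ * |β - c| ^ k = |β - c| ^ k / ‖K₀‖ * (1 / 2 * ‖K₀‖ ^ 2) := by
        rcases eq_or_ne ‖K₀‖ 0 with h₀ | h₀
        · simp [h₀]
        · field_simp
    _ ≤ (σ * (β - α)) ^ k / ‖K₀‖ * (starRingEnd ℂ K₀ * w).re := by
        gcongr
        exact half_sq_le_re_conj_mul h
    _ = (testPhase K₀ σ k * (((α : ℂ) - β) ^ k * w)).re := by
        rw [h_eq, Complex.re_ofReal_mul]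

theorem setIntegral_univ_pi_eval {ι α : Type*} [Fintype ι] [DecidableEq ι] [MeasureSpace α]
    [SigmaFinite (volume : Measure α)] (W : ι → Set α) (i : ι) {g : α → ℝ}
    (hg : AEStronglyMeasurable g (volume.restrict (W i))) :
    ∫ y in Set.univ.pi W, g (y i) = (∏ j ∈ Finset.univ.erase i, volume.real (W j)) *
      ∫ z in W i, g z := by
  have h_eval := Measure.pi_map_eval (fun j ↦ (volume : Measure α).restrict (W j)) i
  rw [volume_pi, Measure.restrict_pi_pi]
  calc ∫ y, g (y i) ∂Measure.pi (fun j ↦ volume.restrict (W j))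
      = ∫ z, g z ∂(Measure.pi (fun j ↦ volume.restrict (W j))).map (Function.eval i) := by
        refine (integral_map (measurable_pi_apply i).aemeasurable ?_).symm
        rw [h_eval]
        exact hg.smul_measure _
    _ = _ := by
        rw [h_eval, integral_smul_measure, smul_eq_mul, ENNReal.toReal_prod]
        simp only [Measure.restrict_apply_univ, measureReal_def]

variable {n m : ℕ} {K : RSpace n → (Fin m → RSpace n) → ℂ} {C : ℝ} {ω : ℝ → ℝ} {b : RSpace n → ℝ}
  {i : Fin m} {c σ M Λ c₁ : ℝ} {y₀ x₀ : RSpace n} {l : ℝ} {K₀ : ℂ}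
  {W : Fin m → Set (RSpace n)} {F : Set (RSpace n)}

/-- Sets on which a commutator is tested: the input set `W j` of slot `j` lies in the ball of radius
`l` about `y₀`, the output set `F` in the ball about `x₀`, all but `W i` are substantial parts of
these balls, and `b z - b x` has the sign `σ` and dominates `b z - c` for `z ∈ W i`, `x ∈ F`. The
function `b` is bounded by `M` on the input sets. -/
structure IsTestSets (b : RSpace n → ℝ) (i : Fin m) (c σ M : ℝ) (y₀ x₀ : RSpace n) (l : ℝ)
    (W : Fin m → Set (RSpace n)) (F : Set (RSpace n)) : Prop where
  measurableSet_input : ∀ j, MeasurableSet (W j)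
  measurableSet_output : MeasurableSet F
  input_subset : ∀ j, W j ⊆ Metric.closedBall y₀ l ∩ {z | |b z| ≤ M}
  output_subset : F ⊆ Metric.closedBall x₀ l
  volume_le_input : ∀ j ≠ i, volume.real (Metric.closedBall y₀ l) ≤ 2 * volume.real (W j)
  volume_le_output : volume.real (Metric.closedBall y₀ l) ≤ 2 * volume.real F
  abs_sub_le : ∀ x ∈ F, ∀ z ∈ W i, |b z - c| ≤ σ * (b z - b x)

namespace IsTestSets

theorem isBddOn_indicator (h : IsTestSets b i c σ M y₀ x₀ l W F) (j : Fin m) :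
    IsBddOn (Metric.closedBall y₀ l ∩ {z | |b z| ≤ M}) ((W j).indicator 1) :=
  .indicator_const (h.measurableSet_input j) (h.input_subset j) 1

theorem univ_pi_subset (h : IsTestSets b i c σ M y₀ x₀ l W F) :
    Set.univ.pi W ⊆ ballTuples m y₀ l :=
  Set.pi_mono fun j _ _ hz ↦ (h.input_subset j hz).1

theorem notMem_closedBall (h : IsTestSets b i c σ M y₀ x₀ l W F) (hl : 0 < l)
    (h_far : 4 * l ≤ dist x₀ y₀) {x : RSpace n} (hx : x ∈ F) :
    x ∉ Metric.closedBall y₀ (2 * l) := by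
  have hxx₀ : dist x x₀ ≤ l := h.output_subset hx
  rw [Metric.mem_closedBall, not_le]
  linarith [dist_triangle x₀ x y₀, dist_comm x₀ x]

theorem le_re_integral_commutatorKernel (h : IsTestSets b i c σ M y₀ x₀ l W F)
    (hK : IsMultilinearCZKernel K C ω) (hrefl : IsReflection K Λ c₁ y₀ l x₀ K₀) (hl : 0 < l)
    (hb : Measurable b) (k : ℕ) {x : RSpace n} (hx : x ∈ F) :
    1 / 2 * ‖K₀‖ * ((∏ j ∈ Finset.univ.erase i, volume.real (W j)) * ∫ z in W i, |b z - c| ^ k) ≤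
      (testPhase K₀ σ k * ∫ y, commutatorKernel b i k K x y *
        ∏ j, (W j).indicator (1 : RSpace n → ℂ) (y j)).re := by
  have h_off : x ∉ Metric.closedBall y₀ l := fun hxl ↦ h.notMem_closedBall hl hrefl.le_dist hx
    (Metric.closedBall_subset_closedBall (by linarith) hxl)
  have hW : MeasurableSet (Set.univ.pi W) := .univ_pi h.measurableSet_input
  have h_prod (y : Fin m → RSpace n) : commutatorKernel b i k K x y *
      ∏ j, (W j).indicator (1 : RSpace n → ℂ) (y j) =
      (Set.univ.pi W).indicator (commutatorKernel b i k K x) y := by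
    rw [← Set.indicator_pi_one_apply, Finset.coe_univ]
    by_cases hy : y ∈ Set.univ.pi W <;> simp [hy, -Set.mem_pi]
  have h_int : IntegrableOn (fun y ↦ testPhase K₀ σ k * commutatorKernel b i k K x y)
      (Set.univ.pi W) := by
    have := integrable_commutatorKernel_mul_prod (i := i) hK hb k h.isBddOn_indicator h_off
    simp only [h_prod] at this
    exact ((integrable_indicator_iff hW).1 this).const_mul _
  have h_le : ∀ y ∈ Set.univ.pi W, 1 / 2 * ‖K₀‖ * |b (y i) - c| ^ k ≤
      (testPhase K₀ σ k * commutatorKernel b i k K x y).re := fun y hy ↦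
    half_mul_pow_le_re_testPhase_mul
      (hrefl.norm_sub_le x (h.output_subset hx) y (h.univ_pi_subset hy))
      (h.abs_sub_le x hx _ (hy i trivial)) k
  have h_abs : Measurable fun z ↦ |b z - c| ^ k := by fun_prop
  calc 1 / 2 * ‖K₀‖ * ((∏ j ∈ Finset.univ.erase i, volume.real (W j)) * ∫ z in W i, |b z - c| ^ k)
      = ∫ y in Set.univ.pi W, 1 / 2 * ‖K₀‖ * |b (y i) - c| ^ k := by
        rw [integral_const_mul, setIntegral_univ_pi_eval W i h_abs.aestronglyMeasurable]
    _ ≤ ∫ y in Set.univ.pi W, (testPhase K₀ σ k * commutatorKernel b i k K x y).re :=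
        integral_mono_of_nonneg (.of_forall fun y ↦ by positivity) h_int.re
          (ae_restrict_of_forall_mem hW h_le)
    _ = (∫ y in Set.univ.pi W, testPhase K₀ σ k * commutatorKernel b i k K x y).re :=
        integral_re h_int
    _ = _ := by simp only [h_prod, integral_const_mul, integral_indicator hW]

theorem mul_volume_real_le (h : IsTestSets b i c σ M y₀ x₀ l W F)
    (hrefl : IsReflection K Λ c₁ y₀ l x₀ K₀) :
    c₁ / (2 * 2 ^ m) ≤
      1 / 2 * ‖K₀‖ * ((∏ j ∈ Finset.univ.erase i, volume.real (W j)) * volume.real F) := by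
  set v := volume.real (Metric.closedBall y₀ l)
  have hm : m = (Finset.univ.erase i).card + 1 := by
    rw [Finset.card_erase_add_one (Finset.mem_univ i), Finset.card_univ, Fintype.card_fin]
  have h_prod : (v / 2) ^ (Finset.univ.erase i).card ≤
      ∏ j ∈ Finset.univ.erase i, volume.real (W j) := by
    rw [← Finset.prod_const]
    refine Finset.prod_le_prod (fun _ _ ↦ by positivity) fun j hj ↦ ?_
    linarith [h.volume_le_input j (Finset.ne_of_mem_erase hj)]
  calc c₁ / (2 * 2 ^ m) ≤ ‖K₀‖ * v ^ m / (2 * 2 ^ m) := by gcongr; exact hrefl.le_norm_mul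
    _ = 1 / 2 * ‖K₀‖ * ((v / 2) ^ (Finset.univ.erase i).card * (v / 2)) := by
        rw [← pow_succ, ← hm, div_pow]
        field_simp
    _ ≤ 1 / 2 * ‖K₀‖ * ((∏ j ∈ Finset.univ.erase i, volume.real (W j)) * volume.real F) := by
        gcongr
        linarith [h.volume_le_output]

theorem setIntegral_le_re_integral_iteratedCommutator (h : IsTestSets b i c σ M y₀ x₀ l W F)
    {s : Fin m → ℝ≥0∞} {s₀ : ℝ≥0∞} {T : LpMultilinear n m s s₀} (hT : IsInitiallyBounded T)
    (hK : IsMultilinearCZKernel K C ω) (hTK : IsRepresentedBy T.onFunctions K)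
    (hrefl : IsReflection K Λ c₁ y₀ l x₀ K₀) (hl : 0 < l) (hb : Measurable b) (k : ℕ)
    (h_int : IntegrableOn (iteratedCommutator b i k T.onFunctions fun j ↦ (W j).indicator 1) F) :
    c₁ / (2 * 2 ^ m) * ∫ z in W i, |b z - c| ^ k ≤
      (testPhase K₀ σ k *
        ∫ x in F, iteratedCommutator b i k T.onFunctions (fun j ↦ (W j).indicator 1) x).re := by
  set S := iteratedCommutator b i k T.onFunctions fun j ↦ (W j).indicator 1
  set P := ∏ j ∈ Finset.univ.erase i, volume.real (W j)
  set I := ∫ z in W i, |b z - c| ^ k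
  have : 0 ≤ I := integral_nonneg fun z ↦ by positivity
  have hF : volume F ≠ ∞ := measure_ne_top_of_subset h.output_subset measure_closedBall_lt_top.ne
  have h_phase_int : IntegrableOn (fun x ↦ testPhase K₀ σ k * S x) F := h_int.const_mul _
  have h_le : ∀ᵐ x ∂volume.restrict F, 1 / 2 * ‖K₀‖ * (P * I) ≤ (testPhase K₀ σ k * S x).re := by
    refine (ae_restrict_iff' h.measurableSet_output).2 ?_
    filter_upwards [isRepresentedOff_iteratedCommutator (i := i) hT hK hTK
      (show l < 2 * l by linarith) hb k h.isBddOn_indicator] with x hx hxF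
    have h_rep := hx (h.notMem_closedBall hl hrefl.le_dist hxF)
    exact (h.le_re_integral_commutatorKernel hK hrefl hl hb k hxF).trans_eq (by rw [← h_rep])
  calc c₁ / (2 * 2 ^ m) * I ≤ 1 / 2 * ‖K₀‖ * (P * volume.real F) * I := by
        gcongr
        exact h.mul_volume_real_le hrefl
    _ = ∫ _x in F, 1 / 2 * ‖K₀‖ * (P * I) := by
        rw [setIntegral_const, smul_eq_mul]
        ring
    _ ≤ ∫ x in F, (testPhase K₀ σ k * S x).re :=
        integral_mono_ae (integrableOn_const hF) h_phase_int.re h_le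
    _ = (∫ x in F, testPhase K₀ σ k * S x).re := integral_re h_phase_int
    _ = (testPhase K₀ σ k * ∫ x in F, S x).re := by rw [integral_const_mul]

end IsTestSets

end LowerBound

/-! ### Random signs and multilinearity up to null sets -/

section RandomSigns

variable {ι κ V 𝕜 : Type*} [Fintype ι] [Fintype κ] [RCLike 𝕜] [AddCommGroup V] [Module 𝕜 V]

theorem sum_sign_mul_sign [DecidableEq ι] (p q : ι) :
    ∑ e : ι → ℤˣ, ((e p : ℤ) : 𝕜) * ((e q : ℤ) : 𝕜) =
      if p = q then (Fintype.card (ι → ℤˣ) : 𝕜) else 0 := by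
  split_ifs with h
  · subst h
    simp [← Int.cast_mul, Int.units_coe_mul_self]
  · have h_flip : ∑ e : ι → ℤˣ, ((e p : ℤ) : 𝕜) * ((e q : ℤ) : 𝕜) =
        ∑ e : ι → ℤˣ, -(((e p : ℤ) : 𝕜) * ((e q : ℤ) : 𝕜)) := by
      refine Fintype.sum_equiv (Equiv.mulRight (Pi.mulSingle p (-1 : ℤˣ))) _ _ fun e ↦ ?_
      simp [Pi.mulSingle_eq_of_ne (Ne.symm h)]
    rw [Finset.sum_neg_distrib] at h_flip
    exact self_eq_neg.1 h_flip

theorem sum_signs_multilinear [DecidableEq ι] [DecidableEq κ]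
    (Φ : ι → MultilinearMap 𝕜 (fun _ : κ ↦ V) 𝕜) (f : κ → ι → V) :
    ∑ ε : κ → ι → ℤˣ, ∑ Q, (∏ i, ((ε i Q : ℤ) : 𝕜)) *
        Φ Q (fun i ↦ ∑ P, ((ε i P : ℤ) : 𝕜) • f i P) =
      (Fintype.card (κ → ι → ℤˣ) : 𝕜) * ∑ Q, Φ Q (f · Q) := by
  rw [Finset.sum_comm, Finset.mul_sum]
  refine Finset.sum_congr rfl fun Q _ ↦ ?_
  have h_average (π : κ → ι) : ∑ ε : κ → ι → ℤˣ, (∏ i, ((ε i Q : ℤ) : 𝕜)) *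
      ((∏ i, ((ε i (π i) : ℤ) : 𝕜)) • Φ Q fun i ↦ f i (π i)) =
      (∏ i, if Q = π i then (Fintype.card (ι → ℤˣ) : 𝕜) else 0) * Φ Q fun i ↦ f i (π i) := by
    simp_rw [smul_eq_mul, ← mul_assoc, ← Finset.prod_mul_distrib, ← Finset.sum_mul,
      ← sum_sign_mul_sign]
    rw [Finset.prod_univ_sum, Fintype.piFinset_univ]
  simp_rw [MultilinearMap.map_sum, MultilinearMap.map_smul_univ, Finset.mul_sum]
  rw [Finset.sum_comm, Finset.sum_congr rfl fun π _ ↦ h_average π,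
    Finset.sum_eq_single (fun _ ↦ Q)]
  · simp
  · intro π _ hπ
    obtain ⟨i, hi⟩ : ∃ i, π i ≠ Q := Function.ne_iff.1 hπ
    rw [Finset.prod_eq_zero (Finset.mem_univ i) (if_neg hi.symm), zero_mul]
  · simp

theorem enorm_sum_diag_le (Φ : ι → MultilinearMap 𝕜 (fun _ : κ ↦ V) 𝕜) (f : κ → ι → V)
    {B : ℝ≥0∞} (hB : ∀ ε : κ → ι → ℤˣ, ‖∑ Q, (∏ i, ((ε i Q : ℤ) : 𝕜)) *
        Φ Q (fun i ↦ ∑ P, ((ε i P : ℤ) : 𝕜) • f i P)‖ₑ ≤ B) :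
    ‖∑ Q, Φ Q (f · Q)‖ₑ ≤ B := by
  classical
  have h_card : (Fintype.card (κ → ι → ℤˣ) : ℝ≥0∞) ≠ 0 := by exact_mod_cast Fintype.card_ne_zero
  refine (ENNReal.mul_le_mul_iff_right h_card (ENNReal.natCast_ne_top _)).1 ?_
  calc (Fintype.card (κ → ι → ℤˣ) : ℝ≥0∞) * ‖∑ Q, Φ Q (f · Q)‖ₑ
      = ‖∑ ε : κ → ι → ℤˣ, ∑ Q, (∏ i, ((ε i Q : ℤ) : 𝕜)) *
          Φ Q (fun i ↦ ∑ P, ((ε i P : ℤ) : 𝕜) • f i P)‖ₑ := by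
        rw [sum_signs_multilinear, enorm_mul]
        simp [enorm_eq_nnnorm]
    _ ≤ ∑ _ε : κ → ι → ℤˣ, B := (enorm_sum_le _ _).trans (Finset.sum_le_sum fun ε _ ↦ hB ε)
    _ = Fintype.card (κ → ι → ℤˣ) * B := by rw [Finset.sum_const, nsmul_eq_mul, Finset.card_univ]

end RandomSigns

section AEMultilinear

variable {n m : ℕ} {A : Set (RSpace n)}

/-- The space of bounded measurable functions that vanish off `A`. -/
def bddSubmodule (A : Set (RSpace n)) : Submodule ℂ (RSpace n → ℂ) where
  carrier := {f | IsBddOn A f}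
  zero_mem' := ⟨measurable_const, ⟨0, by simp⟩, by simp⟩
  add_mem' := by
    rintro f g hf hg
    obtain ⟨M, hM⟩ := hf.exists_norm_le
    obtain ⟨M', hM'⟩ := hg.exists_norm_le
    exact ⟨hf.measurable.add hg.measurable,
      ⟨M + M', fun x ↦ (norm_add_le _ _).trans (add_le_add (hM x) (hM' x))⟩,
      fun x hx ↦ by simp [hf.eq_zero x hx, hg.eq_zero x hx]⟩
  smul_mem' a f hf := hf.mul_left (a := fun _ ↦ a) measurable_const fun _ _ ↦ le_rfl

/-- `S` agrees, up to null sets, with a multilinear map on the bounded measurable functions that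
vanish off `A`. -/
def IsAEMultilinearOn (A : Set (RSpace n)) (S : TupleOp n m) : Prop :=
  ∃ Ψ : MultilinearMap ℂ (fun _ : Fin m ↦ bddSubmodule A) (RSpace n →ₘ[volume] ℂ),
    ∀ f, Ψ f =ᵐ[volume] S fun l ↦ (f l : RSpace n → ℂ)

theorem LpMultilinear.isAEMultilinearOn {s : Fin m → ℝ≥0∞} {s₀ : ℝ≥0∞}
    (T : LpMultilinear n m s s₀) (hA : Bornology.IsBounded A) :
    IsAEMultilinearOn A T.onFunctions := by
  let toLp (l : Fin m) : bddSubmodule A →ₗ[ℂ] Lp ℂ (s l) (volume : Measure (RSpace n)) :=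
    { toFun := fun f ↦ (f.2.memLp hA (s l)).toLp f
      map_add' := fun f g ↦ MemLp.toLp_add (f.2.memLp hA _) (g.2.memLp hA _)
      map_smul' := fun a f ↦ MemLp.toLp_const_smul a (f.2.memLp hA _) }
  refine ⟨(Lp.LpSubmodule ℂ ℂ s₀ volume).subtype.compMultilinearMap (T.compLinearMap toLp),
    fun f ↦ ?_⟩
  have h_class (l : Fin m) : lpClass (s l) (f l) = toLp l (f l) :=
    dif_pos ((f l).2.memLp hA (s l))
  simp only [LpMultilinear.onFunctions, h_class]
  rfl

theorem IsAEMultilinearOn.slotCommutator {S : TupleOp n m} (hS : IsAEMultilinearOn A S)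
    {b : RSpace n → ℝ} (hb : Measurable b) {M : ℝ} (hbA : ∀ x ∈ A, |b x| ≤ M) (i : Fin m) :
    IsAEMultilinearOn A (slotCommutator b i S) := by
  obtain ⟨Ψ, hΨ⟩ := hS
  have hbℂ : Measurable fun x ↦ (b x : ℂ) := by fun_prop
  let bClass : RSpace n →ₘ[volume] ℂ := .mk (fun x ↦ (b x : ℂ)) hbℂ.aestronglyMeasurable
  let mulClass : (RSpace n →ₘ[volume] ℂ) →ₗ[ℂ] RSpace n →ₘ[volume] ℂ :=
    { toFun := fun g ↦ bClass * g
      map_add' := fun f g ↦ AEEqFun.induction_on₂ f g fun f hf g hg ↦ by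
        simp [bClass, AEEqFun.mk_mul_mk, AEEqFun.mk_add_mk, mul_add]
      map_smul' := fun a f ↦ AEEqFun.induction_on f fun f hf ↦ by
        simp [bClass, AEEqFun.mk_mul_mk, AEEqFun.smul_mk] }
  let mulBdd : bddSubmodule A →ₗ[ℂ] bddSubmodule A :=
    { toFun := fun f ↦ ⟨fun x ↦ b x * f.1 x, f.2.mul_left hbℂ (by simpa using hbA)⟩
      map_add' := fun f g ↦ Subtype.ext (funext fun x ↦ mul_add _ _ _)
      map_smul' := fun a f ↦ Subtype.ext (funext fun x ↦ mul_left_comm _ _ _) }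
  refine ⟨mulClass.compMultilinearMap Ψ -
    Ψ.compLinearMap (Function.update (fun _ ↦ .id) i mulBdd), fun f ↦ ?_⟩
  have h_update : (fun l ↦ ((Function.update (fun _ ↦ .id) i mulBdd : Fin m → _) l (f l)).1) =
      Function.update (fun l ↦ (f l).1) i fun x ↦ (b x : ℂ) * (f i).1 x := by
    funext l
    obtain rfl | hl := eq_or_ne l i
    · simp [mulBdd]
    · simp [hl]
  have h_slot := hΨ fun l ↦ (Function.update (fun _ ↦ .id) i mulBdd : Fin m → _) l (f l)
  rw [h_update] at h_slot
  filter_upwards [AEEqFun.coeFn_sub (bClass * Ψ f)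
      (Ψ fun l ↦ (Function.update (fun _ ↦ .id) i mulBdd : Fin m → _) l (f l)),
    AEEqFun.coeFn_mul bClass (Ψ f), AEEqFun.coeFn_mk _ hbℂ.aestronglyMeasurable, hΨ f, h_slot]
    with x h_sub h_mul h_coe h_main h_slot
  simp only [Pi.sub_apply, Pi.mul_apply] at h_sub h_mul
  rw [_root_.slotCommutator, ← h_main, ← h_slot, ← h_coe, ← h_mul]
  exact h_sub

theorem IsAEMultilinearOn.iteratedCommutator {S : TupleOp n m} (hS : IsAEMultilinearOn A S)
    {b : RSpace n → ℝ} (hb : Measurable b) {M : ℝ} (hbA : ∀ x ∈ A, |b x| ≤ M) (i : Fin m) :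
    ∀ k, IsAEMultilinearOn A (iteratedCommutator b i k S)
  | 0 => hS
  | k + 1 => (hS.iteratedCommutator hb hbA i k).slotCommutator hb hbA i

theorem IsAEMultilinearOn.exists_integral_form {S : TupleOp n m} (hS : IsAEMultilinearOn A S)
    {F : Set (RSpace n)} (h_int : ∀ f, (∀ l, IsBddOn A (f l)) → IntegrableOn (S f) F) :
    ∃ Φ : MultilinearMap ℂ (fun _ : Fin m ↦ bddSubmodule A) ℂ,
      ∀ f, Φ f = ∫ x in F, S (fun l ↦ (f l : RSpace n → ℂ)) x := by
  obtain ⟨Ψ, hΨ⟩ := hS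
  have h_int' (f : Fin m → bddSubmodule A) : IntegrableOn (Ψ f) F :=
    (h_int _ fun l ↦ (f l).2).congr (ae_restrict_of_ae (hΨ f).symm)
  refine ⟨{ toFun := fun f ↦ ∫ x in F, Ψ f x
            map_update_add' := fun f i u v ↦ ?_
            map_update_smul' := fun f i a u ↦ ?_ },
    fun f ↦ integral_congr_ae (ae_restrict_of_ae (hΨ f))⟩
  · rw [Ψ.map_update_add, integral_congr_ae (ae_restrict_of_ae (AEEqFun.coeFn_add _ _))]
    exact integral_add (h_int' _) (h_int' _)
  · rw [Ψ.map_update_smul, integral_congr_ae (ae_restrict_of_ae (AEEqFun.coeFn_smul _ _))]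
    exact integral_smul a _

end AEMultilinear

/-! ### Multilinear operators on sparse sums -/

section WeightedSums

theorem ennreal_rpow_sum_of_nonneg {ι : Type*} (x : ℝ≥0∞) {s : Finset ι} {v : ι → ℝ}
    (hv : ∀ i ∈ s, 0 ≤ v i) : x ^ ∑ i ∈ s, v i = ∏ i ∈ s, x ^ v i := by
  induction s using Finset.cons_induction with
  | empty => simp
  | cons i s hi ih =>
    rw [Finset.forall_mem_cons] at hv
    rw [Finset.sum_cons, Finset.prod_cons,
      ENNReal.rpow_add_of_nonneg _ _ hv.1 (Finset.sum_nonneg hv.2), ih hv.2]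

theorem enorm_sum_mul_setIntegral_le {α 𝕜 ι : Type*} [MeasurableSpace α] {μ : Measure α} [RCLike 𝕜]
    [Fintype ι] {p q : ℝ≥0∞} [p.HolderConjugate q] {F : ι → Set α}
    (hF : ∀ Q, MeasurableSet (F Q)) (hF_top : ∀ Q, μ (F Q) ≠ ∞) (κ : ι → 𝕜) {G : α → 𝕜}
    (hG : MemLp G q μ) :
    ‖∑ Q, κ Q * ∫ x in F Q, G x ∂μ‖ₑ ≤
      eLpNorm (fun x ↦ ∑ Q, κ Q * (F Q).indicator 1 x) p μ * eLpNorm G q μ := by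
  set H : α → 𝕜 := fun x ↦ ∑ Q, κ Q * (F Q).indicator 1 x
  have hH : Measurable H :=
    Finset.measurable_fun_sum _ fun Q _ ↦ (measurable_one.indicator (hF Q)).const_mul _
  have h_int (Q : ι) : IntegrableOn G (F Q) μ := by
    have : IsFiniteMeasure (μ.restrict (F Q)) := isFiniteMeasure_restrict.2 (hF_top Q)
    exact (hG.restrict _).integrable (ENNReal.HolderConjugate.one_le q p)
  have h_eq : ∑ Q, κ Q * ∫ x in F Q, G x ∂μ = ∫ x, (H • G) x ∂μ := by
    have h_mul (x : α) : (H • G) x = ∑ Q, κ Q * (F Q).indicator G x := by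
      have (Q : ι) : (F Q).indicator 1 x * G x = (F Q).indicator G x := by
        by_cases hx : x ∈ F Q <;> simp [hx]
      simp [H, Finset.sum_mul, mul_assoc, this]
    simp_rw [h_mul]
    rw [integral_finsetSum _ fun Q _ ↦ ((h_int Q).integrable_indicator (hF Q)).const_mul _]
    simp_rw [integral_const_mul, integral_indicator (hF _)]
  rw [h_eq]
  refine (enorm_integral_le_lintegral_enorm _).trans ?_
  rw [← eLpNorm_one_eq_lintegral_enorm]
  exact eLpNorm_smul_le_mul_eLpNorm hG.1 hH.aestronglyMeasurable

theorem nnreal_rpow_mul_prod_rpow {ι : Type*} [Fintype ι] (a : ℝ≥0) {t u : ℝ} {v : ι → ℝ}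
    (ht₀ : 0 < t) (hu : 0 < u) (hv : ∀ j, 0 < v j) (ht : 1 / t = 1 / u + ∑ j, 1 / v j) :
    a ^ (t / u) * ∏ j, a ^ (t / v j) = a := by
  have h_sum : t / u + ∑ j, t / v j = 1 := by
    rw [← mul_one_div_cancel ht₀.ne', ht, mul_add, Finset.mul_sum]
    simp only [mul_one_div]
  have hv₀ : ∀ j ∈ Finset.univ, 0 ≤ t / v j := fun j _ ↦ (div_pos ht₀ (hv j)).le
  apply NNReal.coe_injective
  push_cast
  rw [← Real.rpow_sum_of_nonneg a.coe_nonneg hv₀, ← Real.rpow_add_of_nonneg a.coe_nonneg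
    (div_pos ht₀ hu).le (Finset.sum_nonneg hv₀), h_sum, Real.rpow_one]

/-- The constant in the `L^u` bound for sums over a sparse family of balls in `ℝⁿ`. -/
def sparseConst (C₀ : ℝ≥0) (n : ℕ) (u : ℝ) : ℝ≥0 := C₀ * (u.toNNReal * 5 ^ n)

variable {n : ℕ} {ι : Type*} {C₀ : ℝ≥0} {y : ι → RSpace n} {l : ι → ℝ} {E : ι → Set (RSpace n)}

theorem IsSparseFamily.dilate (hE : IsSparseFamily volume C₀ y l E) {Λ : ℝ≥0} (hΛ : 1 ≤ Λ) :
    IsSparseFamily volume (Λ ^ n * C₀) y (fun Q ↦ Λ * l Q) E where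
  radius_pos Q := mul_pos (by positivity) (hE.radius_pos Q)
  measurableSet := hE.measurableSet
  subset Q := (hE.subset Q).trans
    (Metric.closedBall_subset_closedBall (le_mul_of_one_le_left (hE.radius_pos Q).le hΛ))
  disjoint := hE.disjoint
  measure_le Q := by
    rw [Measure.addHaar_closedBall_mul _ _ (by positivity) (hE.radius_pos Q).le,
      finrank_euclideanSpace_fin, ← NNReal.coe_pow, ENNReal.ofReal_coe_nnreal, ENNReal.coe_mul,
      mul_assoc]
    gcongr
    exact (Measure.addHaar_closedBall_center volume (y Q) _).symm.trans_le (hE.measure_le Q)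

theorem IsSparseFamily.eLpNorm_sum_mul_le [Fintype ι] (hE : IsSparseFamily volume C₀ y l E)
    {a : ι → ℝ≥0} {t u : ℝ} (hu : 1 < u) {κ : ι → ℂ} (hκ : ∀ Q, ‖κ Q‖₊ ≤ a Q ^ (t / u))
    {φ : ι → RSpace n → ℂ}
    (hφ : ∀ Q x, ‖φ Q x‖ₑ ≤ (Metric.closedBall (y Q) (l Q)).indicator 1 x) :
    eLpNorm (fun x ↦ ∑ Q, κ Q * φ Q x) (ENNReal.ofReal u) volume ≤
      sparseConst C₀ n u * (∑ Q, ((a Q ^ t : ℝ≥0) : ℝ≥0∞) * volume (E Q)) ^ (1 / u) := by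
  have hu₀ : 0 < u := by positivity
  have h_pow (Q : ι) : ((a Q ^ (t / u) : ℝ≥0) : ℝ≥0∞) ^ u = (a Q ^ t : ℝ≥0) := by
    rw [← ENNReal.coe_rpow_of_nonneg _ hu₀.le, ← NNReal.rpow_mul, div_mul_cancel₀ _ hu₀.ne']
  have h_sum := hE.eLpNorm_sum_le (fun Q ↦ a Q ^ (t / u)) (w := fun Q x ↦ κ Q * φ Q x)
    (fun Q x ↦ ?_) hu
  · simpa only [h_pow, sparseConst, finrank_euclideanSpace_fin, ENNReal.ofReal, ENNReal.coe_mul,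
      ENNReal.coe_pow, ENNReal.coe_ofNat] using h_sum
  · rw [enorm_mul]
    refine (mul_le_mul' (enorm_le_coe.2 (hκ Q)) (hφ Q x)).trans_eq ?_
    by_cases hx : x ∈ Metric.closedBall (y Q) (l Q) <;> simp [hx]

end WeightedSums

section SparseForm

variable {n m : ℕ} {A : Set (RSpace n)} {S : TupleOp n m} {ps : Fin m → ℝ} {q : ℝ} {A₀ : ℝ≥0}

/-- On bounded measurable functions that vanish off `A`, the operator `S` is multilinear up to null
sets and bounded from `L^{p₁} × ⋯ × L^{p_m}` to `L^q` with constant `A₀`. -/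
structure IsLpBoundedOn (A : Set (RSpace n)) (S : TupleOp n m) (ps : Fin m → ℝ) (q : ℝ)
    (A₀ : ℝ≥0) : Prop where
  isAEMultilinearOn : IsAEMultilinearOn A S
  aestronglyMeasurable : ∀ f, (∀ j, IsBddOn A (f j)) → AEStronglyMeasurable (S f) volume
  eLpNorm_le : ∀ f, (∀ j, IsBddOn A (f j)) → eLpNorm (S f) (ENNReal.ofReal q) volume ≤
    A₀ * ∏ j, eLpNorm (f j) (ENNReal.ofReal (ps j)) volume

theorem IsLpBoundedOn.memLp (hS : IsLpBoundedOn A S ps q A₀) (hA : Bornology.IsBounded A)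
    {f : Fin m → RSpace n → ℂ} (hf : ∀ j, IsBddOn A (f j)) :
    MemLp (S f) (ENNReal.ofReal q) volume :=
  ⟨hS.aestronglyMeasurable f hf, (hS.eLpNorm_le f hf).trans_lt (ENNReal.mul_lt_top
    ENNReal.coe_lt_top (ENNReal.prod_lt_top fun j _ ↦ ((hf j).memLp hA _).eLpNorm_lt_top))⟩

theorem IsLpBoundedOn.integrableOn (hS : IsLpBoundedOn A S ps q A₀) (hA : Bornology.IsBounded A)
    (hq : 1 ≤ q) {F : Set (RSpace n)} (hF : volume F ≠ ∞) {f : Fin m → RSpace n → ℂ}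
    (hf : ∀ j, IsBddOn A (f j)) : IntegrableOn (S f) F := by
  have : IsFiniteMeasure (volume.restrict F) := isFiniteMeasure_restrict.2 hF
  exact ((hS.memLp hA hf).restrict F).integrable (ENNReal.one_le_ofReal.2 hq)

variable {ι : Type*} [Fintype ι] {C₀ : ℝ≥0} {y : ι → RSpace n} {l : ι → ℝ}
  {E F : ι → Set (RSpace n)} {q' t : ℝ} {a : ι → ℝ≥0} {κ : ι → ℂ} {β : Fin m → ι → ℂ}
  {w : ι → Fin m → RSpace n → ℂ}

/-- The constant in the bounds for sparse sums of integrals of a bounded multilinear operator. -/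
def sparseFormConst (C₀ : ℝ≥0) (n : ℕ) (ps : Fin m → ℝ) (q' : ℝ) (A₀ : ℝ≥0) : ℝ≥0 :=
  sparseConst C₀ n q' * (A₀ * ∏ j, sparseConst C₀ n (ps j))

theorem IsLpBoundedOn.enorm_sum_mul_setIntegral_sum_le (hS : IsLpBoundedOn A S ps q A₀)
    (hA : Bornology.IsBounded A) (hE : IsSparseFamily volume C₀ y l E)
    (hqq' : q'.HolderConjugate q) (hps : ∀ j, 1 < ps j) (ht : 1 / t = 1 / q' + ∑ j, 1 / ps j)
    (hκ : ∀ Q, ‖κ Q‖₊ ≤ a Q ^ (t / q')) (hβ : ∀ j Q, ‖β j Q‖₊ ≤ a Q ^ (t / ps j))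
    (hF : ∀ Q, MeasurableSet (F Q)) (hFB : ∀ Q, F Q ⊆ Metric.closedBall (y Q) (l Q))
    (hw : ∀ Q j, IsBddOn A (w Q j))
    (hwB : ∀ Q j x, ‖w Q j x‖ₑ ≤ (Metric.closedBall (y Q) (l Q)).indicator 1 x) :
    ‖∑ Q, κ Q * ∫ x in F Q, S (fun j x ↦ ∑ P, β j P * w P j x) x‖ₑ ≤
      sparseFormConst C₀ n ps q' A₀ *
        (∑ Q, ((a Q ^ t : ℝ≥0) : ℝ≥0∞) * volume (E Q)) ^ (1 / t) := by
  set Y := ∑ Q, ((a Q ^ t : ℝ≥0) : ℝ≥0∞) * volume (E Q)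
  set g : Fin m → RSpace n → ℂ := fun j x ↦ ∑ P, β j P * w P j x
  have hg (j : Fin m) : IsBddOn A (g j) := by
    have h_sum := (bddSubmodule A).sum_smul_mem (t := Finset.univ) (fun P ↦ β j P)
      fun P _ ↦ (hw P j : w P j ∈ bddSubmodule A)
    have h_eq : g j = ∑ P, β j P • w P j := by
      ext x
      simp [g]
    rwa [h_eq]
  have hps₀ (j : Fin m) : 0 ≤ 1 / ps j := by have := hps j; positivity
  have hq'₀ : 0 ≤ 1 / q' := hqq'.one_div_nonneg
  have hF_top (Q : ι) : volume (F Q) ≠ ∞ :=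
    measure_ne_top_of_subset (hFB Q) measure_closedBall_lt_top.ne
  have hF_le (Q : ι) (x : RSpace n) :
      ‖(F Q).indicator (1 : RSpace n → ℂ) x‖ₑ ≤ (Metric.closedBall (y Q) (l Q)).indicator 1 x := by
    by_cases hx : x ∈ F Q
    · simp [hx, hFB Q hx]
    · simp [hx]
  have := hqq'.ennrealOfReal
  calc _ ≤ eLpNorm (fun x ↦ ∑ Q, κ Q * (F Q).indicator 1 x) (ENNReal.ofReal q') volume *
        eLpNorm (S g) (ENNReal.ofReal q) volume :=
        enorm_sum_mul_setIntegral_le hF hF_top κ (hS.memLp hA hg)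
    _ ≤ (sparseConst C₀ n q' * Y ^ (1 / q')) *
        (A₀ * ∏ j, (sparseConst C₀ n (ps j) * Y ^ (1 / ps j))) := by
        refine mul_le_mul' (hE.eLpNorm_sum_mul_le hqq'.lt hκ hF_le) ((hS.eLpNorm_le g hg).trans ?_)
        gcongr with j
        exact hE.eLpNorm_sum_mul_le (hps j) (hβ j) fun Q x ↦ hwB Q j x
    _ = _ := by
        rw [ht, ENNReal.rpow_add_of_nonneg _ _ hq'₀ (Finset.sum_nonneg fun j _ ↦ hps₀ j),
          ennreal_rpow_sum_of_nonneg Y fun j _ ↦ hps₀ j, Finset.prod_mul_distrib, sparseFormConst]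
        push_cast
        ring

/-- Averaging over signs isolates the diagonal terms `S (w Q)` of the previous estimate. -/
theorem IsLpBoundedOn.enorm_sum_mul_setIntegral_le (hS : IsLpBoundedOn A S ps q A₀)
    (hA : Bornology.IsBounded A) (hE : IsSparseFamily volume C₀ y l E)
    (hqq' : q'.HolderConjugate q) (hps : ∀ j, 1 < ps j) (ht : 1 / t = 1 / q' + ∑ j, 1 / ps j)
    (hκ : ∀ Q, ‖κ Q‖₊ ≤ a Q ^ (t / q')) (hβ : ∀ j Q, ‖β j Q‖₊ ≤ a Q ^ (t / ps j))
    (hF : ∀ Q, MeasurableSet (F Q)) (hFB : ∀ Q, F Q ⊆ Metric.closedBall (y Q) (l Q))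
    (hw : ∀ Q j, IsBddOn A (w Q j))
    (hwB : ∀ Q j x, ‖w Q j x‖ₑ ≤ (Metric.closedBall (y Q) (l Q)).indicator 1 x) :
    ‖∑ Q, (κ Q * ∏ j, β j Q) * ∫ x in F Q, S (w Q) x‖ₑ ≤ sparseFormConst C₀ n ps q' A₀ *
      (∑ Q, ((a Q ^ t : ℝ≥0) : ℝ≥0∞) * volume (E Q)) ^ (1 / t) := by
  have hF_top (Q : ι) : volume (F Q) ≠ ∞ :=
    measure_ne_top_of_subset (hFB Q) measure_closedBall_lt_top.ne
  choose Φ hΦ using fun Q ↦ hS.isAEMultilinearOn.exists_integral_form (F := F Q) fun f hf ↦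
    hS.integrableOn hA hqq'.symm.lt.le (hF_top Q) hf
  let w' : Fin m → ι → bddSubmodule A := fun j Q ↦ ⟨w Q j, hw Q j⟩
  have h_diag (Q : ι) : (κ Q • Φ Q) (fun j ↦ β j Q • w' j Q) =
      (κ Q * ∏ j, β j Q) * ∫ x in F Q, S (w Q) x := by
    rw [_root_.smul_apply, MultilinearMap.map_smul_univ, hΦ, smul_smul, smul_eq_mul]
  simp only [← h_diag]
  refine enorm_sum_diag_le (fun Q ↦ κ Q • Φ Q) (fun j Q ↦ β j Q • w' j Q) fun ε ↦ ?_
  have h_sign (e : ℤˣ) : ‖((e : ℤ) : ℂ)‖₊ = 1 := by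
    obtain rfl | rfl := Int.units_eq_one_or e <;> simp
  have h_eq (Q : ι) : (∏ j, ((ε j Q : ℤ) : ℂ)) *
      (κ Q • Φ Q) (fun j ↦ ∑ P, ((ε j P : ℤ) : ℂ) • β j P • w' j P) =
      ((∏ j, ((ε j Q : ℤ) : ℂ)) * κ Q) *
        ∫ x in F Q, S (fun j x ↦ ∑ P, ((ε j P : ℤ) : ℂ) * β j P * w P j x) x := by
    rw [_root_.smul_apply, hΦ, smul_eq_mul, mul_assoc]
    congr! 6 with x j
    ext x
    simp [w', mul_assoc]
  simp only [h_eq]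
  refine hS.enorm_sum_mul_setIntegral_sum_le hA hE hqq' hps ht (fun Q ↦ ?_) (fun j Q ↦ ?_) hF hFB
    hw hwB
  · simpa only [nnnorm_mul, nnnorm_prod, h_sign, Finset.prod_const_one, one_mul] using hκ Q
  · simpa only [nnnorm_mul, h_sign, one_mul] using hβ j Q

theorem IsLpBoundedOn.enorm_sum_weight_mul_setIntegral_le (hS : IsLpBoundedOn A S ps q A₀)
    (hA : Bornology.IsBounded A) (hE : IsSparseFamily volume C₀ y l E)
    (hqq' : q'.HolderConjugate q) (hps : ∀ j, 1 < ps j) (ht₀ : 0 < t)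
    (ht : 1 / t = 1 / q' + ∑ j, 1 / ps j) (a : ι → ℝ≥0) {θ : ι → ℂ} (hθ : ∀ Q, ‖θ Q‖₊ ≤ 1)
    (hF : ∀ Q, MeasurableSet (F Q)) (hFB : ∀ Q, F Q ⊆ Metric.closedBall (y Q) (l Q))
    (hw : ∀ Q j, IsBddOn A (w Q j))
    (hwB : ∀ Q j x, ‖w Q j x‖ₑ ≤ (Metric.closedBall (y Q) (l Q)).indicator 1 x) :
    ‖∑ Q, a Q * (θ Q * ∫ x in F Q, S (w Q) x)‖ₑ ≤ sparseFormConst C₀ n ps q' A₀ *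
      (∑ Q, ((a Q ^ t : ℝ≥0) : ℝ≥0∞) * volume (E Q)) ^ (1 / t) := by
  have h_nnnorm (u : ℝ≥0) : ‖(u : ℂ)‖₊ = u := by ext; simp
  have h_weight (Q : ι) : (a Q : ℂ) * θ Q =
      (a Q ^ (t / q') : ℝ≥0) * θ Q * ∏ j, ((a Q ^ (t / ps j) : ℝ≥0) : ℂ) := by
    rw [mul_right_comm]
    exact_mod_cast congr_arg (fun u : ℝ≥0 ↦ (u : ℂ) * θ Q)
      (nnreal_rpow_mul_prod_rpow (a Q) ht₀ hqq'.pos (fun j ↦ one_pos.trans (hps j)) ht).symm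
  simp only [← mul_assoc, h_weight]
  refine hS.enorm_sum_mul_setIntegral_le hA hE hqq' hps ht (fun Q ↦ ?_) (fun j Q ↦ ?_) hF hFB hw hwB
  · rw [nnnorm_mul, h_nnnorm]
    exact mul_le_of_le_one_right' (hθ Q)
  · exact (h_nnnorm _).le

end SparseForm

section WeightedTesting

variable {n m : ℕ} {A : Set (RSpace n)} {s : Fin m → ℝ≥0∞} {s₀ : ℝ≥0∞}
  {T : LpMultilinear n m s s₀} {K : RSpace n → (Fin m → RSpace n) → ℂ} {C : ℝ} {ω : ℝ → ℝ}
  {b : RSpace n → ℝ} {i : Fin m} {k : ℕ} {ps : Fin m → ℝ} {q : ℝ} {A₀ : ℝ≥0}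

theorem aestronglyMeasurable_iteratedCommutator (T : LpMultilinear n m s s₀) (hb : Measurable b)
    (i : Fin m) (k : ℕ) (f : Fin m → RSpace n → ℂ) :
    AEStronglyMeasurable (iteratedCommutator b i k T.onFunctions f) volume := by
  induction k generalizing f with
  | zero => exact Lp.aestronglyMeasurable _
  | succ k ih =>
    have hbℂ : Measurable fun x ↦ (b x : ℂ) := by fun_prop
    exact (hbℂ.aestronglyMeasurable.mul (ih f)).sub (ih _)

theorem IsBddOn.mem_commutatorDomain (hb : Measurable b) (hA : Bornology.IsBounded A) {M : ℝ}
    (hbA : ∀ x ∈ A, |b x| ≤ M) (s p : Fin m → ℝ≥0∞) (i : Fin m) (k : ℕ)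
    {f : Fin m → RSpace n → ℂ} (hf : ∀ j, IsBddOn A (f j)) : f ∈ commutatorDomain s p b i k := by
  refine ⟨fun j ↦ (hf j).memLp hA _, fun j ↦ (hf j).memLp hA _, fun j _ ↦ ?_⟩
  have h_pow : ∀ x ∈ A, ‖(b x : ℂ) ^ j‖ ≤ M ^ j := fun x hx ↦ by
    rw [norm_pow]
    exact pow_le_pow_left₀ (norm_nonneg _) (by simpa using hbA x hx) j
  exact ((hf i).mul_left (by fun_prop) h_pow).memLp hA _

theorem isLpBoundedOn_iteratedCommutator (hb : Measurable b) (hA : Bornology.IsBounded A) {M : ℝ}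
    (hbA : ∀ x ∈ A, |b x| ≤ M)
    (hA₀ : ∀ f ∈ commutatorDomain s (fun j ↦ ENNReal.ofReal (ps j)) b i k,
      eLpNorm (iteratedCommutator b i k T.onFunctions f) (ENNReal.ofReal q) volume ≤
        A₀ * ∏ j, eLpNorm (f j) (ENNReal.ofReal (ps j)) volume) :
    IsLpBoundedOn A (iteratedCommutator b i k T.onFunctions) ps q A₀ where
  isAEMultilinearOn := (T.isAEMultilinearOn hA).iteratedCommutator hb hbA i k
  aestronglyMeasurable f _ := aestronglyMeasurable_iteratedCommutator T hb i k f
  eLpNorm_le f hf := hA₀ f (IsBddOn.mem_commutatorDomain hb hA hbA s _ i k hf)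

theorem IsTestSets.sum_le_norm_sum {ι : Type*} [Fintype ι] (hT : IsInitiallyBounded T)
    (hK : IsMultilinearCZKernel K C ω) (hTK : IsRepresentedBy T.onFunctions K) (hb : Measurable b)
    {Λ c₁ σ M : ℝ} {y x₀ : ι → RSpace n} {l c : ι → ℝ} {K₀ : ι → ℂ} {F : ι → Set (RSpace n)}
    {W : ι → Fin m → Set (RSpace n)}
    (h : ∀ Q, IsTestSets b i (c Q) σ M (y Q) (x₀ Q) (l Q) (W Q) (F Q))
    (hrefl : ∀ Q, IsReflection K Λ c₁ (y Q) (l Q) (x₀ Q) (K₀ Q)) (hl : ∀ Q, 0 < l Q)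
    (h_int : ∀ Q, IntegrableOn (iteratedCommutator b i k T.onFunctions
      fun j ↦ (W Q j).indicator 1) (F Q)) (a : ι → ℝ≥0) :
    c₁ / (2 * 2 ^ m) * ∑ Q, a Q * ∫ z in W Q i, |b z - c Q| ^ k ≤
      ‖∑ Q, a Q * (testPhase (K₀ Q) σ k * ∫ x in F Q, iteratedCommutator b i k T.onFunctions
        (fun j ↦ (W Q j).indicator 1) x)‖ := by
  refine le_trans ?_ (Complex.re_le_norm _)
  rw [Finset.mul_sum, Complex.re_sum]
  refine Finset.sum_le_sum fun Q _ ↦ ?_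
  rw [mul_left_comm, Complex.re_ofReal_mul]
  exact mul_le_mul_of_nonneg_left ((h Q).setIntegral_le_re_integral_iteratedCommutator hT hK hTK
    (hrefl Q) (hl Q) hb k (h_int Q)) (a Q).2

theorem exists_weighted_testing (hT : IsInitiallyBounded T) (hK : IsMultilinearCZKernel K C ω)
    (hTK : IsRepresentedBy T.onFunctions K) (hb : Measurable b)
    (hbdd : IsBoundedOnDomain (commutatorDomain s (fun j ↦ ENNReal.ofReal (ps j)) b i k)
      (iteratedCommutator b i k T.onFunctions) (fun j ↦ ENNReal.ofReal (ps j))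
      (ENNReal.ofReal q))
    {q' t : ℝ} (hqq' : q'.HolderConjugate q) (hps : ∀ j, 1 < ps j) (ht₀ : 0 < t)
    (ht : 1 / t = 1 / q' + ∑ j, 1 / ps j) {Λ c₁ : ℝ} (hΛ : 0 ≤ Λ) (hc₁ : 0 < c₁) (C₀ : ℝ≥0) :
    ∃ C₂ : ℝ≥0, ∀ {ι : Type} [Fintype ι] {y x₀ : ι → RSpace n} {l : ι → ℝ} {K₀ : ι → ℂ}
      {E F : ι → Set (RSpace n)} {W : ι → Fin m → Set (RSpace n)} {c : ι → ℝ} {σ M : ℝ},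
      IsSparseFamily volume C₀ y l E →
      (∀ Q, IsReflection K Λ c₁ (y Q) (l Q) (x₀ Q) (K₀ Q)) → |σ| = 1 →
      (∀ Q, IsTestSets b i (c Q) σ M (y Q) (x₀ Q) (l Q) (W Q) (F Q)) → ∀ a : ι → ℝ≥0,
      ENNReal.ofReal (∑ Q, a Q * ∫ z in W Q i, |b z - c Q| ^ k) ≤
        C₂ * (∑ Q, ((a Q ^ t : ℝ≥0) : ℝ≥0∞) * volume (E Q)) ^ (1 / t) := by
  obtain ⟨A₀, hA₀⟩ := hbdd
  lift Λ to ℝ≥0 using hΛ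
  refine ⟨(2 * 2 ^ m / c₁).toNNReal * sparseFormConst ((Λ + 1) ^ n * C₀) n ps q' A₀,
    fun {ι} _ {y x₀ l K₀ E F W c σ M} hE hrefl hσ h a ↦ ?_⟩
  have hE' := hE.dilate (le_add_self : 1 ≤ Λ + 1)
  set B : ι → Set (RSpace n) := fun Q ↦ Metric.closedBall (y Q) ((Λ + 1 : ℝ≥0) * l Q)
  have h_sub (Q : ι) : Metric.closedBall (y Q) (l Q) ⊆ B Q :=
    Metric.closedBall_subset_closedBall
      (le_mul_of_one_le_left (hE.radius_pos Q).le (le_add_self : 1 ≤ Λ + 1))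
  have hFB (Q : ι) : F Q ⊆ B Q := (h Q).output_subset.trans
    (Metric.closedBall_subset_closedBall' (by push_cast; linarith [(hrefl Q).dist_le]))
  set A : Set (RSpace n) := (⋃ Q, B Q) ∩ {z | |b z| ≤ M}
  have hA : Bornology.IsBounded A :=
    (Bornology.isBounded_iUnion.2 fun Q ↦ Metric.isBounded_closedBall).subset Set.inter_subset_left
  have hS := isLpBoundedOn_iteratedCommutator hb hA (fun x hx ↦ hx.2) hA₀
  have hw (Q : ι) (j : Fin m) : IsBddOn A ((W Q j).indicator 1) :=
    ((h Q).isBddOn_indicator j).mono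
      (Set.inter_subset_inter_left _ ((h_sub Q).trans (Set.subset_iUnion B Q)))
  have hwB (Q : ι) (j : Fin m) (x : RSpace n) :
      ‖(W Q j).indicator (1 : RSpace n → ℂ) x‖ₑ ≤ (B Q).indicator 1 x := by
    by_cases hx : x ∈ W Q j
    · simp [hx, h_sub Q ((h Q).input_subset j hx).1]
    · simp [hx]
  have h_int (Q : ι) : IntegrableOn (iteratedCommutator b i k T.onFunctions
      fun j ↦ (W Q j).indicator 1) (F Q) :=
    hS.integrableOn hA hqq'.symm.lt.le
      (measure_ne_top_of_subset (hFB Q) measure_closedBall_lt_top.ne) (hw Q)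
  have h_upper := hS.enorm_sum_weight_mul_setIntegral_le hA hE' hqq' hps ht₀ ht a
    (fun Q ↦ norm_testPhase_le hσ (K₀ Q) k) (fun Q ↦ (h Q).measurableSet_output) hFB hw hwB
  have h_lower := IsTestSets.sum_le_norm_sum hT hK hTK hb h hrefl hE.radius_pos h_int a
  have h_ofReal := (ENNReal.ofReal_le_ofReal h_lower).trans ((ofReal_norm _).le.trans h_upper)
  have hc : 0 < c₁ / (2 * 2 ^ m) := by positivity
  rw [ENNReal.ofReal_mul hc.le] at h_ofReal
  rw [ENNReal.coe_mul, mul_assoc, ← inv_div, Real.toNNReal_inv, ENNReal.coe_inv (by simpa using hc)]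
  exact (ENNReal.mul_le_iff_le_inv (by simpa using hc) ENNReal.ofReal_ne_top).1 h_ofReal

end WeightedTesting

/-! ### Oscillations over sparse families -/

section Testing

theorem monotone_inter_abs_le {α : Type*} (b : α → ℝ) (S : Set α) :
    Monotone fun N : ℕ ↦ S ∩ {z | |b z| ≤ N} :=
  fun _ _ h _ hz ↦ ⟨hz.1, le_trans (Set.mem_ofPred_eq.mp hz.2) (Nat.cast_le.2 h)⟩

theorem iUnion_inter_abs_le {α : Type*} (b : α → ℝ) (S : Set α) :
    ⋃ N : ℕ, S ∩ {z | |b z| ≤ N} = S := by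
  rw [← Set.inter_iUnion, Set.inter_eq_left]
  exact fun z _ ↦ Set.mem_iUnion.2 (exists_nat_ge |b z|)

theorem eventually_measureReal_le_two_mul_inter_abs_le {α : Type*} [MeasurableSpace α]
    {μ : Measure α} (b : α → ℝ) {S : Set α} (hS : μ S ≠ ∞) :
    ∀ᶠ N : ℕ in atTop, μ.real S ≤ 2 * μ.real (S ∩ {z | |b z| ≤ N}) := by
  rcases (measureReal_nonneg (μ := μ) (s := S)).eq_or_lt with h | h
  · exact .of_forall fun N ↦ h.symm.trans_le (by positivity)
  · have h_lim : Tendsto (fun N : ℕ ↦ μ.real (S ∩ {z | |b z| ≤ N})) atTop (𝓝 (μ.real S)) := by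
      have := tendsto_measure_iUnion_atTop (μ := μ) (monotone_inter_abs_le b S)
      rw [iUnion_inter_abs_le] at this
      exact (ENNReal.tendsto_toReal hS).comp this
    filter_upwards [h_lim.eventually (lt_mem_nhds (half_lt_self h))] with N hN
    linarith

/-- The extremal weight in the converse of Hölder's inequality is `o ^ (r - 1)`. -/
theorem sum_rpow_mul_le_of_forall_weight {ι : Type*} [Fintype ι] {o : ι → ℝ≥0} {e : ι → ℝ≥0∞}
    (he : ∀ Q, e Q ≠ ∞) {D : ℝ≥0∞} {r t : ℝ} (hrt : r.HolderConjugate t)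
    (h : ∀ a : ι → ℝ≥0, ∑ Q, (a Q * o Q : ℝ≥0∞) * e Q ≤
      D * (∑ Q, ((a Q ^ t : ℝ≥0) : ℝ≥0∞) * e Q) ^ (1 / t)) :
    ∑ Q, ((o Q ^ r : ℝ≥0) : ℝ≥0∞) * e Q ≤ D ^ r := by
  set X := ∑ Q, ((o Q ^ r : ℝ≥0) : ℝ≥0∞) * e Q
  have hX : X ≠ ∞ :=
    (ENNReal.sum_lt_top.2 fun Q _ ↦ (ENNReal.mul_ne_top ENNReal.coe_ne_top (he Q)).lt_top).ne
  have h_mul (Q : ι) : o Q ^ (r - 1) * o Q = o Q ^ r := by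
    rw [← NNReal.rpow_add_one' (by simpa using hrt.ne_zero), sub_add_cancel]
  have h_rpow (Q : ι) : (o Q ^ (r - 1)) ^ t = o Q ^ r := by
    rw [← NNReal.rpow_mul, hrt.sub_one_mul_conj]
  have hX_le : X ≤ D * X ^ (1 / t) := by
    simpa only [← ENNReal.coe_mul, h_mul, h_rpow] using h fun Q ↦ o Q ^ (r - 1)
  have h_inv : 1 / r + 1 / t = 1 := by simpa only [one_div] using hrt.inv_add_inv_eq_one
  exact (ENNReal.rpow_inv_le_iff hrt.pos).1 (by
    simpa only [one_div] using ennreal_rpow_le_of_le_mul_rpow (one_div_pos.2 hrt.pos)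
      (one_div_pos.2 hrt.symm.pos) h_inv hX hX_le)

variable {n m : ℕ} {s : Fin m → ℝ≥0∞} {s₀ : ℝ≥0∞} {T : LpMultilinear n m s s₀}
  {K : RSpace n → (Fin m → RSpace n) → ℂ} {C : ℝ} {ω : ℝ → ℝ}
  {b : RSpace n → ℝ} {i : Fin m} {k : ℕ} {ps : Fin m → ℝ} {q : ℝ}

theorem measureReal_closedBall_le_two_mul {y₀ x₀ : RSpace n} {l : ℝ} {V : Set (RSpace n)}
    (h : volume (Metric.closedBall x₀ l) ≤ 2 * volume (Metric.closedBall x₀ l ∩ V)) :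
    volume.real (Metric.closedBall y₀ l) ≤ 2 * volume.real (Metric.closedBall x₀ l ∩ V) := by
  have h_fin : volume (Metric.closedBall x₀ l ∩ V) ≠ ∞ :=
    measure_ne_top_of_subset Set.inter_subset_left measure_closedBall_lt_top.ne
  rw [Measure.addHaar_closedBall_center volume x₀, ← Measure.addHaar_closedBall_center volume y₀]
    at h
  simpa [Measure.real] using ENNReal.toReal_mono (ENNReal.mul_ne_top (by simp) h_fin) h

theorem isTestSets_update (hb : Measurable b) (i : Fin m) {c σ M l : ℝ} {y₀ x₀ : RSpace n}
    {U V : Set (RSpace n)} (hU : MeasurableSet U) (hV : MeasurableSet V)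
    (hM : volume.real (Metric.closedBall y₀ l) ≤
      2 * volume.real (Metric.closedBall y₀ l ∩ {z | |b z| ≤ M}))
    (h_half : volume (Metric.closedBall x₀ l) ≤ 2 * volume (Metric.closedBall x₀ l ∩ V))
    (hUV : ∀ x ∈ V, ∀ z ∈ U, |b z - c| ≤ σ * (b z - b x)) :
    IsTestSets b i c σ M y₀ x₀ l
      (Function.update (fun _ ↦ Metric.closedBall y₀ l ∩ {z | |b z| ≤ M}) i
        (Metric.closedBall y₀ l ∩ {z | |b z| ≤ M} ∩ U)) (Metric.closedBall x₀ l ∩ V) where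
  measurableSet_input := by
    have h : MeasurableSet (Metric.closedBall y₀ l ∩ {z | |b z| ≤ M}) :=
      measurableSet_closedBall.inter (measurableSet_le hb.abs measurable_const)
    exact (Function.forall_update_iff _ fun _ ↦ MeasurableSet).2 ⟨h.inter hU, fun _ _ ↦ h⟩
  measurableSet_output := measurableSet_closedBall.inter hV
  input_subset := (Function.forall_update_iff _
      fun _ S ↦ S ⊆ Metric.closedBall y₀ l ∩ {z | |b z| ≤ M}).2
    ⟨Set.inter_subset_left, fun _ _ ↦ subset_rfl⟩
  output_subset := Set.inter_subset_left
  volume_le_input j hj := by simpa only [Function.update_of_ne hj] using hM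
  volume_le_output := measureReal_closedBall_le_two_mul h_half
  abs_sub_le x hx z hz := hUV x hx.2 z (by rw [Function.update_self] at hz; exact hz.2)

theorem IsMedianOn.isTestSets_upper {c M l : ℝ} {y₀ x₀ : RSpace n}
    (hc : IsMedianOn volume b (Metric.closedBall x₀ l) c) (hb : Measurable b) (i : Fin m)
    (hM : volume.real (Metric.closedBall y₀ l) ≤
      2 * volume.real (Metric.closedBall y₀ l ∩ {z | |b z| ≤ M})) :
    IsTestSets b i c 1 M y₀ x₀ l
      (Function.update (fun _ ↦ Metric.closedBall y₀ l ∩ {z | |b z| ≤ M}) i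
        (Metric.closedBall y₀ l ∩ {z | |b z| ≤ M} ∩ {z | c ≤ b z}))
      (Metric.closedBall x₀ l ∩ {x | b x ≤ c}) :=
  isTestSets_update hb i (measurableSet_le measurable_const hb)
    (measurableSet_le hb measurable_const) hM hc.measure_le_two_mul_lower fun x hx z hz ↦ by
      rw [Set.mem_ofPred_eq] at hx hz
      rw [abs_of_nonneg (sub_nonneg.2 hz)]
      linarith

theorem IsMedianOn.isTestSets_lower {c M l : ℝ} {y₀ x₀ : RSpace n}
    (hc : IsMedianOn volume b (Metric.closedBall x₀ l) c) (hb : Measurable b) (i : Fin m)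
    (hM : volume.real (Metric.closedBall y₀ l) ≤
      2 * volume.real (Metric.closedBall y₀ l ∩ {z | |b z| ≤ M})) :
    IsTestSets b i c (-1) M y₀ x₀ l
      (Function.update (fun _ ↦ Metric.closedBall y₀ l ∩ {z | |b z| ≤ M}) i
        (Metric.closedBall y₀ l ∩ {z | |b z| ≤ M} ∩ {z | c ≤ b z}ᶜ))
      (Metric.closedBall x₀ l ∩ {x | c ≤ b x}) :=
  isTestSets_update hb i (measurableSet_le measurable_const hb).compl
    (measurableSet_le measurable_const hb) hM hc.measure_le_two_mul_upper fun x hx z hz ↦ by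
      rw [Set.mem_compl_iff, Set.mem_ofPred_eq, not_le] at hz
      rw [Set.mem_ofPred_eq] at hx
      rw [abs_of_neg (sub_neg.2 hz)]
      linarith

theorem exists_median_testing (hT : IsInitiallyBounded T) (hK : IsMultilinearCZKernel K C ω)
    (hTK : IsRepresentedBy T.onFunctions K) (hb : Measurable b) (hbk : MemLpLoc (k : ℝ≥0∞) b)
    (hbdd : IsBoundedOnDomain (commutatorDomain s (fun j ↦ ENNReal.ofReal (ps j)) b i k)
      (iteratedCommutator b i k T.onFunctions) (fun j ↦ ENNReal.ofReal (ps j))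
      (ENNReal.ofReal q))
    {q' t : ℝ} (hqq' : q'.HolderConjugate q) (hps : ∀ j, 1 < ps j) (ht₀ : 0 < t)
    (ht : 1 / t = 1 / q' + ∑ j, 1 / ps j) {Λ c₁ : ℝ} (hΛ : 0 ≤ Λ) (hc₁ : 0 < c₁) (C₀ : ℝ≥0) :
    ∃ C₂ : ℝ≥0, ∀ {ι : Type} [Fintype ι] {y x₀ : ι → RSpace n} {l : ι → ℝ} {K₀ : ι → ℂ}
      {E : ι → Set (RSpace n)} {c : ι → ℝ}, IsSparseFamily volume C₀ y l E →
      (∀ Q, IsReflection K Λ c₁ (y Q) (l Q) (x₀ Q) (K₀ Q)) →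
      (∀ Q, IsMedianOn volume b (Metric.closedBall (x₀ Q) (l Q)) (c Q)) → ∀ a : ι → ℝ≥0,
      ENNReal.ofReal (∑ Q, a Q * ∫ z in Metric.closedBall (y Q) (l Q), |b z - c Q| ^ k) ≤
        C₂ * (∑ Q, ((a Q ^ t : ℝ≥0) : ℝ≥0∞) * volume (E Q)) ^ (1 / t) := by
  obtain ⟨C₂, h⟩ := exists_weighted_testing hT hK hTK hb hbdd hqq' hps ht₀ ht hΛ hc₁ C₀
  refine ⟨2 * C₂, fun {ι} _ {y x₀ l K₀ E c} hE hrefl hc a ↦ ?_⟩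
  set B : ι → Set (RSpace n) := fun Q ↦ Metric.closedBall (y Q) (l Q)
  have h_int (Q : ι) : IntegrableOn (fun z ↦ |b z - c Q| ^ k) (B Q) :=
    hbk.integrableOn_pow_abs_sub Metric.isBounded_closedBall _
  have h_lim : Tendsto (fun N : ℕ ↦ ENNReal.ofReal
      (∑ Q, a Q * ∫ z in B Q ∩ {z | |b z| ≤ N}, |b z - c Q| ^ k)) atTop
      (𝓝 (ENNReal.ofReal (∑ Q, a Q * ∫ z in B Q, |b z - c Q| ^ k))) := by
    refine ENNReal.tendsto_ofReal (tendsto_finsetSum _ fun Q _ ↦ .const_mul _ ?_)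
    have := tendsto_setIntegral_of_monotone (μ := volume) (f := fun z ↦ |b z - c Q| ^ k)
      (fun N : ℕ ↦ measurableSet_closedBall.inter (measurableSet_le hb.abs measurable_const))
      (monotone_inter_abs_le b (B Q)) (by rw [iUnion_inter_abs_le]; exact h_int Q)
    rwa [iUnion_inter_abs_le] at this
  refine le_of_tendsto h_lim ?_
  filter_upwards [eventually_all.2 fun Q ↦ eventually_measureReal_le_two_mul_inter_abs_le b
    (measure_closedBall_lt_top (μ := volume) (x := y Q) (r := l Q)).ne] with N hN
  have h_upper := h hE hrefl (by simp) (fun Q ↦ (hc Q).isTestSets_upper hb i (hN Q)) a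
  have h_lower := h hE hrefl (by simp) (fun Q ↦ (hc Q).isTestSets_lower hb i (hN Q)) a
  simp only [Function.update_self] at h_upper h_lower
  have h_split (Q : ι) : ∫ z in B Q ∩ {z | |b z| ≤ N}, |b z - c Q| ^ k =
      (∫ z in B Q ∩ {z | |b z| ≤ N} ∩ {z | c Q ≤ b z}, |b z - c Q| ^ k) +
        ∫ z in B Q ∩ {z | |b z| ≤ N} ∩ {z | c Q ≤ b z}ᶜ, |b z - c Q| ^ k := by
    rw [← Set.sdiff_eq, integral_inter_add_sdiff (measurableSet_le measurable_const hb)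
      ((h_int Q).mono_set Set.inter_subset_left)]
  simp only [h_split, mul_add, Finset.sum_add_distrib]
  refine ENNReal.ofReal_add_le.trans ((add_le_add h_upper h_lower).trans_eq ?_)
  rw [ENNReal.coe_mul, ← two_mul, mul_assoc, ENNReal.coe_ofNat]

theorem ofReal_setAverage_mul_measure_le {α : Type*} [MeasurableSpace α] {μ : Measure α}
    {f : α → ℝ} {A B : Set α} (hAB : A ⊆ B) (hB : μ B ≠ ∞) :
    ENNReal.ofReal (⨍ x in B, f x ∂μ) * μ A ≤ ENNReal.ofReal (∫ x in B, f x ∂μ) := by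
  calc ENNReal.ofReal (⨍ x in B, f x ∂μ) * μ A ≤ ENNReal.ofReal (⨍ x in B, f x ∂μ) * μ B := by
        gcongr
    _ = ENNReal.ofReal (∫ x in B, f x ∂μ) := by
        rw [← measure_smul_setAverage f hB, smul_eq_mul, ENNReal.ofReal_mul measureReal_nonneg,
          ofReal_measureReal hB, mul_comm]

/-- Over every sparse family with constant `C₀`, the `L^k` oscillations of `b` about the constants
`c y l` on the balls `B(y, l)` are bounded in `ℓ^{kr}`, with major subsets as weights. -/
def IsSparseOscillationBound {n : ℕ} (C₀ : ℝ≥0) (k : ℕ) (r : ℝ) (b : RSpace n → ℝ)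
    (c : RSpace n → ℝ → ℝ) (V : ℝ≥0) : Prop :=
  ∀ {ι : Type} [Fintype ι] {y : ι → RSpace n} {l : ι → ℝ} {E : ι → Set (RSpace n)},
    IsSparseFamily volume C₀ y l E →
      ∑ Q, ENNReal.ofReal (⨍ z in Metric.closedBall (y Q) (l Q), |b z - c (y Q) (l Q)| ^ k) ^ r *
        volume (E Q) ≤ V

theorem exists_isSparseOscillationBound (hT : IsNondegenerateCZO T) (hb : Measurable b)
    (hbk : MemLpLoc (k : ℝ≥0∞) b)
    (hbdd : IsBoundedOnDomain (commutatorDomain s (fun j ↦ ENNReal.ofReal (ps j)) b i k)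
      (iteratedCommutator b i k T.onFunctions) (fun j ↦ ENNReal.ofReal (ps j))
      (ENNReal.ofReal q))
    (hq : 1 < q) (hps : ∀ j, 1 < ps j) {r : ℝ} (hr₁ : 1 < r)
    (hr : 1 / r = 1 / q - ∑ j, 1 / ps j) (C₀ : ℝ≥0) :
    ∃ V c, IsSparseOscillationBound C₀ k r b c V := by
  obtain ⟨hT_bdd, K, C, ω, hK, hTK, hKn⟩ := hT
  obtain ⟨Λ, c₁, hΛ, hc₁, hrefl⟩ := hK.exists_isReflection hKn i.pos
  have h_median (y₀ : RSpace n) (l : ℝ) (hl : 0 < l) : ∃ (x₀ : RSpace n) (K₀ : ℂ) (c : ℝ),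
      IsReflection K Λ c₁ y₀ l x₀ K₀ ∧ IsMedianOn volume b (Metric.closedBall x₀ l) c := by
    obtain ⟨x₀, K₀, h⟩ := hrefl y₀ l hl
    exact ⟨x₀, K₀, (exists_isMedianOn measure_closedBall_lt_top.ne hb).imp fun c hc ↦ ⟨h, hc⟩⟩
  choose! x₀ K₀ c hrefl hc using h_median
  have hrt := Real.HolderConjugate.conjExponent hr₁
  have hqq' := (Real.HolderConjugate.conjExponent hq).symm
  have ht : 1 / r.conjExponent = 1 / q.conjExponent + ∑ j, 1 / ps j := by
    have h_r := hrt.inv_add_inv_eq_one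
    have h_q := hqq'.inv_add_inv_eq_one
    simp only [one_div] at hr ⊢
    linarith
  obtain ⟨C₂, h⟩ := exists_median_testing hT_bdd hK hTK hb hbk hbdd hqq' hps hrt.symm.pos ht hΛ hc₁
    C₀
  refine ⟨C₂ ^ r, c, fun {ι} _ {y l E} hE ↦ ?_⟩
  have hE_fin (Q : ι) : volume (E Q) ≠ ∞ :=
    measure_ne_top_of_subset (hE.subset Q) measure_closedBall_lt_top.ne
  have h_weight (a : ι → ℝ≥0) := h hE (fun Q ↦ hrefl _ _ (hE.radius_pos Q))
    (fun Q ↦ hc _ _ (hE.radius_pos Q)) a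
  simp only [ENNReal.ofReal, ← ENNReal.coe_rpow_of_nonneg _ hrt.nonneg]
  rw [ENNReal.coe_rpow_of_nonneg _ hrt.nonneg]
  refine sum_rpow_mul_le_of_forall_weight hE_fin hrt fun a ↦ le_trans ?_ (h_weight a)
  rw [ENNReal.ofReal_sum_of_nonneg fun Q _ ↦ by positivity]
  refine Finset.sum_le_sum fun Q _ ↦ ?_
  rw [ENNReal.ofReal_mul (a Q).coe_nonneg, ENNReal.ofReal_coe_nnreal, mul_assoc]
  gcongr
  exact ofReal_setAverage_mul_measure_le (hE.subset Q) measure_closedBall_lt_top.ne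

end Testing

/-! ### From the cubes to the whole space -/

section GlobalBound

variable {n : ℕ} {L : ℝ} {k : ℕ} {b : RSpace n → ℝ}

theorem isSparseFamily_gridBall (hn : 0 < n) (hL : 0 < L) {S : Finset (ℕ × (Fin n → ℤ))}
    {E : ℕ × (Fin n → ℤ) → Set (RSpace n)} (hE : ∀ I, MeasurableSet (E I))
    (hE_subset : ∀ I, E I ⊆ gridCube L I.1 I.2) (hE_disj : Pairwise (Function.onFun Disjoint E))
    (hE_volume : ∀ I ∈ S, volume (gridCube L I.1 I.2) ≤ 2 * volume (E I)) :
    IsSparseFamily volume (2 * gridRatio n) (fun I : S ↦ gridCorner L I.1.1 I.1.2)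
      (fun I ↦ gridRadius n L I.1.1) fun I ↦ E I where
  radius_pos I := gridRadius_pos hn hL I.1.1
  measurableSet I := hE I
  subset I := (hE_subset I).trans (gridCube_subset_gridBall hL)
  disjoint := hE_disj.comp_of_injective Subtype.val_injective
  measure_le I := by
    refine (volume_gridBall hL I.1.1 I.1.2).trans_le ?_
    rw [ENNReal.coe_mul, mul_comm ((2 : ℝ≥0) : ℝ≥0∞), mul_assoc]
    gcongr
    exact hE_volume I I.2

theorem enorm_indicator_gridCube_le (hn : 0 < n) (hL : 0 < L) (hb : MemLpLoc (k : ℝ≥0∞) b)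
    (t : ℝ) (j : ℕ) (κ : Fin n → ℤ) (x : RSpace n) :
    ‖(gridCube L j κ).indicator
      (fun _ ↦ (⨍ y in gridCube L j κ, |b y - t| ^ k) ^ (1 / k : ℝ)) x‖ₑ ≤
    (gridBall L j κ).indicator (fun _ ↦ (((gridRatio n *
      (⨍ y in gridBall L j κ, |b y - t| ^ k).toNNReal) ^ (1 / k : ℝ) : ℝ≥0) : ℝ≥0∞)) x := by
  by_cases hx : x ∈ gridCube L j κ
  swap; · simp [hx]
  have h_nonneg (A : Set (RSpace n)) : 0 ≤ ⨍ y in A, |b y - t| ^ k :=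
    setAverage_nonneg (fun _ ↦ by positivity) A
  rw [Set.indicator_of_mem hx, Set.indicator_of_mem (gridCube_subset_gridBall hL hx),
    Real.enorm_of_nonneg (Real.rpow_nonneg (h_nonneg _) _), ENNReal.ofReal_le_coe]
  push_cast
  rw [Real.coe_toNNReal _ (h_nonneg _)]
  exact Real.rpow_le_rpow (h_nonneg _) (setAverage_gridCube_le hn hL (fun _ ↦ by positivity)
    (hb.integrableOn_pow_abs_sub Metric.isBounded_closedBall t)) (by positivity)

/-- The constant in the `L^{kr}` bound for the dyadic averages of `b`, in terms of a bound `V` for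
the oscillations of `b` over sparse families. -/
def dyadicAverageConst (n k : ℕ) (r : ℝ) (V : ℝ≥0) : ℝ≥0 :=
  (1 + (2 * 2 ^ n) ^ (1 / k : ℝ)) *
    (sparseConst (2 * gridRatio n) n (k * r) * (gridRatio n ^ r * V) ^ (1 / (k * r)))

theorem eLpNorm_setAverage_sub_le (hn : 0 < n) (hL : 0 < L) (hk : 1 ≤ k)
    (hb : MemLpLoc (k : ℝ≥0∞) b) {r : ℝ} (hr : 1 < r) {c : RSpace n → ℝ → ℝ} {V : ℝ≥0}
    (h : IsSparseOscillationBound (2 * gridRatio n) k r b c V) (N : ℕ) :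
    eLpNorm (fun x ↦ (⨍ y in gridCube L N (gridMap L N x), b y) -
        c (gridCorner L 0 0) (gridRadius n L 0)) (ENNReal.ofReal (k * r))
      (volume.restrict (gridCube L 0 0)) ≤ dyadicAverageConst n k r V := by
  have hkr : 1 < k * r := one_lt_mul_of_le_of_lt (by exact_mod_cast hk) hr
  let cI (I : ℕ × (Fin n → ℤ)) : ℝ := c (gridCorner L I.1 I.2) (gridRadius n L I.1)
  obtain ⟨S, E, hE, hE_subset, hE_disj, hE_volume, h_dom⟩ :=
    exists_sparse_domination hL hk hb cI N
  have h_sparse := isSparseFamily_gridBall hn hL hE hE_subset hE_disj hE_volume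
  let o (I : ℕ × (Fin n → ℤ)) : ℝ≥0 := (⨍ y in gridBall L I.1 I.2, |b y - cI I| ^ k).toNNReal
  have h_pow (I : S) : (((gridRatio n * o I) ^ (1 / k : ℝ) : ℝ≥0) : ℝ≥0∞) ^ (k * r) =
      gridRatio n ^ r * (o I : ℝ≥0∞) ^ r := by
    rw [← ENNReal.coe_rpow_of_nonneg _ (by positivity), ← NNReal.rpow_mul, ← mul_assoc,
      one_div_mul_cancel (by positivity), one_mul, ENNReal.coe_rpow_of_nonneg _ (by positivity),
      ENNReal.coe_mul, ENNReal.mul_rpow_of_nonneg _ _ (by positivity)]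
  let w (I : ℕ × (Fin n → ℤ)) : RSpace n → ℝ := (gridCube L I.1 I.2).indicator
    fun _ ↦ (⨍ y in gridCube L I.1 I.2, |b y - cI I| ^ k) ^ (1 / k : ℝ)
  refine (eLpNorm_le_mul_eLpNorm_of_ae_le_mul (g := fun x ↦ ∑ I ∈ S, w I x)
    (ae_restrict_of_forall_mem measurableSet_gridCube fun x hx ↦
      (h_dom x hx).trans (mul_le_mul_of_nonneg_left (le_abs_self _) (by positivity))) _).trans ?_
  have h_const : ENNReal.ofReal (1 + (2 * 2 ^ n) ^ (1 / k : ℝ)) =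
      ((1 + (2 * 2 ^ n) ^ (1 / k : ℝ) : ℝ≥0) : ℝ≥0∞) := by
    rw [← ENNReal.ofReal_coe_nnreal]; push_cast; rfl
  rw [dyadicAverageConst, h_const, ENNReal.coe_mul]
  refine mul_le_mul_right ((eLpNorm_restrict_le _ _ _ _).trans ?_) _
  simp only [← Finset.sum_coe_sort S]
  refine (h_sparse.eLpNorm_sum_le (fun I ↦ (gridRatio n * o I) ^ (1 / k : ℝ))
    (fun I x ↦ enorm_indicator_gridCube_le hn hL hb (cI I) I.1.1 I.1.2 x) hkr).trans ?_
  simp only [h_pow, mul_assoc, ← Finset.mul_sum, sparseConst, finrank_euclideanSpace_fin,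
    ENNReal.ofReal, ENNReal.coe_mul, ENNReal.coe_pow, ENNReal.coe_ofNat,
    ENNReal.coe_rpow_of_nonneg _ (one_div_nonneg.2 (zero_le_one.trans hkr.le)),
    ENNReal.coe_rpow_of_nonneg _ (zero_le_one.trans hr.le)]
  gcongr
  exact h h_sparse

theorem eLpNorm_sub_le_of_setAverage (hn : 0 < n) (hL : 0 < L) (hb : LocallyIntegrable b volume)
    {u V : ℝ≥0∞} {t : ℝ}
    (h : ∀ N, eLpNorm (fun x ↦ (⨍ y in gridCube L N (gridMap L N x), b y) - t) u
      (volume.restrict (gridCube L 0 0)) ≤ V) :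
    eLpNorm (fun x ↦ b x - t) u (volume.restrict (gridCube L 0 0)) ≤ V := by
  have h_meas (N : ℕ) : Measurable fun x : RSpace n ↦
      (⨍ y in gridCube L N (gridMap L N x), b y) - t :=
    (measurable_of_countable fun κ : Fin n → ℤ ↦ (⨍ y in gridCube L N κ, b y) - t).comp
      (measurable_gridMap L N)
  refine (Lp.eLpNorm_lim_le_liminf_eLpNorm (fun N ↦ (h_meas N).aestronglyMeasurable) _
    (ae_restrict_of_ae ?_)).trans (liminf_le_of_frequently_le' (.of_forall h))
  filter_upwards [ae_tendsto_setAverage_gridCube hn hL hb] with x hx using hx.sub_const t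

theorem enorm_sub_le_of_eLpNorm_sub_le {α : Type*} [MeasurableSpace α] {μ : Measure α}
    {F : Type*} [NormedAddCommGroup F] {u V : ℝ≥0∞} (hu : 1 ≤ u) (hu_top : u ≠ ∞)
    {f : α → F} (hf : AEStronglyMeasurable f μ) {s t : F}
    (hs : eLpNorm (fun x ↦ f x - s) u μ ≤ V) (ht : eLpNorm (fun x ↦ f x - t) u μ ≤ V) :
    ‖s - t‖ₑ * μ Set.univ ^ (1 / u.toReal) ≤ V + V := by
  rw [← eLpNorm_const' _ (zero_lt_one.trans_le hu).ne' hu_top]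
  calc eLpNorm (fun _ ↦ s - t) u μ = eLpNorm ((fun x ↦ f x - t) - fun x ↦ f x - s) u μ := by
        congr 1; ext x; simp
    _ ≤ V + V := (eLpNorm_sub_le (hf.sub aestronglyMeasurable_const)
        (hf.sub aestronglyMeasurable_const) hu).trans (add_le_add ht hs)

theorem exists_eLpNorm_sub_le {α F : Type*} [MeasurableSpace α] {μ : Measure α}
    [NormedAddCommGroup F] [ProperSpace F] {u V : ℝ≥0∞} (hu : 1 ≤ u) (hu_top : u ≠ ∞)
    (hV : V ≠ ∞) {A : ℕ → Set α} (hA : ∀ N, MeasurableSet (A N)) (hA_mono : Monotone A)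
    (hA_univ : ⋃ N, A N = Set.univ) (hA₀ : μ (A 0) ≠ 0) {f : α → F}
    (hf : AEStronglyMeasurable f μ)
    (h : ∀ N, ∃ t, eLpNorm (fun x ↦ f x - t) u (μ.restrict (A N)) ≤ V) :
    ∃ t, eLpNorm (fun x ↦ f x - t) u μ ≤ V := by
  choose t ht using h
  set M : ℝ≥0∞ := (V + V) / μ (A 0) ^ (1 / u.toReal)
  have hv : μ (A 0) ^ (1 / u.toReal) ≠ 0 := by simp [ENNReal.rpow_eq_zero_iff, hA₀]
  have hM : M ≠ ∞ := ENNReal.div_ne_top (by simp [hV]) hv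
  have h_bdd (N : ℕ) : t N ∈ Metric.closedBall (t 0) M.toReal := by
    have h_dist : ‖t N - t 0‖ₑ ≤ M := by
      refine (ENNReal.le_div_iff_mul_le (.inl hv) (.inr (by simp [hV]))).2 ?_
      rw [← Measure.restrict_apply_univ (A 0)]
      exact enorm_sub_le_of_eLpNorm_sub_le hu hu_top hf.restrict ((eLpNorm_mono_measure _
        (Measure.restrict_mono (hA_mono N.zero_le) le_rfl)).trans (ht N)) (ht 0)
    rw [mem_closedBall_iff_norm, ← toReal_enorm]
    exact ENNReal.toReal_mono hM h_dist
  obtain ⟨a, -, φ, hφ, h_lim⟩ := tendsto_subseq_of_bounded Metric.isBounded_closedBall h_bdd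
  refine ⟨a, (Lp.eLpNorm_lim_le_liminf_eLpNorm
    (f := fun N ↦ (A (φ N)).indicator fun x ↦ f x - t (φ N)) (fun N ↦
      (hf.sub aestronglyMeasurable_const).indicator (hA _)) _ (.of_forall fun x ↦ ?_)).trans
    (liminf_le_of_frequently_le' (.of_forall fun N ↦ ?_))⟩
  · obtain ⟨N₀, hN₀⟩ := Set.mem_iUnion.1 (hA_univ ▸ Set.mem_univ x)
    refine (h_lim.const_sub (f x)).congr' ?_
    filter_upwards [hφ.tendsto_atTop.eventually_ge_atTop N₀] with N hN
    exact (Set.indicator_of_mem (hA_mono hN hN₀) fun x ↦ f x - t (φ N)).symm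
  · rw [eLpNorm_indicator_eq_eLpNorm_restrict (hA _)]
    exact ht _

end GlobalBound

section Representatives

variable {n m k : ℕ} {u : ℝ≥0∞} {b b' : RSpace n → ℝ} {s p : Fin m → ℝ≥0∞} {s₀ q : ℝ≥0∞}
  {T : LpMultilinear n m s s₀} {i : Fin m}

theorem lpClass_congr_ae {f g : RSpace n → ℂ} (h : f =ᵐ[volume] g) : lpClass u f = lpClass u g := by
  by_cases hf : MemLp f u volume
  · have hg : MemLp g u volume := (memLp_congr_ae h).1 hf
    rw [lpClass, lpClass, dif_pos hf, dif_pos hg]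
    exact MemLp.toLp_congr hf hg h
  · have hg : ¬ MemLp g u volume := mt (memLp_congr_ae h).2 hf
    rw [lpClass, lpClass, dif_neg hf, dif_neg hg]

theorem iteratedCommutator_congr_ae (T : LpMultilinear n m s s₀) (hb : b =ᵐ[volume] b')
    (i : Fin m) (k : ℕ) {f f' : Fin m → RSpace n → ℂ} (hf : ∀ l, f l =ᵐ[volume] f' l) :
    iteratedCommutator b i k T.onFunctions f =ᵐ[volume]
      iteratedCommutator b' i k T.onFunctions f' := by
  induction k generalizing f f' with
  | zero =>
    simp only [iteratedCommutator, LpMultilinear.onFunctions, fun l ↦ lpClass_congr_ae (hf l)]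
    rfl
  | succ k ih =>
    have h_update : ∀ l, Function.update f i (fun z ↦ (b z : ℂ) * f i z) l =ᵐ[volume]
        Function.update f' i (fun z ↦ (b' z : ℂ) * f' i z) l := by
      intro l
      rcases eq_or_ne l i with rfl | hl
      · simp only [Function.update_self]
        filter_upwards [hb, hf l] with z hbz hfz
        rw [hbz, hfz]
      · simpa only [Function.update_of_ne hl] using hf l
    filter_upwards [hb, ih hf, ih h_update] with x hbx hx hx_update
    simp only [iteratedCommutator, slotCommutator, hbx, hx, hx_update]

theorem IsBoundedOnDomain.congr_ae (h : IsBoundedOnDomain (commutatorDomain s p b i k)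
      (iteratedCommutator b i k T.onFunctions) p q) (hb : b =ᵐ[volume] b') :
    IsBoundedOnDomain (commutatorDomain s p b' i k) (iteratedCommutator b' i k T.onFunctions)
      p q := by
  obtain ⟨C, hC⟩ := h
  refine ⟨C, fun f hf ↦ ?_⟩
  rw [← eLpNorm_congr_ae (iteratedCommutator_congr_ae T hb i k fun _ ↦ .rfl)]
  refine hC f ⟨hf.1, hf.2.1, fun j hj ↦ (memLp_congr_ae ?_).2 (hf.2.2 j hj)⟩
  filter_upwards [hb] with z hz
  rw [hz]

theorem MemLpLoc.aestronglyMeasurable (hb : MemLpLoc u b) : AEStronglyMeasurable b volume := by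
  rw [← Measure.restrict_univ (μ := volume), ← Metric.iUnion_ball_nat (0 : RSpace n)]
  exact aestronglyMeasurable_iUnion_iff.2 fun N ↦ (hb 0 N).1

theorem MemLpLoc.congr_ae (hb : MemLpLoc u b) (h : b =ᵐ[volume] b') : MemLpLoc u b' :=
  fun z R ↦ (memLp_congr_ae (ae_restrict_of_ae h)).1 (hb z R)

theorem MemLpModConst.congr_ae (hb : MemLpModConst u b) (h : b =ᵐ[volume] b') :
    MemLpModConst u b' := by
  have h_norm (t : ℝ) : eLpNorm (fun x ↦ b' x - t) u volume = eLpNorm (fun x ↦ b x - t) u volume :=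
    eLpNorm_congr_ae (h.symm.sub .rfl)
  exact ⟨hb.1.congr_ae h, by simpa only [h_norm] using hb.2⟩

theorem MemLpLoc.locallyIntegrable (hu : 1 ≤ u) (hb : MemLpLoc u b) :
    LocallyIntegrable b volume := by
  intro x
  have : IsFiniteMeasure (volume.restrict (Metric.ball x 1)) := ⟨by simpa using measure_ball_lt_top⟩
  exact ⟨Metric.ball x 1, Metric.ball_mem_nhds x one_pos, (hb x 1).integrable hu⟩

theorem memLpModConst_of_memLp_sub {t : ℝ} (h : MemLp (fun x ↦ b x - t) u volume) :
    MemLpModConst u b := by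
  refine ⟨fun z R ↦ ?_, (iInf_le _ t).trans_lt h.2⟩
  have : IsFiniteMeasure (volume.restrict (Metric.ball z R)) := ⟨by simpa using measure_ball_lt_top⟩
  simpa [Pi.add_def] using (h.restrict (Metric.ball z R)).add (memLp_const t)

end Representatives

section MainTheorem

variable {n k : ℕ} {b : RSpace n → ℝ}

theorem IsSparseOscillationBound.memLpModConst (hn : 0 < n) (hk : 1 ≤ k)
    (hb : MemLpLoc (k : ℝ≥0∞) b) {r : ℝ} (hr : 1 < r) {c : RSpace n → ℝ → ℝ} {V : ℝ≥0}
    (h : IsSparseOscillationBound (2 * gridRatio n) k r b c V) :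
    MemLpModConst (ENNReal.ofReal (k * r)) b := by
  have hk_one : (1 : ℝ≥0∞) ≤ k := by exact_mod_cast hk
  have hkr : 1 ≤ ENNReal.ofReal (k * r) :=
    ENNReal.one_le_ofReal.2 (one_le_mul_of_one_le_of_one_le (by exact_mod_cast hk) hr.le)
  have h_ball (N : ℕ) : ∃ t, eLpNorm (fun x ↦ b x - t) (ENNReal.ofReal (k * r))
      (volume.restrict (Metric.ball 0 (N + 1))) ≤ dyadicAverageConst n k r V := by
    have hL : (0 : ℝ) < 2 * (N + 1) := by positivity
    exact ⟨_, (eLpNorm_mono_measure _ (Measure.restrict_mono (ball_subset_gridCube hL le_rfl)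
      le_rfl)).trans (eLpNorm_sub_le_of_setAverage hn hL (hb.locallyIntegrable hk_one)
        (eLpNorm_setAverage_sub_le hn hL hk hb hr h))⟩
  obtain ⟨t, ht⟩ := exists_eLpNorm_sub_le hkr ENNReal.ofReal_ne_top ENNReal.coe_ne_top
    (fun _ ↦ measurableSet_ball) (fun _ _ h ↦ Metric.ball_subset_ball (by gcongr))
    (Metric.iUnion_ball_nat_succ 0) (by simpa using (Metric.measure_ball_pos _ _ one_pos).ne')
    hb.aestronglyMeasurable h_ball
  exact memLpModConst_of_memLp_sub ⟨hb.aestronglyMeasurable.sub aestronglyMeasurable_const,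
    ht.trans_lt ENNReal.coe_lt_top⟩

theorem one_lt_of_one_div_eq_sub {p q r : ℝ} (hq : 1 < q) (hqp : q < p)
    (hr : 1 / r = 1 / q - 1 / p) : 1 < r := by
  have hp_pos : 0 < 1 / p := one_div_pos.2 (by linarith)
  have hpq : 1 / p < 1 / q := one_div_lt_one_div_of_lt (by linarith) hqp
  have hq_inv : 1 / q < 1 := (div_lt_one (by linarith)).2 hq
  have hr_pos : 0 < r := one_div_pos.1 (by linarith)
  exact (div_lt_one hr_pos).1 (by linarith)

end MainTheorem

theorem theorem3p6_general (n m k : ℕ) (i : Fin m) (hk : 1 ≤ k)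
    (p q r : ℝ) (ps : Fin m → ℝ) (hq : 1 < q) (hqp : q < p) (hps : ∀ j, 1 < ps j)
    (hp : 1 / p = ∑ j, 1 / ps j) (hr : 1 / r = 1 / q - 1 / p)
    (s : Fin m → ℝ≥0∞) (s₀ : ℝ≥0∞) (T : LpMultilinear n m s s₀) (hT : IsNondegenerateCZO T)
    (b : RSpace n → ℝ) (hb : MemLpLoc (k : ℝ≥0∞) b)
    (hbdd : IsBoundedOnDomain
      (commutatorDomain s (fun j ↦ ENNReal.ofReal (ps j)) b i k)
      (iteratedCommutator b i k T.onFunctions)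
      (fun j ↦ ENNReal.ofReal (ps j)) (ENNReal.ofReal q)) :
    MemLpModConst (ENNReal.ofReal (k * r)) b := by
  have hn : 0 < n := by
    obtain ⟨-, K, C, ω, -, -, hK⟩ := hT
    exact hK.dim_pos
  have hr₁ : 1 < r := one_lt_of_one_div_eq_sub hq hqp hr
  let b' := hb.aestronglyMeasurable.mk b
  have hbb' : b =ᵐ[volume] b' := hb.aestronglyMeasurable.ae_eq_mk
  have hb'_meas : Measurable b' := hb.aestronglyMeasurable.stronglyMeasurable_mk.measurable
  have hb' : MemLpLoc (k : ℝ≥0∞) b' := hb.congr_ae hbb'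
  obtain ⟨V, c, h⟩ := exists_isSparseOscillationBound hT hb'_meas hb' (hbdd.congr_ae hbb') hq hps
    hr₁ (hp ▸ hr) (2 * gridRatio n)
  exact (h.memLpModConst hn hk hb' hr₁).congr_ae hbb'.symm

end

theorem theorem3p6 (n m k : ℕ) [NeZero m] (hm : 2 ≤ m) (hk : 1 ≤ k)
    (p q r : ℝ) (ps : Fin m → ℝ) (hq : 1 < q) (hqp : q < p) (hps : ∀ i, 1 < ps i)
    (hp : 1 / p = ∑ i, 1 / ps i) (hr : 1 / r = 1 / q - 1 / p)
    (s : Fin m → ℝ≥0∞) (s₀ : ℝ≥0∞) (T : LpMultilinear n m s s₀) (hT : IsNondegenerateCZO T)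
    (b : RSpace n → ℝ) (hb : MemLpLoc (k : ℝ≥0∞) b)
    (hbdd : IsBoundedOnDomain
      (commutatorDomain s (fun i => ENNReal.ofReal (ps i)) b 0 k)
      (iteratedCommutator b 0 k T.onFunctions)
      (fun i => ENNReal.ofReal (ps i)) (ENNReal.ofReal q)) :
    MemLpModConst (ENNReal.ofReal (k * r)) b :=
  theorem3p6_general n m k 0 hk p q r ps hq hqp hps hp hr s s₀ T hT b hb hbdd
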